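/- Let $k\ge 3$, let $X\subset\mathbb{R}^{k+1}$ be open, let $f,g_0,g_1$ be smooth ($C^\infty$) vector fields on $X$, and fix $x^*\in X$. Consider the two-input control-affine system $$\Sigma:\ \dot x=f(x)+u_0g_0(x)+u_1g_1(x).$$ Put $\mathcal G^0=\mathrm{span}\{g_0,g_1\}$ and $\mathcal G^{i+1}=\mathcal G^i+[\mathcal G^i,\mathcal G^i]$ for $i\ge 0$ (the derived flag), and let $\mathcal C^i$ be the characteristic distribution of $\mathcal G^i$, that is, the distribution spanned by the vector fields $c\in\mathcal G^i$ such that $[c,\mathcal G^i]\subset\mathcal G^i$. The triangular form $TCh_1^k$ is any system of the form $$\dot z_0=v_0,\qquad \dot z_j=f_j(z_0,\dots,z_{j+1})+z_{j+1}v_0\quad(1\le j\le k-1),\qquad \dot z_k=v_1,$$ with smooth functions $f_1,\dots,f_{k-1}$, on an open subset of $\mathbb{R}^{k+1}$. The system $\Sigma$ is called locally static feedback equivalent, around $x^*$, to $TCh_1^k$ if there are a smooth diffeomorphism $z=\phi(x)$ from an open neighbourhood of $x^*$ in $X$ onto an open subset of $\mathbb{R}^{k+1}$ and a smooth feedback $u=\alpha(x)+\beta(x)v$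 on that neighbourhood, with $\beta(x)\in GL(2,\mathbb{R})$ for every $x$, that transform $\Sigma$ into a system of the form $TCh_1^k$ (around $z^*=\phi(x^*)$). **Theorem.** The system $\Sigma$ is locally, around $x^*$, static feedback equivalent to $TCh_1^k$ if and only if there is an open neighbourhood $U\subset X$ of $x^*$ on which the following conditions hold (all distributions being taken for the restriction of $\Sigma$ to $U$): - (Ch1) $\mathcal G^{k-1}=TU$; - (Ch2) $\mathcal G^{k-3}$ has constant rank $k-1$, and the characteristic distribution $\mathcal C^{k-2}$ of $\mathcal G^{k-2}$ is contained in $\mathcal G^{k-3}$ and has constant corank one in $\mathcal G^{k-3}$; - (Ch3) $\mathcal G^0(x^*)$ is not contained in $\mathcal C^{k-2}(x^*)$; - (Comp) $[f,\mathcal C^i]\subset\mathcal G^i$ for $1\le i\le k-2$, i.e. $[f,c]\in\mathcal G^i$ for every vector field $c\in\mathcal G^i$ with $[c,\mathcal G^i]\subset\mathcal G^i$. -/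

import Mathlib

open scoped ContDiff

/-- A two-input control-affine system `ẋ = f(x) + u₀ g₀(x) + u₁ g₁(x)` with smooth vector fields on
an open subset `X` of `ℝⁿ`. The vector fields are functions on `ℝⁿ`, of which only the restrictions
to `X` matter. -/
structure ControlAffineSystem (n : ℕ) where
  /-- the state space -/
  X : Set (Fin n → ℝ)
  isOpen_X : IsOpen X
  /-- the drift -/
  f : (Fin n → ℝ) → (Fin n → ℝ)
  /-- the two controlled vector fields -/
  g : Fin 2 → (Fin n → ℝ) → (Fin n → ℝ)
  smooth_f : ContDiffOn ℝ ∞ f X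
  smooth_g : ∀ i, ContDiffOn ℝ ∞ (g i) X

/-- The systems `S` around `x₀` and `T` around `z₀` are locally static feedback equivalent: there are
a smooth local diffeomorphism `z = φ(x)` with `φ(x₀) = z₀` and a smooth invertible feedback
`u = α(x) + β(x) v`, both defined near `x₀`, that transform `S` into `T`. -/
def StaticFeedbackEquivalent {n : ℕ} (S : ControlAffineSystem n) (x₀ : Fin n → ℝ)
    (T : ControlAffineSystem n) (z₀ : Fin n → ℝ) : Prop :=
  ∃ (φ : OpenPartialHomeomorph (Fin n → ℝ) (Fin n → ℝ))
    (α : (Fin n → ℝ) → (Fin 2 → ℝ))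
    (β : (Fin n → ℝ) → Fin 2 → Fin 2 → ℝ),
    x₀ ∈ φ.source ∧ φ x₀ = z₀ ∧ φ.source ⊆ S.X ∧ φ.target ⊆ T.X ∧
    ContDiffOn ℝ ∞ φ φ.source ∧ ContDiffOn ℝ ∞ φ.symm φ.target ∧
    ContDiffOn ℝ ∞ α φ.source ∧ ContDiffOn ℝ ∞ β φ.source ∧
    ∀ x ∈ φ.source,
      IsUnit (Matrix.of (β x)).det ∧
      fderiv ℝ φ x (S.f x + ∑ i, α x i • S.g i x) = T.f (φ x) ∧
      ∀ j, fderiv ℝ φ x (∑ i, β x i j • S.g i x) = T.g j (φ x)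

/-- A system on an open subset of `ℝ^(k+1)`, with coordinates `z_0, …, z_k`, is in the triangular
form compatible with the chained form if it reads
`ż_0 = v₀`,  `ż_j = h_j(z_0, …, z_{j+1}) + z_{j+1} v₀` for `1 ≤ j ≤ k - 1`,  `ż_k = v₁`,
with smooth functions `h_1, …, h_{k-1}`. -/
def IsTriangularChainedForm {k : ℕ} (T : ControlAffineSystem (k + 1)) : Prop :=
  ∃ h : (j : ℕ) → (Fin (j + 2) → ℝ) → ℝ,
    (∀ (j : ℕ) (_ : 1 ≤ j) (hjk : j < k),
      ContDiffOn ℝ ∞ (h j)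
        ((fun (z : Fin (k + 1) → ℝ) (l : Fin (j + 2)) => z (Fin.castLE (by omega) l)) '' T.X)) ∧
    ∀ z ∈ T.X,
      -- the equation of `z_0`
      (T.f z 0 = 0 ∧ T.g 0 z 0 = 1 ∧ T.g 1 z 0 = 0) ∧
      -- the equations of `z_1, …, z_{k-1}`
      (∀ (j : ℕ) (_ : 1 ≤ j) (hjk : j < k),
        T.f z ⟨j, by omega⟩ = h j (fun l => z (Fin.castLE (by omega) l)) ∧
        T.g 0 z ⟨j, by omega⟩ = z ⟨j + 1, by omega⟩ ∧
        T.g 1 z ⟨j, by omega⟩ = 0) ∧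
      -- the equation of `z_k`
      (T.f z (Fin.last k) = 0 ∧ T.g 0 z (Fin.last k) = 0 ∧ T.g 1 z (Fin.last k) = 1)

/-- A (possibly singular) distribution assigns a linear subspace of the tangent space `ℝⁿ` to each
point. -/
abbrev TangentDistribution (n : ℕ) : Type := (Fin n → ℝ) → Submodule ℝ (Fin n → ℝ)

namespace TangentDistribution

variable {n : ℕ}

/-- The smooth vector fields on `U` that belong to the distribution `D`. -/
def sections (D : TangentDistribution n) (U : Set (Fin n → ℝ)) : Set ((Fin n → ℝ) → (Fin n → ℝ)) :=
  {V | ContDiffOn ℝ ∞ V U ∧ ∀ x ∈ U, V x ∈ D x}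

/-- The distribution `D + [D, D]` on the open set `U`. -/
def derived (D : TangentDistribution n) (U : Set (Fin n → ℝ)) : TangentDistribution n := fun x =>
  D x ⊔ Submodule.span ℝ
    {w | ∃ V ∈ D.sections U, ∃ W ∈ D.sections U, w = VectorField.lieBracket ℝ V W x}

/-- The derived flag of `D` on the open set `U`: `D^0 = D`, `D^{i+1} = D^i + [D^i, D^i]`. -/
def derivedFlag (D : TangentDistribution n) (U : Set (Fin n → ℝ)) : ℕ → TangentDistribution n
  | 0 => D
  | i + 1 => (derivedFlag D U i).derived U

/-- The characteristic vector fields of `D` on the open set `U`: those `c ∈ D` with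
`[c, D] ⊆ D`. -/
def characteristicFields (D : TangentDistribution n) (U : Set (Fin n → ℝ)) :
    Set ((Fin n → ℝ) → (Fin n → ℝ)) :=
  {c | c ∈ D.sections U ∧
    ∀ V ∈ D.sections U, ∀ x ∈ U, VectorField.lieBracket ℝ c V x ∈ D x}

/-- The characteristic distribution of `D` on `U`, spanned by the characteristic vector fields. -/
def characteristic (D : TangentDistribution n) (U : Set (Fin n → ℝ)) : TangentDistribution n := fun x =>
  Submodule.span ℝ {w | ∃ c ∈ D.characteristicFields U, w = c x}

end TangentDistribution

namespace ControlAffineSystem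

variable {n : ℕ}

/-- The distribution spanned by the controlled vector fields. -/
def controlDistribution (S : ControlAffineSystem n) : TangentDistribution n := fun x =>
  Submodule.span ℝ (Set.range fun i => S.g i x)

/-- The derived flag `𝒢^i` of the distribution spanned by the controlled vector fields, on `U`. -/
def G (S : ControlAffineSystem n) (U : Set (Fin n → ℝ)) (i : ℕ) : TangentDistribution n :=
  S.controlDistribution.derivedFlag U i

/-- The characteristic distribution `𝒞^i` of `𝒢^i`, on `U`. -/
def C (S : ControlAffineSystem n) (U : Set (Fin n → ℝ)) (i : ℕ) : TangentDistribution n :=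
  (S.G U i).characteristic U

/-- (Ch1) `𝒢^{k-1} = TX` on `U`. -/
def Ch1 {k : ℕ} (S : ControlAffineSystem (k + 1)) (U : Set (Fin (k + 1) → ℝ)) : Prop :=
  ∀ x ∈ U, S.G U (k - 1) x = ⊤

/-- (Ch2) On `U`, `𝒢^{k-3}` has constant rank `k - 1`, and `𝒞^{k-2}` is contained in `𝒢^{k-3}` with
constant corank one. -/
def Ch2 {k : ℕ} (S : ControlAffineSystem (k + 1)) (U : Set (Fin (k + 1) → ℝ)) : Prop :=
  ∀ x ∈ U,
    Module.finrank ℝ (S.G U (k - 3) x) = k - 1 ∧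
    S.C U (k - 2) x ≤ S.G U (k - 3) x ∧
    Module.finrank ℝ (S.C U (k - 2) x) + 1 = Module.finrank ℝ (S.G U (k - 3) x)

/-- (Ch3) `𝒢^0(x₀)` is not contained in `𝒞^{k-2}(x₀)`. -/
def Ch3 {k : ℕ} (S : ControlAffineSystem (k + 1)) (U : Set (Fin (k + 1) → ℝ))
    (x₀ : Fin (k + 1) → ℝ) : Prop :=
  ¬ S.G U 0 x₀ ≤ S.C U (k - 2) x₀

/-- (Comp) `[f, 𝒞^i] ⊆ 𝒢^i` on `U` for `1 ≤ i ≤ k - 2`. -/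
def Comp {k : ℕ} (S : ControlAffineSystem (k + 1)) (U : Set (Fin (k + 1) → ℝ)) : Prop :=
  ∀ i, 1 ≤ i → i ≤ k - 2 → ∀ c ∈ (S.G U i).characteristicFields U, ∀ x ∈ U,
    VectorField.lieBracket ℝ S.f c x ∈ S.G U i x

end ControlAffineSystem

/-!
The conditions do not depend on the choice of the controls spanning `𝒢⁰` and are transported by
diffeomorphisms, so both directions are about functions `z_0, …, z_k` and the one-forms
`dz_m - z_{m+1} dz_0`.

Necessity. In the coordinates of the triangular form, `𝒢^i` is the annihilator of the forms
`dz_m - z_{m+1} dz_0` with `1 ≤ m ≤ k - 1 - i` (`IsAdaptedChart.G_eq`, by induction on `i` from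
Cartan's formula `contactForm_lieBracket`), and for `1 ≤ i ≤ k - 2` the distribution `𝒞^i` is the
annihilator of `dz_0, …, dz_{k-i}`. The rank conditions can be read off, and (Comp) holds because
the drift component `f_j` depends on `z_0, …, z_{j+1}` only.

Sufficiency. The distribution `𝒞^{k-2}` has rank `k - 2` and is involutive by the Jacobi identity;
let `g` be one of the two control fields, not in `𝒞^{k-2}` at `x₀`. Frobenius' theorem gives a first
integral `z_0` of `𝒞^{k-2}` with `g(z_0) ≠ 0`. Next, `𝒢^{k-2}` has rank exactly `k`: it is not the
whole tangent space, since otherwise `𝒞^{k-2}` would be, and it is larger than the span of `𝒞^{k-2}`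
and `g` (`IsCharacteristicFrame.exists_section_notMem`). Constancy of this rank is not assumed, and
a drop at `x₀` alone is excluded by (Ch1): two forms `dw_i - (g(w_i) / g(z_0)) dz_0` annihilating
`𝒢^{k-2}` at `x₀` take proportional values on its sections nearby, hence on their brackets at `x₀`.
So `𝒢^{k-2} ∩ ker dz_0` is involutive of rank `k - 1` and has a first integral `z_1`. Put
`z_{m+1} = g(z_m) / g(z_0)`. Then `dz_1 - z_2 dz_0` annihilates `𝒢^{k-2}`, and Cartan's formula
propagates this down the derived flag: `𝒢^i` is annihilated by `dz_m - z_{m+1} dz_0` for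
`1 ≤ m ≤ k - 1 - i` (`IsContactSequence.G_le_contactDistribution`). By (Ch1) the functions
`z_0, …, z_k` are coordinates and the control fields, after a feedback, are in chained form; (Comp)
says that the drift is triangular in them (`IsContactSequence.exists_triangularChainedForm`).

The form of Frobenius' theorem that is needed, `exists_firstIntegral_of_involutive`, rests on the
smooth dependence of integral curves on the initial point (`exists_local_flow`), which is obtained
by applying the inverse function theorem to the integral equation in a space of continuous curves.
-/

open scoped Topology
open Set Filter

/-! ### Smooth dependence of integral curves on the initial point -/

section Flow

universe u

/-- The inverse function theorem, with smoothness of the inverse on a whole neighbourhood. -/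
theorem exists_openPartialHomeomorph_contDiffOn_symm {E F : Type*} [NormedAddCommGroup E]
    [NormedSpace ℝ E] [CompleteSpace E] [NormedAddCommGroup F] [NormedSpace ℝ F] {f : E → F} {a : E}
    (hf : ∀ᶠ x in 𝓝 a, ContDiffAt ℝ ∞ f x) {f' : E ≃L[ℝ] F}
    (hf' : HasFDerivAt f (f' : E →L[ℝ] F) a) :
    ∃ e : OpenPartialHomeomorph E F, a ∈ e.source ∧ (e : E → F) = f ∧
      (∀ x ∈ e.source, ContDiffAt ℝ ∞ f x) ∧ (∀ y ∈ e.target, ContDiffAt ℝ ∞ e.symm y) := by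
  have ha : ContDiffAt ℝ ∞ f a := hf.self_of_nhds
  let e := ha.toOpenPartialHomeomorph f hf' (by simp)
  have hinv : ∀ᶠ x in 𝓝 a, fderiv ℝ f x ∈ range ((↑) : (E ≃L[ℝ] F) → E →L[ℝ] F) := by
    have hc : ContinuousAt (fderiv ℝ f) a := (ha.fderiv_right (m := 0) (by simp)).continuousAt
    refine hc.eventually_mem (ContinuousLinearEquiv.nhds f' |> fun h => ?_)
    rw [hf'.fderiv]; exact h
  obtain ⟨s, hs, hso, has⟩ := eventually_nhds_iff.1 (hf.and hinv)
  refine ⟨e.restrOpen s hso, ⟨ha.mem_toOpenPartialHomeomorph_source hf' (by simp), has⟩, ?_, ?_, ?_⟩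
  · rfl
  · intro x hx; exact (hs x hx.2).1
  · intro y hy
    have hy' := (e.restrOpen s hso).map_target hy
    obtain ⟨h1, A, hA⟩ := hs _ hy'.2
    refine OpenPartialHomeomorph.contDiffAt_symm (f₀' := A) _ hy ?_ h1
    rw [hA]
    exact (h1.differentiableAt (by simp)).hasFDerivAt

variable {K : Type*} [TopologicalSpace K] [CompactSpace K]

/-- Pointwise evaluation of a family of operators on a family of vectors. -/
noncomputable def ContinuousMap.applyCLM (K : Type*) [TopologicalSpace K] [CompactSpace K]
    (E F : Type*) [NormedAddCommGroup E] [NormedSpace ℝ E] [NormedAddCommGroup F]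
    [NormedSpace ℝ F] : C(K, E →L[ℝ] F) →L[ℝ] C(K, E) →L[ℝ] C(K, F) :=
  LinearMap.mkContinuous₂
    (LinearMap.mk₂ ℝ (fun (A : C(K, E →L[ℝ] F)) (u : C(K, E)) =>
        (⟨fun t => A t (u t), by fun_prop⟩ : C(K, F)))
      (by intros; ext; simp) (by intros; ext; simp) (by intros; ext; simp) (by intros; ext; simp))
    1 (by
      intro A u
      rw [one_mul]
      refine (ContinuousMap.norm_le _ (by positivity)).2 fun t => ?_
      exact ((A t).le_opNorm_of_le (u.norm_coe_le_norm t)).trans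
        (mul_le_mul_of_nonneg_right (A.norm_coe_le_norm t) (norm_nonneg _)))

/-- The superposition operator `u ↦ V ∘ u` on continuous maps. -/
def ContinuousMap.superposition (K : Type*) [TopologicalSpace K] {E F : Type*} [TopologicalSpace E]
    [TopologicalSpace F] (V : C(E, F)) (u : C(K, E)) : C(K, F) := V.comp u

theorem hasFDerivAt_superposition {E F : Type*} [NormedAddCommGroup E] [NormedSpace ℝ E]
    [NormedAddCommGroup F] [NormedSpace ℝ F] (V : C(E, F)) (V' : C(E, E →L[ℝ] F))
    (h : ∀ x, HasFDerivAt V (V' x) x) (u : C(K, E)) :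
    HasFDerivAt (ContinuousMap.superposition K V)
      (ContinuousMap.applyCLM K E F (ContinuousMap.superposition K V' u)) u := by
  rw [hasFDerivAt_iff_isLittleO_nhds_zero, Asymptotics.isLittleO_iff]
  intro ε hε
  have hc : Continuous (ContinuousMap.superposition K V' : C(K, E) → C(K, E →L[ℝ] F)) :=
    ContinuousMap.continuous_postcomp V'
  obtain ⟨δ, hδ, hball⟩ := Metric.mem_nhds_iff.1 (hc.continuousAt.preimage_mem_nhds
    (Metric.ball_mem_nhds (ContinuousMap.superposition K V' u) hε))
  filter_upwards [Metric.ball_mem_nhds (0 : C(K, E)) hδ] with w hw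
  refine (ContinuousMap.norm_le _ (by positivity)).2 fun t => ?_
  have hseg : ∀ y ∈ segment ℝ (u t) (u t + w t), ‖V' y - V' (u t)‖ ≤ ε := by
    intro y hy
    rw [segment_eq_image'] at hy
    obtain ⟨θ, hθ, rfl⟩ := hy
    have h1 : dist (u + θ • w) u < δ := by
      rw [dist_eq_norm, add_sub_cancel_left, norm_smul, Real.norm_of_nonneg hθ.1]
      rw [mem_ball_zero_iff] at hw
      nlinarith [norm_nonneg w, hθ.2]
    have h2 := (ContinuousMap.dist_lt_iff hε).1 (Metric.mem_ball.1 (hball (Metric.mem_ball.2 h1))) t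
    rw [dist_eq_norm] at h2
    simpa [ContinuousMap.superposition] using h2.le
  have := (convex_segment (𝕜 := ℝ) (u t) (u t + w t)).norm_image_sub_le_of_norm_hasFDerivWithin_le'
    (f := V) (f' := V') (φ := V' (u t)) (C := ε) (fun y _ => (h y).hasFDerivWithinAt) hseg
    (left_mem_segment _ _ _) (right_mem_segment _ _ _)
  simp only [add_sub_cancel_left] at this
  refine le_trans ?_ (this.trans (by gcongr; exact w.norm_coe_le_norm t))
  simp [ContinuousMap.superposition, ContinuousMap.applyCLM]

/-- The superposition operator of a smooth map is smooth: its derivative is again built from a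
superposition operator, so that one may induct on the order of differentiability. -/
theorem contDiff_superposition {E : Type u} [NormedAddCommGroup E] [NormedSpace ℝ E] (n : ℕ) :
    ∀ {F : Type u} [NormedAddCommGroup F] [NormedSpace ℝ F] (V : C(E, F)), ContDiff ℝ ∞ V →
      ContDiff ℝ n (ContinuousMap.superposition K V) := by
  induction n with
  | zero =>
    intro F _ _ V _
    exact contDiff_zero.2 (ContinuousMap.continuous_postcomp V)
  | succ n ih =>
    intro F _ _ V hV
    let V' : C(E, E →L[ℝ] F) := ⟨fderiv ℝ V, hV.continuous_fderiv (by simp)⟩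
    have hV' : ContDiff ℝ ∞ V' := hV.fderiv_right (by simp)
    have hd := hasFDerivAt_superposition (K := K) V V'
      fun x => (hV.differentiable (by simp) x).hasFDerivAt
    rw [Nat.cast_succ]
    refine (contDiff_succ_iff_hasFDerivAt (n := n)).2 ⟨_, ?_, hd⟩
    exact (ContinuousMap.applyCLM K E F).contDiff.comp (ih V' hV')

/-- The linear operator sending a curve on `[-1, 1]` to its primitive that vanishes at `0`. -/
noncomputable def primitiveCLM (E : Type*) [NormedAddCommGroup E] [NormedSpace ℝ E] :
    C(Icc (-1 : ℝ) 1, E) →L[ℝ] C(Icc (-1 : ℝ) 1, E) :=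
  LinearMap.mkContinuous
    { toFun := fun u => ⟨fun t => ∫ τ in (0 : ℝ)..t, IccExtend (by norm_num) u τ, by
        have : Continuous (IccExtend (by norm_num : (-1 : ℝ) ≤ 1) u) := u.continuous.Icc_extend'
        exact (intervalIntegral.continuous_primitive
          (fun a b => this.intervalIntegrable a b) 0).comp continuous_subtype_val⟩
      map_add' := fun u v => by
        ext t
        exact intervalIntegral.integral_add (u.continuous.Icc_extend'.intervalIntegrable _ _)
          (v.continuous.Icc_extend'.intervalIntegrable _ _)
      map_smul' := fun c u => by
        ext t
        exact intervalIntegral.integral_smul c _ }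
    1 (by
      intro u
      rw [one_mul]
      refine (ContinuousMap.norm_le _ (by positivity)).2 fun t => ?_
      have h := intervalIntegral.norm_integral_le_of_norm_le_const (a := 0) (b := (t : ℝ)) (C := ‖u‖)
        (f := IccExtend (by norm_num : (-1 : ℝ) ≤ 1) u) fun τ _ => u.norm_coe_le_norm _
      refine h.trans (mul_le_of_le_one_right (norm_nonneg _) ?_)
      rw [sub_zero, abs_le]
      exact t.2)

/-- The constant curves, as a continuous linear map. -/
noncomputable def constCLM (K : Type*) [TopologicalSpace K] [CompactSpace K] (E : Type*)
    [NormedAddCommGroup E] [NormedSpace ℝ E] : E →L[ℝ] C(K, E) :=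
  LinearMap.mkContinuous
    { toFun := fun x => ContinuousMap.const K x
      map_add' := fun _ _ => rfl
      map_smul' := fun _ _ => rfl }
    1 (by
      intro x
      rw [one_mul]
      exact (ContinuousMap.norm_le _ (norm_nonneg _)).2 fun t => le_rfl)

/-- The equation `u = x + s ∫ V(u)` for a curve `u` on `[-1, 1]`, together with its parameters
`(s, x)`: a solution is an integral curve of `s V` through `x`. At `s = 0` the linearization
in `u` is the identity, whatever `V` is. -/
noncomputable def integralCurveEquation {E : Type*} [NormedAddCommGroup E] [NormedSpace ℝ E]
    (V : C(E, E)) (p : (ℝ × E) × C(Icc (-1 : ℝ) 1, E)) : (ℝ × E) × C(Icc (-1 : ℝ) 1, E) :=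
  (p.1, p.2 - constCLM _ E p.1.2 -
    p.1.1 • primitiveCLM E (ContinuousMap.superposition _ V p.2))

theorem contDiff_integralCurveEquation {E : Type u} [NormedAddCommGroup E] [NormedSpace ℝ E]
    (V : C(E, E)) (hV : ContDiff ℝ ∞ V) : ContDiff ℝ ∞ (integralCurveEquation V) := by
  have h : ContDiff ℝ ∞ (ContinuousMap.superposition (Icc (-1 : ℝ) 1) V) :=
    contDiff_infty.2 fun n => contDiff_superposition n V hV
  unfold integralCurveEquation
  have h1 := (constCLM (Icc (-1 : ℝ) 1) E).contDiff (n := ∞)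
  have h2 := (primitiveCLM E).contDiff (n := ∞)
  fun_prop

theorem hasFDerivAt_integralCurveEquation {E : Type u} [NormedAddCommGroup E] [NormedSpace ℝ E]
    (V : C(E, E)) (hV : ContDiff ℝ ∞ V) (x₀ : E) :
    ∃ A : ((ℝ × E) × C(Icc (-1 : ℝ) 1, E)) ≃L[ℝ] ((ℝ × E) × C(Icc (-1 : ℝ) 1, E)),
      HasFDerivAt (integralCurveEquation V)
        (A : ((ℝ × E) × C(Icc (-1 : ℝ) 1, E)) →L[ℝ] ((ℝ × E) × C(Icc (-1 : ℝ) 1, E)))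
        ((0, x₀), constCLM _ E x₀) := by
  set c : C(Icc (-1 : ℝ) 1, E) := constCLM _ E x₀
  -- The derivative is `(s, x, u) ↦ (s, x, u - B (s, x))`, with inverse `u ↦ u + B (s, x)`.
  let w := primitiveCLM E (ContinuousMap.superposition _ V c)
  let B : (ℝ × E) →L[ℝ] C(Icc (-1 : ℝ) 1, E) :=
    (constCLM _ E).comp (ContinuousLinearMap.snd ℝ ℝ E) +
      (ContinuousLinearMap.fst ℝ ℝ E).smulRight w
  let P := ContinuousLinearMap.fst ℝ (ℝ × E) C(Icc (-1 : ℝ) 1, E)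
  let Q := ContinuousLinearMap.snd ℝ (ℝ × E) C(Icc (-1 : ℝ) 1, E)
  let A : ((ℝ × E) × C(Icc (-1 : ℝ) 1, E)) ≃L[ℝ] ((ℝ × E) × C(Icc (-1 : ℝ) 1, E)) :=
    ContinuousLinearEquiv.equivOfInverse (P.prod (Q - B.comp P)) (P.prod (Q + B.comp P))
      (fun p => by simp [P, Q]) (fun p => by simp [P, Q])
  refine ⟨A, ?_⟩
  have h : ContDiff ℝ ∞ (ContinuousMap.superposition (Icc (-1 : ℝ) 1) V) :=
    contDiff_infty.2 fun n => contDiff_superposition n V hV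
  have h1 : HasFDerivAt (fun p : (ℝ × E) × C(Icc (-1 : ℝ) 1, E) =>
      primitiveCLM E (ContinuousMap.superposition _ V p.2))
      (fderiv ℝ (fun p : (ℝ × E) × C(Icc (-1 : ℝ) 1, E) =>
      primitiveCLM E (ContinuousMap.superposition _ V p.2)) ((0, x₀), c)) ((0, x₀), c) := by
    refine DifferentiableAt.hasFDerivAt ?_
    exact (((primitiveCLM E).contDiff (n := ∞)).comp (h.comp contDiff_snd)).differentiable
      (by simp) _
  have h2 := (((ContinuousLinearMap.fst ℝ ℝ E).comp P).hasFDerivAt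
    (x := (((0 : ℝ), x₀), c))).smul h1
  have h3 := ((((constCLM (Icc (-1 : ℝ) 1) E).comp
    ((ContinuousLinearMap.snd ℝ ℝ E).comp P)).hasFDerivAt (x := (((0 : ℝ), x₀), c))))
  have h4 := (P.hasFDerivAt (x := (((0 : ℝ), x₀), c))).prodMk
    (((Q.hasFDerivAt (x := (((0 : ℝ), x₀), c))).sub h3).sub h2)
  refine h4.congr_fderiv ?_
  ext p <;> simp [A, P, Q, B, w]

/-- Evaluation of the equation of integral curves: the solution is differentiable with the expected
derivative. -/
theorem hasDerivAt_of_integralCurveEquation {E : Type u} [NormedAddCommGroup E] [NormedSpace ℝ E]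
    [CompleteSpace E] {V : C(E, E)} {q : ℝ × E} {u : C(Icc (-1 : ℝ) 1, E)}
    (hu : integralCurveEquation V (q, u) = (q, 0)) {t : ℝ} (ht : t ∈ Ioo (-1 : ℝ) 1) :
    HasDerivAt (IccExtend (by norm_num) u) (q.1 • V (IccExtend (by norm_num) u t)) t := by
  have hle : (-1 : ℝ) ≤ 1 := by norm_num
  have hc : Continuous (fun τ => V (IccExtend hle u τ)) :=
    V.continuous.comp u.continuous.Icc_extend'
  have h1 : HasDerivAt (fun t => q.2 + q.1 • ∫ τ in (0 : ℝ)..t, V (IccExtend hle u τ))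
      (q.1 • V (IccExtend hle u t)) t :=
    ((hc.integral_hasStrictDerivAt 0 t).hasDerivAt.const_smul q.1).const_add q.2
  refine h1.congr_of_eventuallyEq ?_
  filter_upwards [Ioo_mem_nhds ht.1 ht.2] with s hs
  have h2 := congrArg (fun w => w ⟨s, hs.1.le, hs.2.le⟩) (congrArg Prod.snd hu)
  have h3 : u ⟨s, hs.1.le, hs.2.le⟩ - q.2 -
      q.1 • (∫ τ in (0 : ℝ)..s, V (IccExtend hle u τ)) = 0 := h2
  rw [IccExtend_of_mem hle u ⟨hs.1.le, hs.2.le⟩]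
  rw [sub_sub, sub_eq_zero] at h3
  exact h3

/-- Reparametrizing a solution of `u = x + s ∫ V(u)` by `t ↦ σ t` gives a solution for `σ s`. -/
theorem integralCurveEquation_rescale {E : Type u} [NormedAddCommGroup E] [NormedSpace ℝ E]
    {V : C(E, E)} {q : ℝ × E} {u : C(Icc (-1 : ℝ) 1, E)}
    (hu : integralCurveEquation V (q, u) = (q, 0)) {σ : ℝ} (hσ : σ ∈ Icc (-1 : ℝ) 1) :
    ∃ v : C(Icc (-1 : ℝ) 1, E), integralCurveEquation V ((σ * q.1, q.2), v) = ((σ * q.1, q.2), 0) ∧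
      (∀ x, dist v (constCLM _ E x) ≤ dist u (constCLM _ E x)) ∧
      v ⟨1, by norm_num⟩ = IccExtend (by norm_num) u σ := by
  have hle : (-1 : ℝ) ≤ 1 := by norm_num
  have hmem : ∀ t ∈ Icc (-1 : ℝ) 1, σ * t ∈ Icc (-1 : ℝ) 1 := by
    intro t ht
    rw [mem_Icc, ← abs_le] at *
    rw [abs_mul]
    nlinarith [abs_nonneg σ, abs_nonneg t]
  let v : C(Icc (-1 : ℝ) 1, E) := ⟨fun t => IccExtend hle u (σ * t),
    u.continuous.Icc_extend'.comp (by fun_prop)⟩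
  refine ⟨v, ?_, ?_, ?_⟩
  · refine Prod.ext rfl ?_
    ext t
    have h2 := congrArg (fun w => w ⟨σ * t, hmem t t.2⟩) (congrArg Prod.snd hu)
    have h3 : u ⟨σ * t, hmem t t.2⟩ - q.2 -
      q.1 • (∫ τ in (0 : ℝ)..(σ * t), V (IccExtend hle u τ)) = 0 := h2
    change IccExtend hle u (σ * t) - q.2 - (σ * q.1) •
      (∫ τ in (0 : ℝ)..t, V (IccExtend hle v τ)) = 0
    have h4 : (∫ τ in (0 : ℝ)..t, V (IccExtend hle v τ)) =
        ∫ τ in (0 : ℝ)..t, V (IccExtend hle u (σ * τ)) := by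
      refine intervalIntegral.integral_congr fun τ hτ => ?_
      have hτ' : τ ∈ Icc (-1 : ℝ) 1 := by
        refine (uIcc_subset_Icc ?_ t.2) hτ
        norm_num
      rw [IccExtend_of_mem hle v hτ']
      rfl
    have h5 := intervalIntegral.smul_integral_comp_mul_left (a := 0) (b := (t : ℝ))
      (fun τ => V (IccExtend hle u τ)) σ
    rw [mul_zero] at h5
    rw [h4, IccExtend_of_mem hle u (hmem t t.2), mul_comm σ q.1, mul_smul]
    exact (congrArg (fun w => u ⟨σ * t, hmem t t.2⟩ - q.2 - q.1 • w) h5).trans h3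
  · intro x
    refine (ContinuousMap.dist_le dist_nonneg).2 fun t => ?_
    exact ContinuousMap.dist_apply_le_dist (f := u) (g := constCLM _ E x) (projIcc _ _ hle (σ * t))
  · simp [v]

/-- Smooth local flow of a vector field that is smooth on the whole space. The inverse function
theorem solves the integral equation smoothly in `(s, x)`, and `Φ (s, x)` is the value at time `1` of
the solution. By uniqueness of solutions near the constant one, all these values for small `s` lie on
a single integral curve. -/
theorem exists_local_flow_of_contDiff {E : Type u} [NormedAddCommGroup E] [NormedSpace ℝ E]
    [CompleteSpace E] (V : C(E, E)) (hV : ContDiff ℝ ∞ V) (x₀ : E) :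
    ∃ Φ : ℝ × E → E, (∀ᶠ p in 𝓝 ((0 : ℝ), x₀), ContDiffAt ℝ ∞ Φ p) ∧
      (∀ᶠ x in 𝓝 x₀, Φ (0, x) = x) ∧
      ∀ᶠ p in 𝓝 ((0 : ℝ), x₀), HasDerivAt (fun s => Φ (s, p.2)) (V (Φ p)) p.1 := by
  obtain ⟨A, hA⟩ := hasFDerivAt_integralCurveEquation V hV x₀
  obtain ⟨e, he₀, hef, -, hes⟩ := exists_openPartialHomeomorph_contDiffOn_symm
    (Eventually.of_forall fun x => (contDiff_integralCurveEquation V hV).contDiffAt) hA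
  have hval : integralCurveEquation V (((0 : ℝ), x₀), constCLM _ E x₀) = ((0, x₀), 0) := by
    simp [integralCurveEquation]
  have hle : (-1 : ℝ) ≤ 1 := by norm_num
  set p₀ : (ℝ × E) × C(Icc (-1 : ℝ) 1, E) := ((0, x₀), constCLM _ E x₀)
  let ι : ℝ × E → (ℝ × E) × C(Icc (-1 : ℝ) 1, E) := fun q => (q, 0)
  have hι : ContDiff ℝ ∞ ι := by fun_prop
  have hιt : ∀ᶠ q in 𝓝 ((0 : ℝ), x₀), ι q ∈ e.target := by
    refine hι.continuous.continuousAt.eventually_mem (e.open_target.mem_nhds ?_)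
    have := e.map_source he₀
    rw [hef, hval] at this
    exact this
  let u : ℝ × E → C(Icc (-1 : ℝ) 1, E) := fun q => (e.symm (ι q)).2
  have hsol : ∀ q, ι q ∈ e.target → e.symm (ι q) = (q, u q) ∧
      integralCurveEquation V (q, u q) = (q, 0) := by
    intro q hq
    have h1 := e.right_inv hq
    rw [hef] at h1
    have h2 : (e.symm (ι q)).1 = q := congrArg Prod.fst h1
    have h3 : e.symm (ι q) = (q, u q) := Prod.ext h2 rfl
    exact ⟨h3, by rw [h3] at h1; exact h1⟩
  let ev : C(Icc (-1 : ℝ) 1, E) →L[ℝ] E := ContinuousMap.evalCLM ℝ ⟨1, by norm_num⟩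
  have hu : ∀ q, ι q ∈ e.target → ContDiffAt ℝ ∞ u q := fun q hq =>
    contDiffAt_snd.comp q ((hes _ hq).comp q hι.contDiffAt)
  have hu₀ : u (0, x₀) = constCLM _ E x₀ := by
    have := e.left_inv he₀
    rw [hef, hval] at this
    exact congrArg Prod.snd this
  refine ⟨fun q => ev (u q), ?_, ?_, ?_⟩
  · filter_upwards [hιt] with q hq
    exact ev.contDiff.contDiffAt.comp q (hu q hq)
  · have hx : ∀ᶠ x in 𝓝 x₀, ι (0, x) ∈ e.target :=
      (Continuous.continuousAt (f := fun x : E => ((0 : ℝ), x)) (by fun_prop)).eventually hιt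
    filter_upwards [hx] with x hx
    have h2 := congrArg (fun w => w ⟨1, by norm_num⟩) (congrArg Prod.snd (hsol _ hx).2)
    have h3 : u (0, x) ⟨1, by norm_num⟩ - x - (0 : ℝ) •
      (∫ τ in (0 : ℝ)..1, V (IccExtend hle (u (0, x)) τ)) = 0 := h2
    rw [zero_smul, sub_zero, sub_eq_zero] at h3
    exact h3
  · -- A ball around the constant solution on which solutions are unique.
    obtain ⟨r, hr, hball⟩ := Metric.isOpen_iff.1 e.open_source _ he₀
    have hcont : ContinuousAt (fun q => (q, u q)) ((0 : ℝ), x₀) :=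
      continuousAt_id.prodMk (hu _ hιt.self_of_nhds).continuousAt
    have hnear : ∀ᶠ q in 𝓝 ((0 : ℝ), x₀), (q, u q) ∈ Metric.ball p₀ r := by
      refine hcont.eventually_mem ?_
      simp only [hu₀]
      exact Metric.ball_mem_nhds _ hr
    obtain ⟨δ, hδ, hδ'⟩ := Metric.eventually_nhds_iff.1 (hnear.and hιt)
    have hρ : ∀ x, dist x x₀ < δ → ∀ s, |s| < δ / 2 →
        ev (u (s, x)) = IccExtend hle (u (δ / 2, x)) (s / (δ / 2)) := by
      intro x hx s hs
      have hd : dist (δ / 2, x) ((0 : ℝ), x₀) < δ := by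
        rw [Prod.dist_eq, Real.dist_eq, sub_zero, abs_of_pos (half_pos hδ)]
        exact max_lt (half_lt_self hδ) hx
      obtain ⟨h1, h2⟩ := hδ' hd
      have hσ : s / (δ / 2) ∈ Icc (-1 : ℝ) 1 := by
        rw [mem_Icc, ← abs_le, abs_div, abs_of_pos (half_pos hδ), div_le_one (half_pos hδ)]
        exact hs.le
      obtain ⟨v, hv, hvd, hv1⟩ := integralCurveEquation_rescale (hsol _ h2).2 hσ
      have hs' : s / (δ / 2) * (δ / 2) = s := div_mul_cancel₀ _ (half_pos hδ).ne'
      rw [← hv1]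
      simp only [hs'] at hv
      have hvs : ((s, x), v) ∈ e.source := by
        refine hball ?_
        rw [Metric.mem_ball, Prod.dist_eq, Prod.dist_eq, max_lt_iff, max_lt_iff] at h1 ⊢
        refine ⟨⟨?_, h1.1.2⟩, (hvd x₀).trans_lt h1.2⟩
        have h3 := h1.1.1
        simp only [p₀, Real.dist_eq, sub_zero] at h3 ⊢
        rw [abs_of_pos (half_pos hδ)] at h3
        exact hs.trans h3
      have h4 := e.left_inv hvs
      rw [hef, hv] at h4
      have h5 : u (s, x) = v := congrArg Prod.snd h4
      rw [h5]
      rfl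
    filter_upwards [Metric.ball_mem_nhds ((0 : ℝ), x₀) (half_pos hδ)] with p hp
    rw [Metric.mem_ball, Prod.dist_eq, max_lt_iff, Real.dist_eq, sub_zero] at hp
    have hx : dist p.2 x₀ < δ := hp.2.trans (half_lt_self hδ)
    have hd : dist (δ / 2, p.2) ((0 : ℝ), x₀) < δ := by
      rw [Prod.dist_eq, Real.dist_eq, sub_zero, abs_of_pos (half_pos hδ)]
      exact max_lt (half_lt_self hδ) hx
    have hσ : p.1 / (δ / 2) ∈ Ioo (-1 : ℝ) 1 := by
      rw [mem_Ioo, ← abs_lt, abs_div, abs_of_pos (half_pos hδ), div_lt_one (half_pos hδ)]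
      exact hp.1
    have h1 := hasDerivAt_of_integralCurveEquation (hsol _ (hδ' hd).2).2 hσ
    have h2 := h1.scomp p.1 ((hasDerivAt_id p.1).div_const (δ / 2))
    have h3 : ev (u p) = IccExtend hle (u (δ / 2, p.2)) (p.1 / (δ / 2)) := hρ p.2 hx p.1 hp.1
    rw [h3]
    have h4 : HasDerivAt (fun s => IccExtend hle (u (δ / 2, p.2)) (s / (δ / 2)))
        (V (IccExtend hle (u (δ / 2, p.2)) (p.1 / (δ / 2)))) p.1 := by
      refine h2.congr_deriv ?_
      rw [smul_smul, one_div, inv_mul_cancel₀ (half_pos hδ).ne', one_smul]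
    refine h4.congr_of_eventuallyEq ?_
    have : ∀ᶠ s in 𝓝 p.1, |s| < δ / 2 := continuous_abs.continuousAt.eventually_lt
      continuousAt_const hp.1
    filter_upwards [this] with s hs
    exact hρ p.2 hx s hs

/-- A vector field that is smooth near a point of a finite-dimensional space has a smooth local flow
there. -/
theorem exists_local_flow {E : Type u} [NormedAddCommGroup E] [NormedSpace ℝ E]
    [FiniteDimensional ℝ E] {V : E → E} {x₀ : E} (hV : ∀ᶠ x in 𝓝 x₀, ContDiffAt ℝ ∞ V x) :
    ∃ Φ : ℝ × E → E, (∀ᶠ p in 𝓝 ((0 : ℝ), x₀), ContDiffAt ℝ ∞ Φ p) ∧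
      (∀ᶠ x in 𝓝 x₀, Φ (0, x) = x) ∧
      ∀ᶠ p in 𝓝 ((0 : ℝ), x₀), HasDerivAt (fun s => Φ (s, p.2)) (V (Φ p)) p.1 := by
  have : CompleteSpace E := FiniteDimensional.complete ℝ E
  obtain ⟨δ, hδ, hδ'⟩ := Metric.eventually_nhds_iff.1 hV
  let b : ContDiffBump x₀ := ⟨δ / 4, δ / 2, by positivity, by linarith⟩
  have hW : ContDiff ℝ ∞ (fun x => b x • V x) := by
    refine contDiff_iff_contDiffAt.2 fun x => ?_
    by_cases hx : dist x x₀ < δ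
    · exact b.contDiffAt.smul (hδ' hx)
    · have h0 : (fun x => b x • V x) =ᶠ[𝓝 x] fun _ => 0 := by
        have h1 : ∀ᶠ y in 𝓝 x, δ / 2 < dist y x₀ :=
          (continuous_id.dist continuous_const).continuousAt.eventually
            (lt_mem_nhds (by simp only [id]; linarith))
        filter_upwards [h1] with y hy
        rw [b.zero_of_le_dist hy.le, zero_smul]
      exact contDiffAt_const.congr_of_eventuallyEq h0
  obtain ⟨Φ, h1, h2, h3⟩ := exists_local_flow_of_contDiff ⟨_, hW.continuous⟩ hW x₀
  refine ⟨Φ, h1, h2, ?_⟩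
  have hc : ∀ᶠ p in 𝓝 ((0 : ℝ), x₀), Φ p ∈ Metric.ball x₀ (δ / 4) := by
    refine h1.self_of_nhds.continuousAt.eventually_mem ?_
    rw [h2.self_of_nhds]
    exact Metric.ball_mem_nhds _ (by positivity)
  filter_upwards [h3, hc] with p hp hpc
  have : b (Φ p) = 1 := b.one_of_mem_closedBall (Metric.ball_subset_closedBall hpc)
  simpa [this] using hp

end Flow

/-! ### First integrals of involutive families of vector fields -/

section Frobenius
universe u
variable {E : Type u} [NormedAddCommGroup E] [NormedSpace ℝ E] [FiniteDimensional ℝ E]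

/-- Local projection `π` along the integral curves of `V` onto a level hypersurface of `σ`
transverse to `V`. Functions killed by `V` are those that factor through `π`. -/
theorem exists_projection_along_flow {V : E → E} {σ : E → ℝ} {a : E}
    (hV : ∀ᶠ x in 𝓝 a, ContDiffAt ℝ ∞ V x) (hσ : ∀ᶠ x in 𝓝 a, ContDiffAt ℝ ∞ σ x)
    (hσV : fderiv ℝ σ a (V a) ≠ 0) :
    ∃ π : E → E, π a = a ∧ (∀ᶠ x in 𝓝 a, ContDiffAt ℝ ∞ π x) ∧ (∀ᶠ x in 𝓝 a, σ (π x) = σ a) ∧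
      (∀ᶠ x in 𝓝 a, fderiv ℝ π x (V x) = 0) ∧
      (∀ᶠ x in 𝓝 a, σ x = σ a → π x = x ∧ ∀ w, ∃ c : ℝ, fderiv ℝ π x w = w - c • V x) ∧
      ∀ u : E → ℝ, (∀ᶠ x in 𝓝 a, DifferentiableAt ℝ u x ∧ fderiv ℝ u x (V x) = 0) →
        ∀ᶠ x in 𝓝 a, u x = u (π x) := by
  have : CompleteSpace E := FiniteDimensional.complete ℝ E
  set v := V a with hv
  set l := fderiv ℝ σ a with hl
  -- `χ` straightens the level hypersurface of `σ` to the hyperplane `s = 0`.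
  let s : E → ℝ := fun y => (l v)⁻¹ * l (y - a)
  let p : E → E := fun y => y - s y • v
  let χ : E → E := fun x => x + ((l v)⁻¹ * (σ x - σ a - l (x - a))) • v
  have hs : ContDiff ℝ ∞ s := by fun_prop
  have hp : ContDiff ℝ ∞ p := by fun_prop
  have hs' : ∀ y, HasFDerivAt s ((l v)⁻¹ • l) y := fun y =>
    (l.hasFDerivAt.comp y ((hasFDerivAt_id y).sub_const a)).const_mul (l v)⁻¹
  have hp' : ∀ y, HasFDerivAt p (ContinuousLinearMap.id ℝ E - ((l v)⁻¹ • l).smulRight v) y :=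
    fun y => (hasFDerivAt_id y).sub ((hs' y).smul_const v)
  have hsv : ∀ y (t : ℝ), s (y + t • v) = s y + t := by
    intro y t
    simp only [s]
    rw [add_sub_right_comm, map_add, map_smul, smul_eq_mul]
    field_simp
  have hpv : ∀ y (t : ℝ), p (y + t • v) = p y := by
    intro y t
    simp only [p, hsv]
    module
  have hsp : ∀ y, s (p y) = 0 := by
    intro y
    have := hsv y (-s y)
    rw [neg_smul, ← sub_eq_add_neg] at this
    rw [this, add_neg_cancel]
  have hps : ∀ y, s y = 0 → p y = y := fun y hy => by simp [p, hy]
  have hsa : s a = 0 := by simp [s]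
  have hpa : p a = a := hps a hsa
  have hχs : ∀ᶠ x in 𝓝 a, ContDiffAt ℝ ∞ χ x := by
    filter_upwards [hσ] with x hx
    fun_prop
  have hσa : HasFDerivAt σ l a := (hσ.self_of_nhds.differentiableAt (by simp)).hasFDerivAt
  have hχa : χ a = a := by simp [χ]
  have hχ' : HasFDerivAt χ ((ContinuousLinearEquiv.refl ℝ E : E ≃L[ℝ] E) : E →L[ℝ] E) a := by
    have h1 := ((hσa.sub_const (σ a)).sub (l.hasFDerivAt.comp a ((hasFDerivAt_id a).sub_const a)))
    have h2 := (hasFDerivAt_id a).add ((h1.const_mul (l v)⁻¹).smul_const v)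
    refine h2.congr_fderiv ?_
    ext w
    simp
  have hsχ : ∀ x, s (χ x) = (l v)⁻¹ * (σ x - σ a) := by
    intro x
    simp only [χ, hsv]
    simp only [s]
    ring
  obtain ⟨e, he₀, hef, -, hes⟩ := exists_openPartialHomeomorph_contDiffOn_symm hχs hχ'
  have heta : a ∈ e.target := by simpa [hef, hχa] using e.map_source he₀
  have hea : e.symm a = a := by simpa [hef, hχa] using e.left_inv he₀
  obtain ⟨Φ, hΦ, hΦ0, hΦd⟩ := exists_local_flow hV
  -- `Ψ` straightens `V` to the constant vector field `v`.
  let Ψ : E → E := fun y => Φ (s y, e.symm (p y))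
  have htar : ∀ᶠ y in 𝓝 a, y ∈ e.target := e.open_target.eventually_mem heta
  have hptar : ∀ᶠ y in 𝓝 a, p y ∈ e.target := by
    have : Tendsto p (𝓝 a) (𝓝 a) := by simpa [hpa] using hp.continuous.tendsto a
    exact this.eventually htar
  have hin : ContinuousAt (fun y => (s y, e.symm (p y))) a := by
    refine hs.continuous.continuousAt.prodMk (ContinuousAt.comp ?_ hp.continuous.continuousAt)
    rw [hpa]
    exact (hes a heta).continuousAt
  have hin' : Tendsto (fun y => (s y, e.symm (p y))) (𝓝 a) (𝓝 ((0 : ℝ), a)) := by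
    have := hin.tendsto
    simpa [hsa, hpa, hea] using this
  have hΨs : ∀ᶠ y in 𝓝 a, ContDiffAt ℝ ∞ Ψ y := by
    filter_upwards [hin'.eventually hΦ, hptar] with y hy1 hy2
    exact hy1.comp y (hs.contDiffAt.prodMk ((hes _ hy2).comp y hp.contDiffAt))
  have hΨv : ∀ᶠ y in 𝓝 a, fderiv ℝ Ψ y v = V (Ψ y) := by
    filter_upwards [hin'.eventually hΦd, hΨs] with y hy hy2
    have h1 : HasDerivAt (fun t : ℝ => Ψ (y + t • v)) (V (Ψ y)) 0 := by
      have h2 : (fun t : ℝ => Ψ (y + t • v)) = fun t => Φ (s y + t, e.symm (p y)) := by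
        funext t
        simp only [Ψ, hsv, hpv]
      rw [h2]
      have h3 := HasDerivAt.scomp (h := fun t : ℝ => s y + t) (h' := 1) (0 : ℝ)
        (g₁ := fun r => Φ (r, e.symm (p y))) (g₁' := V (Ψ y)) (by simpa using hy)
        ((hasDerivAt_id (0 : ℝ)).const_add (s y))
      simpa [Function.comp_def] using h3
    have h4 := (hy2.differentiableAt (by simp)).hasFDerivAt.hasLineDerivAt v
    exact h4.unique h1
  have hΨp : ∀ᶠ y in 𝓝 a, s y = 0 → y ∈ e.target ∧ Ψ y = e.symm y := by
    have h1 : Tendsto e.symm (𝓝 a) (𝓝 a) := by simpa [hea] using (hes a heta).continuousAt.tendsto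
    filter_upwards [h1.eventually hΦ0, htar] with y hy hy2 hsy
    refine ⟨hy2, ?_⟩
    simp only [Ψ, hsy, hps y hsy]
    exact hy
  have hΨa : Ψ a = a := by simpa [hea] using (hΨp.self_of_nhds hsa).2
  have hpt : Tendsto p (𝓝 a) (𝓝 a) := by simpa [hpa] using hp.continuous.tendsto a
  have hΨ' : HasFDerivAt Ψ ((ContinuousLinearEquiv.refl ℝ E : E ≃L[ℝ] E) : E →L[ℝ] E) a := by
    have h1 := (hΨs.self_of_nhds.differentiableAt (by simp)).hasFDerivAt
    have h2 : HasFDerivAt (Ψ ∘ p) (ContinuousLinearMap.id ℝ E - ((l v)⁻¹ • l).smulRight v) a := by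
      have h3 : HasFDerivAt e.symm
          ((ContinuousLinearEquiv.refl ℝ E : E ≃L[ℝ] E) : E →L[ℝ] E) a := by
        have := e.hasFDerivAt_symm (f' := ContinuousLinearEquiv.refl ℝ E) heta
          (by rw [hea, hef]; exact hχ')
        simpa using this
      have h4 : HasFDerivAt (e.symm ∘ p)
          (ContinuousLinearMap.id ℝ E - ((l v)⁻¹ • l).smulRight v) a := by
        have h5 := HasFDerivAt.comp (g := e.symm) a (by rw [hpa]; exact h3) (hp' a)
        simpa using h5
      refine h4.congr_of_eventuallyEq ?_
      filter_upwards [hpt.eventually hΨp] with y hy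
      exact (hy (hsp y)).2
    have h6 : HasFDerivAt (Ψ ∘ p) ((fderiv ℝ Ψ a).comp
        (ContinuousLinearMap.id ℝ E - ((l v)⁻¹ • l).smulRight v)) a :=
      HasFDerivAt.comp (g := Ψ) a (by rw [hpa]; exact h1) (hp' a)
    have h7 := h6.unique h2
    convert h1 using 1
    ext w
    have h8 := congrArg (fun A : E →L[ℝ] E => A w) h7
    have h9 := hΨv.self_of_nhds
    rw [hΨa, ← hv] at h9
    simp only [ContinuousLinearMap.comp_apply, sub_apply,
      ContinuousLinearMap.id_apply, ContinuousLinearMap.smulRight_apply, map_sub, map_smul, h9] at h8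
    exact (sub_left_injective h8).symm
  obtain ⟨d, hd₀, hdf, hds', hds⟩ := exists_openPartialHomeomorph_contDiffOn_symm hΨs hΨ'
  have hdta : a ∈ d.target := by simpa [hdf, hΨa] using d.map_source hd₀
  have hda : d.symm a = a := by simpa [hdf, hΨa] using d.left_inv hd₀
  have hdt : ∀ᶠ x in 𝓝 a, x ∈ d.target := d.open_target.eventually_mem hdta
  have hdsm : Tendsto d.symm (𝓝 a) (𝓝 a) := by
    simpa [hda] using (hds a hdta).continuousAt.tendsto
  have hΨd : ∀ x ∈ d.target, Ψ (d.symm x) = x := fun x hx => by simpa [hdf] using d.right_inv hx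
  let π : E → E := fun x => Ψ (p (d.symm x))
  -- Differentiating `π ∘ Ψ = Ψ ∘ p`.
  have hπ' : ∀ᶠ x in 𝓝 a, ∀ w, fderiv ℝ π x (fderiv ℝ Ψ (d.symm x) w) =
      fderiv ℝ Ψ (p (d.symm x)) (w - ((l v)⁻¹ * l w) • v) := by
    filter_upwards [hdt, (hpt.comp hdsm).eventually hΨs, hdsm.eventually hΨs] with x hx h1 h2 w
    have h3 : HasFDerivAt π (fderiv ℝ π x) (Ψ (d.symm x)) := by
      rw [hΨd x hx]
      refine DifferentiableAt.hasFDerivAt (ContDiffAt.differentiableAt (n := ∞) ?_ (by simp))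
      exact h1.comp x (hp.contDiffAt.comp x (hds x hx))
    have h4 := h3.comp (d.symm x) (h2.differentiableAt (by simp)).hasFDerivAt
    have h5 : HasFDerivAt (Ψ ∘ p) _ (d.symm x) :=
      (h1.differentiableAt (by simp)).hasFDerivAt.comp (d.symm x) (hp' (d.symm x))
    have h6 : π ∘ Ψ =ᶠ[𝓝 (d.symm x)] Ψ ∘ p := by
      filter_upwards [d.open_source.eventually_mem (d.map_target hx)] with y hy
      have := d.left_inv hy
      rw [hdf] at this
      simp only [π, Function.comp_apply, this]
    have h7 := congrArg (fun A : E →L[ℝ] E => A w) (h4.unique (h5.congr_of_eventuallyEq h6))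
    simpa using h7
  refine ⟨π, ?_, ?_, ?_, ?_, ?_, ?_⟩
  · simp only [π, hda, hpa, hΨa]
  · filter_upwards [hdt, (hpt.comp hdsm).eventually hΨs] with x hx h1
    exact h1.comp x (hp.contDiffAt.comp x (hds x hx))
  · filter_upwards [(hpt.comp hdsm).eventually hΨp] with x hx
    obtain ⟨h1, h2⟩ := hx (hsp _)
    have h3 : χ (e.symm (p (d.symm x))) = p (d.symm x) := by simpa [hef] using e.right_inv h1
    have h4 := hsχ (e.symm (p (d.symm x)))
    rw [h3, hsp] at h4
    have h5 : π x = e.symm (p (d.symm x)) := h2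
    rw [h5]
    have h6 := (mul_eq_zero.1 h4.symm).resolve_left (inv_ne_zero hσV)
    linarith
  · filter_upwards [hπ', hdsm.eventually hΨv, hdt] with x h1 h2 hx
    have h3 := h1 v
    rw [h2, hΨd x hx, inv_mul_cancel₀ hσV, one_smul, sub_self, map_zero] at h3
    exact h3
  · have hχt : Tendsto χ (𝓝 a) (𝓝 a) := by
      simpa [hχa] using hχs.self_of_nhds.continuousAt.tendsto
    filter_upwards [hπ', hdsm.eventually hΨv, hdt, hχt.eventually hΨp,
      e.open_source.eventually_mem he₀, hχt.eventually (d.open_source.eventually_mem hd₀),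
      hdsm.eventually (hΨs)] with x h1 h2 hx h3 h4 h5 h6 hσx
    have hsx : s (χ x) = 0 := by rw [hsχ, hσx, sub_self, mul_zero]
    have h7 : Ψ (χ x) = x := by
      rw [(h3 hsx).2]
      simpa [hef] using e.left_inv h4
    have h8 : d.symm x = χ x := by
      have := d.left_inv h5
      rwa [hdf, h7] at this
    have h9 : p (d.symm x) = d.symm x := by rw [h8, hps _ hsx]
    refine ⟨by simp only [π, h9, hΨd x hx], fun w => ?_⟩
    obtain ⟨w', hw'⟩ : ∃ w', fderiv ℝ Ψ (d.symm x) w' = w := by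
      have h10 : HasFDerivAt (Ψ ∘ d.symm) (ContinuousLinearMap.id ℝ E) x := by
        refine (hasFDerivAt_id x).congr_of_eventuallyEq ?_
        filter_upwards [d.open_target.eventually_mem hx] with y hy
        exact hΨd y hy
      have h11 := (h6.differentiableAt (by simp)).hasFDerivAt.comp x
        ((hds x hx).differentiableAt (by simp)).hasFDerivAt
      exact ⟨fderiv ℝ d.symm x w, congrArg (fun A : E →L[ℝ] E => A w) (h11.unique h10)⟩
    refine ⟨(l v)⁻¹ * l w', ?_⟩
    have h12 := h1 w'
    rw [hw', h9, map_sub, map_smul, h2, hw', hΨd x hx] at h12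
    exact h12
  · intro u hu
    have hΨt : Tendsto Ψ (𝓝 a) (𝓝 a) := by simpa [hΨa] using hΨ'.continuousAt.tendsto
    obtain ⟨r, hr, hball⟩ := Metric.eventually_nhds_iff_ball.1
      ((hΨt.eventually hu).and (hΨv.and hΨs))
    have hconst : ∀ y ∈ Metric.ball a r, p y ∈ Metric.ball a r → u (Ψ y) = u (Ψ (p y)) := by
      intro y hy hpy
      let c : ℝ → E := fun t => p y + t • (s y • v)
      have hc : ∀ t ∈ Icc (0 : ℝ) 1, HasDerivWithinAt (fun t => u (Ψ (c t))) 0 (Icc 0 1) t := by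
        intro t ht
        have hct : c t ∈ Metric.ball a r := by
          refine (convex_ball a r).segment_subset hpy hy ?_
          rw [segment_eq_image']
          exact ⟨t, ht, by simp [c, p]⟩
        obtain ⟨⟨h1, h2⟩, h3, h4⟩ := hball _ hct
        have h5 := h1.hasFDerivAt.comp (c t) (h4.differentiableAt (by simp)).hasFDerivAt
        have h6 : HasDerivAt c (s y • v) t := by
          simpa [c] using ((hasDerivAt_id t).smul_const (s y • v)).const_add (p y)
        have h7 := h5.comp_hasDerivAt t h6
        refine (h7.congr_deriv ?_).hasDerivWithinAt
        rw [map_smul, ContinuousLinearMap.comp_apply, h3, h2, smul_zero]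
      have := (convex_Icc (0 : ℝ) 1).norm_image_sub_le_of_norm_hasDerivWithin_le (C := 0) hc
        (by simp) (left_mem_Icc.2 zero_le_one) (right_mem_Icc.2 zero_le_one)
      rw [zero_mul, norm_le_zero_iff, sub_eq_zero] at this
      simpa [c, p] using this
    filter_upwards [hdsm.eventually (Metric.ball_mem_nhds a hr),
      (hpt.comp hdsm).eventually (Metric.ball_mem_nhds a hr), hdt] with x h1 h2 hx
    have := hconst _ h1 h2
    rwa [hΨd x hx] at this

end Frobenius

/-- The Lie bracket acts on functions as the commutator. -/
theorem fderiv_lieBracket_apply {E F : Type*} [NormedAddCommGroup E] [NormedSpace ℝ E]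
    [NormedAddCommGroup F] [NormedSpace ℝ F] {z : E → F} {V W : E → E} {x : E}
    (hz : ContDiffAt ℝ ∞ z x) (hV : ContDiffAt ℝ ∞ V x) (hW : ContDiffAt ℝ ∞ W x) :
    fderiv ℝ z x (VectorField.lieBracket ℝ V W x) =
      fderiv ℝ (fun y => fderiv ℝ z y (W y)) x (V x) -
        fderiv ℝ (fun y => fderiv ℝ z y (V y)) x (W x) :=
  VectorField.fderiv_apply_lieBracket hz
    (by rw [minSmoothness_of_isRCLikeNormedField]; exact WithTop.coe_le_coe.2 le_top)
    (hW.differentiableAt (by simp)) (hV.differentiableAt (by simp))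

/-- If the brackets of `V` with the fields `Y_i`, and these fields, lie in a subspace `D` at a point,
so do the brackets of `V` with combinations of the `Y_i` with variable coefficients. -/
theorem lieBracket_sum_smul_right_mem {E : Type*} [NormedAddCommGroup E]
    [NormedSpace ℝ E] {ι : Type*} (s : Finset ι) {V : E → E} {b : ι → E → ℝ}
    {Y : ι → E → E} {x : E} {D : Submodule ℝ E} (hb : ∀ i, DifferentiableAt ℝ (b i) x)
    (hY : ∀ i, DifferentiableAt ℝ (Y i) x) (hYD : ∀ i, Y i x ∈ D)
    (hD : ∀ i, VectorField.lieBracket ℝ V (Y i) x ∈ D) :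
    VectorField.lieBracket ℝ V (fun y => ∑ i ∈ s, b i y • Y i y) x ∈ D := by
  classical
  induction s using Finset.induction_on with
  | empty =>
    simp only [Finset.sum_empty]
    rw [show (fun _ : E => (0 : E)) = 0 from rfl, VectorField.lieBracket_zero_right]
    exact D.zero_mem
  | insert i s hi ih =>
    simp only [Finset.sum_insert hi]
    have h1 := VectorField.lieBracket_add_right (V := V) (W := fun y => b i y • Y i y)
      (W₁ := fun y => ∑ j ∈ s, b j y • Y j y) ((hb i).smul (hY i))
      (DifferentiableAt.fun_sum fun j _ => (hb j).smul (hY j))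
    refine (congrArg (· ∈ D) h1).mpr ?_
    rw [VectorField.lieBracket_smul_right (hb i) (hY i)]
    exact D.add_mem (D.add_mem (D.smul_mem _ (hYD i)) (D.smul_mem _ (hD i))) ih

section Frobenius
universe u
variable {E : Type u} [NormedAddCommGroup E] [NormedSpace ℝ E] [FiniteDimensional ℝ E]

theorem ContDiffAt.fderiv_apply_smooth {F G : Type*} [NormedAddCommGroup F] [NormedSpace ℝ F]
    [NormedAddCommGroup G] [NormedSpace ℝ G] {f : F → G} {V : F → F} {x : F}
    (hf : ContDiffAt ℝ ∞ f x) (hV : ContDiffAt ℝ ∞ V x) :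
    ContDiffAt ℝ ∞ (fun y => fderiv ℝ f y (V y)) x :=
  (hf.fderiv_right (m := ∞) (by simp)).clm_apply hV

/-- Pairwise commuting, linearly independent vector fields have a common first integral with any
prescribed differential that annihilates them. By induction: a first integral of all fields but the
last is modified to be constant along the last one, without changing it on a hypersurface to which
the other fields are tangent. -/
theorem exists_firstIntegral_of_commute {a : E} (r : ℕ) : ∀ (Y : Fin r → E → E),
    (∀ i, ∀ᶠ x in 𝓝 a, ContDiffAt ℝ ∞ (Y i) x) →
    (∀ i j, ∀ᶠ x in 𝓝 a, VectorField.lieBracket ℝ (Y i) (Y j) x = 0) →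
    LinearIndependent ℝ (fun i => Y i a) → ∀ ξ : E →L[ℝ] ℝ, (∀ i, ξ (Y i a) = 0) →
    ∃ z : E → ℝ, (∀ᶠ x in 𝓝 a, ContDiffAt ℝ ∞ z x) ∧ fderiv ℝ z a = ξ ∧
      ∀ i, ∀ᶠ x in 𝓝 a, fderiv ℝ z x (Y i x) = 0 := by
  induction r with
  | zero =>
    intro Y _ _ _ ξ _
    exact ⟨ξ, Eventually.of_forall fun x => ξ.contDiff.contDiffAt, ξ.hasFDerivAt.fderiv,
      fun i => i.elim0⟩
  | succ r ih =>
    intro Y hY hc hind ξ hξ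
    have hind' := (linearIndependent_finSucc' (v := fun i => Y i a)).1 hind
    have IH := ih (fun i => Y i.castSucc) (fun i => hY _) (fun i j => hc _ _) hind'.1
    set V := Y (Fin.last r) with hV
    obtain ⟨ℓ, hℓ1, hℓ2⟩ := Submodule.exists_le_ker_of_notMem hind'.2
    obtain ⟨σ, hσs, hσa, hσY⟩ := IH (LinearMap.toContinuousLinearMap ℓ) fun i =>
      hℓ2 (Submodule.subset_span ⟨i, rfl⟩)
    obtain ⟨ζ, hζs, hζa, hζY⟩ := IH ξ fun i => hξ _
    have hσV : fderiv ℝ σ a (V a) ≠ 0 := by rw [hσa]; exact hℓ1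
    have hVs := hY (Fin.last r)
    obtain ⟨π, hπa, hπs, hπσ, hπV, hπS, huniq⟩ := exists_projection_along_flow hVs hσs hσV
    have hπt : Tendsto π (𝓝 a) (𝓝 a) := by
      simpa [hπa] using hπs.self_of_nhds.continuousAt.tendsto
    have hzs : ∀ᶠ x in 𝓝 a, ContDiffAt ℝ ∞ (fun y => ζ (π y)) x := by
      filter_upwards [hπs, hπt.eventually hζs] with x h1 h2
      exact h2.comp x h1
    have hz' : ∀ᶠ x in 𝓝 a, ∀ w, fderiv ℝ (fun y => ζ (π y)) x w =
        fderiv ℝ ζ (π x) (fderiv ℝ π x w) := by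
      filter_upwards [hπs, hπt.eventually hζs] with x h1 h2 w
      have := (h2.differentiableAt (by simp)).hasFDerivAt.comp x
        (h1.differentiableAt (by simp)).hasFDerivAt
      rw [show (fun y => ζ (π y)) = ζ ∘ π from rfl, this.fderiv]
      rfl
    have hzV : ∀ᶠ x in 𝓝 a, fderiv ℝ (fun y => ζ (π y)) x (V x) = 0 := by
      filter_upwards [hz', hπV] with x h1 h2
      rw [h1, h2, map_zero]
    refine ⟨fun y => ζ (π y), hzs, ?_, fun i => ?_⟩
    · ext w
      obtain ⟨c, hc⟩ := (hπS.self_of_nhds rfl).2 w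
      rw [hz'.self_of_nhds, hc, hπa, hζa, map_sub, map_smul, hξ, smul_zero, sub_zero]
    · refine Fin.lastCases hzV (fun i => ?_) i
      let X := Y i.castSucc
      have hXs : ∀ᶠ x in 𝓝 a, ContDiffAt ℝ ∞ X x := hY _
      have hu := huniq (fun x => fderiv ℝ (fun y => ζ (π y)) x (X x)) (by
        filter_upwards [hzs, hXs, hVs, hzV.eventually_nhds, hc (Fin.last r) i.castSucc] with
          x h1 h2 h3 h4 h5
        refine ⟨(h1.fderiv_apply_smooth h2).differentiableAt (by simp), ?_⟩
        have h6 := fderiv_lieBracket_apply h1 h3 h2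
        have h7 : fderiv ℝ (fun x => fderiv ℝ (fun y => ζ (π y)) x (V x)) x (X x) = 0 := by
          have h8 : (fun x => fderiv ℝ (fun y => ζ (π y)) x (V x)) =ᶠ[𝓝 x] fun _ => 0 := h4
          rw [h8.fderiv_eq]
          simp
        rw [h5, map_zero, h7, sub_zero] at h6
        exact h6.symm)
      have hS : ∀ᶠ x in 𝓝 a, σ x = σ a → fderiv ℝ (fun y => ζ (π y)) x (X x) = 0 := by
        have hne : ∀ᶠ x in 𝓝 a, fderiv ℝ σ x (V x) ≠ 0 :=
          (hσs.self_of_nhds.fderiv_apply_smooth hVs.self_of_nhds).continuousAt.eventually_ne hσV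
        filter_upwards [hz', hπS, hπs, hσs, hπσ.eventually_nhds, hσY i, hζY i, hne] with
          x h1 h2 h3 h4 h5 h6 h7 h8 hx
        obtain ⟨h9, h10⟩ := h2 hx
        obtain ⟨c, hc⟩ := h10 (X x)
        have h11 : HasFDerivAt (σ ∘ π) ((fderiv ℝ σ x).comp (fderiv ℝ π x)) x :=
          HasFDerivAt.comp (g := σ) x
            (by rw [h9]; exact (h4.differentiableAt (by simp)).hasFDerivAt)
            (h3.differentiableAt (by simp)).hasFDerivAt
        have h12 : HasFDerivAt (σ ∘ π) (0 : E →L[ℝ] ℝ) x :=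
          (hasFDerivAt_const (σ a) x).congr_of_eventuallyEq h5
        have h13 := congrArg (fun A : E →L[ℝ] ℝ => A (X x)) (h11.unique h12)
        have h14 : fderiv ℝ σ x (X x - c • V x) = 0 := by rw [← hc]; exact h13
        have h15 : fderiv ℝ σ x (X x) = 0 := h6
        rw [map_sub, map_smul, h15, zero_sub, neg_eq_zero, smul_eq_mul] at h14
        have hc0 : c = 0 := (mul_eq_zero.1 h14).resolve_right h8
        rw [h1, hc, hc0, zero_smul, sub_zero, h9, h7]
      filter_upwards [hu, hπt.eventually hS, hπσ] with x h1 h2 h3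
      rw [h1, h2 h3]

/-- Frobenius' theorem, in terms of first integrals: an involutive family of linearly independent
vector fields has a common first integral with any prescribed differential that annihilates
them. -/
theorem exists_firstIntegral_of_involutive {a : E} {r : ℕ} (Y : Fin r → E → E)
    (hY : ∀ i, ∀ᶠ x in 𝓝 a, ContDiffAt ℝ ∞ (Y i) x)
    (hinv : ∀ i j, ∀ᶠ x in 𝓝 a,
      VectorField.lieBracket ℝ (Y i) (Y j) x ∈ Submodule.span ℝ (range fun l => Y l x))
    (hind : LinearIndependent ℝ (fun i => Y i a)) (ξ : E →L[ℝ] ℝ) (hξ : ∀ i, ξ (Y i a) = 0) :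
    ∃ z : E → ℝ, (∀ᶠ x in 𝓝 a, ContDiffAt ℝ ∞ z x) ∧ fderiv ℝ z a = ξ ∧
      ∀ i, ∀ᶠ x in 𝓝 a, fderiv ℝ z x (Y i x) = 0 := by
  -- `B x c = ∑ c_j Y_j(x)`, and `Λ` is a left inverse of `B a`.
  let B : E → (Fin r → ℝ) →L[ℝ] E := fun x =>
    ∑ j, (ContinuousLinearMap.proj (R := ℝ) (φ := fun _ : Fin r => ℝ) j).smulRight (Y j x)
  have hB : ∀ x c, B x c = ∑ j, c j • Y j x := fun x c => by
    simp [B]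
  have hBinj : LinearMap.ker (B a : (Fin r → ℝ) →ₗ[ℝ] E) = ⊥ := by
    rw [LinearMap.ker_eq_bot']
    intro c hc
    have h1 : ∑ j, c j • Y j a = 0 := by rw [← hB]; exact hc
    exact funext (Fintype.linearIndependent_iff.1 hind c h1)
  obtain ⟨Λ', hΛ'⟩ := LinearMap.exists_leftInverse_of_injective _ hBinj
  let Λ : E →L[ℝ] (Fin r → ℝ) := LinearMap.toContinuousLinearMap Λ'
  have hΛ : ∀ c, Λ (B a c) = c := fun c => congrArg (fun A => A c) hΛ'
  let A : E → (Fin r → ℝ) →L[ℝ] (Fin r → ℝ) := fun x => Λ.comp (B x)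
  have hAa : A a = ((ContinuousLinearEquiv.refl ℝ (Fin r → ℝ)) :
      (Fin r → ℝ) →L[ℝ] (Fin r → ℝ)) := by
    ext1 c
    exact hΛ c
  have hYall : ∀ᶠ x in 𝓝 a, ∀ i, ContDiffAt ℝ ∞ (Y i) x := eventually_all.2 hY
  have hBs : ∀ᶠ x in 𝓝 a, ContDiffAt ℝ ∞ B x := by
    filter_upwards [hYall] with x hx
    refine ContDiffAt.sum fun j _ => ?_
    exact contDiffAt_const.smulRight (hx j)
  have hAs : ∀ᶠ x in 𝓝 a, ContDiffAt ℝ ∞ A x := by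
    filter_upwards [hBs] with x hx
    exact contDiffAt_const.clm_comp hx
  have hAinv : ∀ᶠ x in 𝓝 a, ∃ e : (Fin r → ℝ) ≃L[ℝ] (Fin r → ℝ),
      (e : (Fin r → ℝ) →L[ℝ] (Fin r → ℝ)) = A x := by
    refine hAs.self_of_nhds.continuousAt.eventually_mem
      (s := range ((↑) : ((Fin r → ℝ) ≃L[ℝ] (Fin r → ℝ)) → _)) ?_
    rw [hAa]
    exact ContinuousLinearEquiv.nhds _
  -- The frame of the same distribution that `Λ` sends to the standard basis commutes.
  let b : Fin r → E → (Fin r → ℝ) := fun i x => (A x).inverse (Pi.single i 1)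
  let X : Fin r → E → E := fun i x => ∑ j, b i x j • Y j x
  have hbs : ∀ᶠ x in 𝓝 a, ∀ i j, ContDiffAt ℝ ∞ (fun y => b i y j) x := by
    filter_upwards [hAs, hAinv] with x h1 ⟨e, he⟩ i j
    have h2 : ContDiffAt ℝ ∞ (fun y => (A y).inverse) x := by
      refine ContDiffAt.comp x (g := ContinuousLinearMap.inverse) ?_ h1
      rw [← he]
      exact contDiffAt_map_inverse e
    exact contDiffAt_pi.1 (h2.clm_apply contDiffAt_const) j
  have hXs : ∀ᶠ x in 𝓝 a, ∀ i, ContDiffAt ℝ ∞ (X i) x := by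
    filter_upwards [hbs, hYall] with x h1 h2 i
    exact ContDiffAt.sum fun j _ => (h1 i j).smul (h2 j)
  have hXΛ : ∀ᶠ x in 𝓝 a, ∀ i, Λ (X i x) = Pi.single i 1 := by
    filter_upwards [hAinv] with x ⟨e, he⟩ i
    have h1 : X i x = B x (b i x) := (hB _ _).symm
    rw [h1]
    change A x ((A x).inverse (Pi.single i 1)) = _
    rw [← he, ContinuousLinearMap.inverse_equiv]
    simp
  have hYX : ∀ᶠ x in 𝓝 a, ∀ v ∈ Submodule.span ℝ (range fun l => Y l x), Λ v = 0 → v = 0 := by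
    filter_upwards [hAinv] with x ⟨e, he⟩ v hv hv0
    obtain ⟨c, rfl⟩ := (Submodule.mem_span_range_iff_exists_fun ℝ).1 hv
    rw [← hB] at hv0 ⊢
    have h1 : e c = 0 := by
      rw [← hv0, ← ContinuousLinearEquiv.coe_coe, he]
      rfl
    rw [(map_eq_zero_iff e e.injective).1 h1, map_zero]
  have hcomm : ∀ i j, ∀ᶠ x in 𝓝 a, VectorField.lieBracket ℝ (X i) (X j) x = 0 := by
    intro i j
    filter_upwards [hYX, hXs, hXΛ.eventually_nhds, hbs, hYall,
      eventually_all.2 fun i => eventually_all.2 (hinv i)] with x h1 h2 h3 h4 h5 h6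
    refine h1 _ ?_ ?_
    · refine lieBracket_sum_smul_right_mem _ (fun l => (h4 j l).differentiableAt (by simp))
        (fun l => (h5 l).differentiableAt (by simp)) (fun l => Submodule.subset_span ⟨l, rfl⟩)
        fun l => ?_
      rw [VectorField.lieBracket_swap]
      refine Submodule.neg_mem _ ?_
      exact lieBracket_sum_smul_right_mem _ (fun l => (h4 i l).differentiableAt (by simp))
        (fun l => (h5 l).differentiableAt (by simp)) (fun l => Submodule.subset_span ⟨l, rfl⟩)
        fun m => h6 l m
    · have h7 := fderiv_lieBracket_apply (z := Λ) Λ.contDiff.contDiffAt (h2 i) (h2 j)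
      simp only [ContinuousLinearMap.fderiv] at h7
      have h8 : ∀ i, (fun x => Λ (X i x)) =ᶠ[𝓝 x] fun _ => Pi.single i 1 := fun i => by
        filter_upwards [h3] with y hy using hy i
      rw [h7, (h8 i).fderiv_eq, (h8 j).fderiv_eq]
      simp
  have hXa : ∀ i, X i a = Y i a := by
    intro i
    have h1 : b i a = Pi.single i 1 := by
      simp only [b]
      rw [hAa, ContinuousLinearMap.inverse_equiv]
      rfl
    simp only [X, h1]
    simp [Pi.single_apply]
  obtain ⟨z, hz, hza, hzX⟩ := exists_firstIntegral_of_commute r X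
    (fun i => hXs.mono fun x h => h i) hcomm (by simpa only [hXa] using hind) ξ
    (fun i => by rw [hXa]; exact hξ i)
  refine ⟨z, hz, hza, fun i => ?_⟩
  filter_upwards [eventually_all.2 hzX, hAinv] with x h1 ⟨e, he⟩
  -- `Y_i` is a combination of the `X_j`.
  have h2 : ∀ c, B x c = ∑ j, (A x c) j • X j x := by
    intro c
    have h3 : ∀ j, X j x = B x (b j x) := fun j => (hB _ _).symm
    simp only [h3, ← map_smul, ← map_sum]
    congr 1
    have h4 : ∀ j, b j x = e.symm (Pi.single j 1) := fun j => by
      simp only [b]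
      rw [← he, ContinuousLinearMap.inverse_equiv]
      rfl
    simp only [h4, ← map_smul, ← map_sum]
    rw [eq_comm, ContinuousLinearEquiv.symm_apply_eq, ← ContinuousLinearEquiv.coe_coe, he]
    ext l
    simp [Finset.sum_apply, Pi.single_apply]
  have h5 : Y i x = B x (Pi.single i 1) := by rw [hB]; simp [Pi.single_apply]
  rw [h5, h2, map_sum]
  exact Finset.sum_eq_zero fun j _ => by rw [map_smul, h1, smul_zero]

end Frobenius

/-! ### Sections, derived distributions and characteristic fields are local notions -/

section Local

variable {n : ℕ}

theorem exists_smooth_cutoff {x : Fin n → ℝ} {N : Set (Fin n → ℝ)} (hN : N ∈ 𝓝 x) :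
    ∃ b : (Fin n → ℝ) → ℝ, ContDiff ℝ ∞ b ∧ (∀ᶠ y in 𝓝 x, b y = 1) ∧
      ∀ y ∉ N, b =ᶠ[𝓝 y] fun _ => 0 := by
  obtain ⟨δ, hδ, hδN⟩ := Metric.mem_nhds_iff.1 hN
  let b : ContDiffBump x := ⟨δ / 4, δ / 2, by positivity, by linarith⟩
  refine ⟨b, b.contDiff, b.eventuallyEq_one, fun y hy => ?_⟩
  have hy' : δ / 2 < dist y x := by
    by_contra h
    exact hy (hδN (Metric.mem_ball.2 (by linarith)))
  filter_upwards [(continuous_id.dist continuous_const).continuousAt.eventually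
    (lt_mem_nhds hy')] with w hw
  exact b.zero_of_le_dist hw.le

theorem contDiff_cutoff_smul {N : Set (Fin n → ℝ)} {b : (Fin n → ℝ) → ℝ} (hb : ContDiff ℝ ∞ b)
    (hb0 : ∀ y ∉ N, b =ᶠ[𝓝 y] fun _ => 0) {Y : (Fin n → ℝ) → (Fin n → ℝ)}
    (hY : ∀ y ∈ N, ContDiffAt ℝ ∞ Y y) : ContDiff ℝ ∞ (fun y => b y • Y y) := by
  refine contDiff_iff_contDiffAt.2 fun y => ?_
  by_cases hy : y ∈ N
  · exact hb.contDiffAt.smul (hY y hy)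
  · refine (contDiffAt_const (c := (0 : Fin n → ℝ))).congr_of_eventuallyEq ?_
    filter_upwards [hb0 y hy] with w hw
    rw [hw, zero_smul]

namespace TangentDistribution

variable {D : TangentDistribution n} {U : Set (Fin n → ℝ)} {x : Fin n → ℝ}
  {V W : (Fin n → ℝ) → (Fin n → ℝ)}

theorem contDiffAt_of_mem_sections (hU : IsOpen U) (hV : V ∈ D.sections U) (hx : x ∈ U) :
    ContDiffAt ℝ ∞ V x := hV.1.contDiffAt (hU.mem_nhds hx)

theorem le_derived : D x ≤ D.derived U x := le_sup_left

theorem lieBracket_mem_derived (hV : V ∈ D.sections U) (hW : W ∈ D.sections U) :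
    VectorField.lieBracket ℝ V W x ∈ D.derived U x :=
  (le_sup_right : _ ≤ D.derived U x) (Submodule.subset_span ⟨V, hV, W, hW, rfl⟩)

theorem derived_le {P : Submodule ℝ (Fin n → ℝ)} (h : D x ≤ P)
    (h' : ∀ V ∈ D.sections U, ∀ W ∈ D.sections U, VectorField.lieBracket ℝ V W x ∈ P) :
    D.derived U x ≤ P := by
  refine sup_le h (Submodule.span_le.2 ?_)
  rintro _ ⟨V, hV, W, hW, rfl⟩
  exact h' V hV W hW

/-- Every germ of a smooth field of `D` extends to a field of `D` on all of `U`. -/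
theorem exists_mem_sections_eventuallyEq
    (hV : ∀ᶠ y in 𝓝 x, ContDiffAt ℝ ∞ V y ∧ V y ∈ D y) :
    ∃ W ∈ D.sections U, W =ᶠ[𝓝 x] V := by
  obtain ⟨b, hb, hb1, hb0⟩ := exists_smooth_cutoff hV
  refine ⟨fun y => b y • V y,
    ⟨(contDiff_cutoff_smul hb hb0 fun y hy => hy.1).contDiffOn, fun y _ => ?_⟩, ?_⟩
  · by_cases hy : y ∈ {y | ContDiffAt ℝ ∞ V y ∧ V y ∈ D y}
    · exact (D y).smul_mem _ hy.2
    · simp only [(hb0 y hy).self_of_nhds, zero_smul]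
      exact (D y).zero_mem
  · filter_upwards [hb1] with y hy
    rw [hy, one_smul]

theorem lieBracket_mem_derived_of_eventually
    (hV : ∀ᶠ y in 𝓝 x, ContDiffAt ℝ ∞ V y ∧ V y ∈ D y)
    (hW : ∀ᶠ y in 𝓝 x, ContDiffAt ℝ ∞ W y ∧ W y ∈ D y) :
    VectorField.lieBracket ℝ V W x ∈ D.derived U x := by
  obtain ⟨V', hV', hVe⟩ := exists_mem_sections_eventuallyEq (U := U) hV
  obtain ⟨W', hW', hWe⟩ := exists_mem_sections_eventuallyEq (U := U) hW
  rw [← hVe.lieBracket_vectorField_eq hWe]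
  exact lieBracket_mem_derived hV' hW'

theorem lieBracket_mem_of_mem_characteristicFields {c : (Fin n → ℝ) → (Fin n → ℝ)}
    (hc : c ∈ D.characteristicFields U) (hx : x ∈ U)
    (hV : ∀ᶠ y in 𝓝 x, ContDiffAt ℝ ∞ V y ∧ V y ∈ D y) :
    VectorField.lieBracket ℝ c V x ∈ D x := by
  obtain ⟨V', hV', hVe⟩ := exists_mem_sections_eventuallyEq (U := U) hV
  rw [← (EventuallyEq.refl _ c).lieBracket_vectorField_eq hVe]
  exact hc.2 V' hV' x hx

theorem derivedFlag_le_succ (i : ℕ) : D.derivedFlag U i x ≤ D.derivedFlag U (i + 1) x :=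
  le_derived (D := D.derivedFlag U i)

theorem derivedFlag_mono {i j : ℕ} (h : i ≤ j) : D.derivedFlag U i x ≤ D.derivedFlag U j x :=
  monotone_nat_of_le_succ (f := fun i => D.derivedFlag U i x) derivedFlag_le_succ h

end TangentDistribution

end Local

/-! ### The forms `dz_m - z_{m+1} dz_0` -/

section ContactForms

open TangentDistribution

variable {n : ℕ}

/-- The one-form `dz_m - z_{m+1} dz_0` at the point `x`. -/
noncomputable def contactForm (z : ℕ → (Fin n → ℝ) → ℝ) (m : ℕ) (x : Fin n → ℝ) :
    (Fin n → ℝ) →L[ℝ] ℝ :=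
  fderiv ℝ (z m) x - z (m + 1) x • fderiv ℝ (z 0) x

theorem contactForm_apply (z : ℕ → (Fin n → ℝ) → ℝ) (m : ℕ) (x v : Fin n → ℝ) :
    contactForm z m x v = fderiv ℝ (z m) x v - z (m + 1) x * fderiv ℝ (z 0) x v := rfl

theorem contDiffAt_contactForm_apply {z : ℕ → (Fin n → ℝ) → ℝ} {m : ℕ} {x : Fin n → ℝ}
    {V : (Fin n → ℝ) → (Fin n → ℝ)} (hz : ∀ m, ContDiffAt ℝ ∞ (z m) x)
    (hV : ContDiffAt ℝ ∞ V x) : ContDiffAt ℝ ∞ (fun y => contactForm z m y (V y)) x :=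
  ((hz m).fderiv_apply_smooth hV).sub ((hz (m + 1)).mul ((hz 0).fderiv_apply_smooth hV))

/-- Cartan's formula for `ω = dz_m - z_{m+1} dz_0`, whose exterior derivative is
`-dz_{m+1} ∧ dz_0`. -/
theorem contactForm_lieBracket {z : ℕ → (Fin n → ℝ) → ℝ} (m : ℕ) {x : Fin n → ℝ}
    {V W : (Fin n → ℝ) → (Fin n → ℝ)} (hz : ∀ m, ContDiffAt ℝ ∞ (z m) x)
    (hV : ContDiffAt ℝ ∞ V x) (hW : ContDiffAt ℝ ∞ W x) :
    contactForm z m x (VectorField.lieBracket ℝ V W x) =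
      fderiv ℝ (fun y => contactForm z m y (W y)) x (V x) -
        fderiv ℝ (fun y => contactForm z m y (V y)) x (W x) +
        (fderiv ℝ (z (m + 1)) x (V x) * fderiv ℝ (z 0) x (W x) -
          fderiv ℝ (z (m + 1)) x (W x) * fderiv ℝ (z 0) x (V x)) := by
  have key : ∀ {Y : (Fin n → ℝ) → (Fin n → ℝ)}, ContDiffAt ℝ ∞ Y x → ∀ w,
      fderiv ℝ (fun y => contactForm z m y (Y y)) x w =
        fderiv ℝ (fun y => fderiv ℝ (z m) y (Y y)) x w -
        (z (m + 1) x * fderiv ℝ (fun y => fderiv ℝ (z 0) y (Y y)) x w +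
          fderiv ℝ (z (m + 1)) x w * fderiv ℝ (z 0) x (Y x)) := by
    intro Y hY w
    have h1 := (((hz m).fderiv_apply_smooth hY).differentiableAt (by simp)).hasFDerivAt
    have h2 := (((hz 0).fderiv_apply_smooth hY).differentiableAt (by simp)).hasFDerivAt
    have h3 := ((hz (m + 1)).differentiableAt (by simp)).hasFDerivAt
    have h4 : HasFDerivAt (fun y => contactForm z m y (Y y)) _ x := h1.sub (h3.mul h2)
    rw [h4.fderiv]
    simp [mul_comm]
  rw [contactForm_apply, fderiv_lieBracket_apply (hz m) hV hW,
    fderiv_lieBracket_apply (hz 0) hV hW, key hW, key hV]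
  ring

theorem contactForm_lieBracket_of_eventually_eq_zero {z : ℕ → (Fin n → ℝ) → ℝ} (m : ℕ)
    {x : Fin n → ℝ} {V W : (Fin n → ℝ) → (Fin n → ℝ)} (hz : ∀ m, ContDiffAt ℝ ∞ (z m) x)
    (hV : ContDiffAt ℝ ∞ V x) (hW : ContDiffAt ℝ ∞ W x)
    (hV0 : ∀ᶠ y in 𝓝 x, contactForm z m y (V y) = 0)
    (hW0 : ∀ᶠ y in 𝓝 x, contactForm z m y (W y) = 0) :
    contactForm z m x (VectorField.lieBracket ℝ V W x) =
      fderiv ℝ (z (m + 1)) x (V x) * fderiv ℝ (z 0) x (W x) -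
        fderiv ℝ (z (m + 1)) x (W x) * fderiv ℝ (z 0) x (V x) := by
  have h1 : (fun y => contactForm z m y (V y)) =ᶠ[𝓝 x] fun _ => 0 := hV0
  have h2 : (fun y => contactForm z m y (W y)) =ᶠ[𝓝 x] fun _ => 0 := hW0
  rw [contactForm_lieBracket m hz hV hW, h1.fderiv_eq, h2.fderiv_eq]
  simp

/-- The distribution annihilated by the forms `dz_m - z_{m+1} dz_0` for `1 ≤ m ≤ p`. -/
def contactDistribution (z : ℕ → (Fin n → ℝ) → ℝ) (p : ℕ) : TangentDistribution n := fun x =>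
  { carrier := {v | ∀ m, 1 ≤ m → m ≤ p → contactForm z m x v = 0}
    add_mem' := fun hv hw m h1 h2 => by rw [map_add, hv m h1 h2, hw m h1 h2, add_zero]
    zero_mem' := fun m _ _ => map_zero _
    smul_mem' := fun c v hv m h1 h2 => by rw [map_smul, hv m h1 h2, smul_zero] }

theorem mem_contactDistribution {z : ℕ → (Fin n → ℝ) → ℝ} {p : ℕ} {x v : Fin n → ℝ} :
    v ∈ contactDistribution z p x ↔ ∀ m, 1 ≤ m → m ≤ p → contactForm z m x v = 0 := Iff.rfl

theorem fderiv_eq_mul_of_mem_contactDistribution {z : ℕ → (Fin n → ℝ) → ℝ} {p m : ℕ}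
    {x v : Fin n → ℝ} (hv : v ∈ contactDistribution z p x) (h1 : 1 ≤ m) (h2 : m ≤ p) :
    fderiv ℝ (z m) x v = z (m + 1) x * fderiv ℝ (z 0) x v :=
  sub_eq_zero.1 (hv m h1 h2)

theorem contactDistribution_anti {z : ℕ → (Fin n → ℝ) → ℝ} {p q : ℕ} (h : p ≤ q)
    (x : Fin n → ℝ) : contactDistribution z q x ≤ contactDistribution z p x :=
  fun _ hv m h1 h2 => hv m h1 (h2.trans h)

theorem lieBracket_mem_contactDistribution {z : ℕ → (Fin n → ℝ) → ℝ} {p : ℕ}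
    {x : Fin n → ℝ} {V W : (Fin n → ℝ) → (Fin n → ℝ)} (hz : ∀ m, ContDiffAt ℝ ∞ (z m) x)
    (hV : ∀ᶠ y in 𝓝 x, ContDiffAt ℝ ∞ V y ∧ V y ∈ contactDistribution z (p + 1) y)
    (hW : ∀ᶠ y in 𝓝 x, ContDiffAt ℝ ∞ W y ∧ W y ∈ contactDistribution z (p + 1) y) :
    VectorField.lieBracket ℝ V W x ∈ contactDistribution z p x := by
  intro m h1 h2
  rw [contactForm_lieBracket_of_eventually_eq_zero m hz hV.self_of_nhds.1 hW.self_of_nhds.1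
    (hV.mono fun y hy => hy.2 m h1 (by omega)) (hW.mono fun y hy => hy.2 m h1 (by omega)),
    fderiv_eq_mul_of_mem_contactDistribution (m := m + 1) hV.self_of_nhds.2 (by omega) (by omega),
    fderiv_eq_mul_of_mem_contactDistribution (m := m + 1) hW.self_of_nhds.2 (by omega) (by omega)]
  ring

end ContactForms

/-! ### The derived flag in adapted coordinates -/

section Adapted

open TangentDistribution

variable {k : ℕ}

/-- Functions `z_0, …, z_k` on the open set `N ⊆ U` that are adapted to the control distribution of
`S`: it is annihilated exactly by the forms `dz_m - z_{m+1} dz_0`, `1 ≤ m ≤ k - 1`. The fields `Z_l`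
are the coordinate fields `∂/∂z_l`, and `g` is a control field transverse to `dz_0`. -/
structure IsAdaptedChart (S : ControlAffineSystem (k + 1)) (U N : Set (Fin (k + 1) → ℝ))
    (z : ℕ → (Fin (k + 1) → ℝ) → ℝ) (g : (Fin (k + 1) → ℝ) → (Fin (k + 1) → ℝ))
    (Z : ℕ → (Fin (k + 1) → ℝ) → (Fin (k + 1) → ℝ)) : Prop where
  isOpen_U : IsOpen U
  subset_X : U ⊆ S.X
  isOpen_N : IsOpen N
  subset_U : N ⊆ U
  smooth_z : ∀ m, ∀ x ∈ N, ContDiffAt ℝ ∞ (z m) x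
  smooth_g : ∀ x ∈ N, ContDiffAt ℝ ∞ g x
  smooth_Z : ∀ l, ∀ x ∈ N, ContDiffAt ℝ ∞ (Z l) x
  dual : ∀ x ∈ N, ∀ m ≤ k, ∀ l ≤ k, fderiv ℝ (z m) x (Z l x) = if m = l then 1 else 0
  inj : ∀ x ∈ N, ∀ v, (∀ m ≤ k, fderiv ℝ (z m) x v = 0) → v = 0
  control_eq : ∀ x ∈ N, S.controlDistribution x = contactDistribution z (k - 1) x
  g_mem : ∀ x ∈ N, g x ∈ S.controlDistribution x
  transverse : ∀ x ∈ N, fderiv ℝ (z 0) x (g x) ≠ 0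

namespace IsAdaptedChart

variable {S : ControlAffineSystem (k + 1)} {U N : Set (Fin (k + 1) → ℝ)}
  {z : ℕ → (Fin (k + 1) → ℝ) → ℝ} {g : (Fin (k + 1) → ℝ) → (Fin (k + 1) → ℝ)}
  {Z : ℕ → (Fin (k + 1) → ℝ) → (Fin (k + 1) → ℝ)} {x : Fin (k + 1) → ℝ}

theorem coordinateField_mem (h : IsAdaptedChart S U N z g Z) (hx : x ∈ N) {p : ℕ}
    (hp : p + 1 ≤ k) : Z (p + 1) x ∈ contactDistribution z p x := by
  intro m h1 h2
  rw [contactForm_apply, h.dual x hx m (by omega) _ hp, h.dual x hx 0 (by omega) _ hp,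
    if_neg (by omega), if_neg (by omega), mul_zero, sub_zero]

theorem g_mem_contactDistribution (h : IsAdaptedChart S U N z g Z) (hx : x ∈ N) {p : ℕ}
    (hp : p ≤ k - 1) : g x ∈ contactDistribution z p x :=
  contactDistribution_anti hp x (h.control_eq x hx ▸ h.g_mem x hx)

theorem eventually_mem (h : IsAdaptedChart S U N z g Z) (hx : x ∈ N) : ∀ᶠ y in 𝓝 x, y ∈ N :=
  h.isOpen_N.eventually_mem hx

/-- In an adapted chart the `i`-th derived distribution is annihilated exactly by the forms
`dz_m - z_{m+1} dz_0` with `1 ≤ m ≤ k - 1 - i`: bracketing `∂/∂z_{p+1}` with `g` produces the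
direction `∂/∂z_p` that the form `dz_p - z_{p+1} dz_0` excluded. -/
theorem G_eq (h : IsAdaptedChart S U N z g Z) {i : ℕ} (hi : i ≤ k - 1) (hx : x ∈ N) :
    S.G U i x = contactDistribution z (k - 1 - i) x := by
  induction i generalizing x with
  | zero => exact h.control_eq x hx
  | succ i ih =>
    have ih' := fun y hy => ih (by omega) (x := y) hy
    obtain ⟨p, hp⟩ : ∃ p, k - 1 - i = p + 1 := ⟨k - 1 - i - 1, by omega⟩
    have hp' : k - 1 - (i + 1) = p := by omega
    rw [hp] at ih'
    rw [hp']
    refine le_antisymm ?_ ?_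
    · refine derived_le (D := S.G U i)
        ((ih' x hx).le.trans (contactDistribution_anti (by omega) x)) fun V hV W hW => ?_
      have key : ∀ Y ∈ (S.G U i).sections U,
          ∀ᶠ y in 𝓝 x, ContDiffAt ℝ ∞ Y y ∧ Y y ∈ contactDistribution z (p + 1) y := by
        intro Y hY
        filter_upwards [h.eventually_mem hx] with y hy
        exact ⟨contDiffAt_of_mem_sections h.isOpen_U hY (h.subset_U hy),
          ih' y hy ▸ hY.2 y (h.subset_U hy)⟩
      exact lieBracket_mem_contactDistribution (fun m => h.smooth_z m x hx) (key V hV) (key W hW)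
    · intro v hv
      set w := VectorField.lieBracket ℝ g (Z (p + 2)) x with hw
      have hwG : w ∈ S.G U (i + 1) x := by
        refine lieBracket_mem_derived_of_eventually (D := S.G U i) ?_ ?_
        · filter_upwards [h.eventually_mem hx] with y hy
          refine ⟨h.smooth_g y hy, ?_⟩
          rw [ih' y hy]
          exact h.g_mem_contactDistribution hy (by omega)
        · filter_upwards [h.eventually_mem hx] with y hy
          refine ⟨h.smooth_Z _ y hy, ?_⟩
          rw [ih' y hy]
          exact h.coordinateField_mem hy (by omega)
      have hwm : ∀ m, 1 ≤ m → m ≤ p + 1 → contactForm z m x w =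
          -((if m + 1 = p + 2 then 1 else 0) * fderiv ℝ (z 0) x (g x)) := by
        intro m h1 h2
        rw [hw, contactForm_lieBracket_of_eventually_eq_zero m (fun m => h.smooth_z m x hx)
          (h.smooth_g x hx) (h.smooth_Z _ x hx), h.dual x hx 0 (by omega) (p + 2) (by omega),
          h.dual x hx (m + 1) (by omega) (p + 2) (by omega)]
        · simp
        · filter_upwards [h.eventually_mem hx] with y hy
          exact h.g_mem_contactDistribution hy le_rfl m h1 (by omega)
        · filter_upwards [h.eventually_mem hx] with y hy
          exact h.coordinateField_mem hy (p := p + 1) (by omega) m h1 h2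
      set c := contactForm z (p + 1) x v / fderiv ℝ (z 0) x (g x) with hc
      have h3 : v + c • w ∈ S.G U i x := by
        rw [ih' x hx]
        intro m h1 h2
        rw [map_add, map_smul, hwm m h1 h2, smul_eq_mul]
        rcases Nat.lt_or_ge m (p + 1) with h4 | h4
        · rw [hv m h1 (by omega), if_neg (by omega)]
          ring
        · obtain rfl : m = p + 1 := by omega
          rw [if_pos rfl, hc]
          field_simp [h.transverse x hx]
          ring
      have h4 : v = (v + c • w) - c • w := by abel
      rw [h4]
      exact Submodule.sub_mem _ (derivedFlag_le_succ i h3) (Submodule.smul_mem _ _ hwG)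

/-- A characteristic field of the `i`-th derived distribution annihilates `z_0, …, z_{k-i}`. -/
theorem fderiv_characteristicFields (h : IsAdaptedChart S U N z g Z) {i p : ℕ} (hi : 1 ≤ i)
    (hp : 1 ≤ p) (hip : i + p + 1 = k) {c : (Fin (k + 1) → ℝ) → (Fin (k + 1) → ℝ)}
    (hc : c ∈ (S.G U i).characteristicFields U) (hx : x ∈ N) {m : ℕ} (hm : m ≤ p + 1) :
    fderiv ℝ (z m) x (c x) = 0 := by
  have hG : ∀ y ∈ N, S.G U i y = contactDistribution z p y := fun y hy => by
    rw [h.G_eq (by omega) hy, show k - 1 - i = p by omega]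
  have hz := fun m => h.smooth_z m x hx
  have hcp : ∀ᶠ y in 𝓝 x, contactForm z p y (c y) = 0 := by
    filter_upwards [h.eventually_mem hx] with y hy
    have := hc.1.2 y (h.subset_U hy)
    rw [hG y hy] at this
    exact this p hp le_rfl
  have hcs := contDiffAt_of_mem_sections h.isOpen_U hc.1 (h.subset_U hx)
  have h1 := lieBracket_mem_of_mem_characteristicFields hc (h.subset_U hx) (V := g) (by
    filter_upwards [h.eventually_mem hx] with y hy
    refine ⟨h.smooth_g y hy, ?_⟩
    rw [hG y hy]
    exact h.g_mem_contactDistribution hy (by omega))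
  have h2 := lieBracket_mem_of_mem_characteristicFields hc (h.subset_U hx) (V := Z (p + 1)) (by
    filter_upwards [h.eventually_mem hx] with y hy
    refine ⟨h.smooth_Z _ y hy, ?_⟩
    rw [hG y hy]
    exact h.coordinateField_mem hy (by omega))
  rw [hG x hx] at h1 h2
  have h1 := h1 p hp le_rfl
  have h2 := h2 p hp le_rfl
  rw [contactForm_lieBracket_of_eventually_eq_zero p hz hcs (h.smooth_g x hx) hcp (by
    filter_upwards [h.eventually_mem hx] with y hy
    exact h.g_mem_contactDistribution hy (by omega) p hp le_rfl),
    fderiv_eq_mul_of_mem_contactDistribution (p := p + 1)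
      (h.g_mem_contactDistribution hx (by omega)) (by omega) le_rfl] at h1
  rw [contactForm_lieBracket_of_eventually_eq_zero p hz hcs (h.smooth_Z _ x hx) hcp (by
    filter_upwards [h.eventually_mem hx] with y hy
    exact h.coordinateField_mem hy (by omega) p hp le_rfl),
    h.dual x hx 0 (by omega) _ (by omega), h.dual x hx _ (by omega) _ (by omega),
    if_neg (by omega), if_pos rfl] at h2
  have h0 : fderiv ℝ (z 0) x (c x) = 0 := by linarith
  have hmem := hc.1.2 x (h.subset_U hx)
  rw [hG x hx] at hmem
  rcases Nat.eq_zero_or_pos m with rfl | hm0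
  · exact h0
  rcases Nat.lt_or_ge m (p + 1) with hm1 | hm1
  · rw [fderiv_eq_mul_of_mem_contactDistribution hmem hm0 (by omega), h0, mul_zero]
  · obtain rfl : m = p + 1 := by omega
    rw [h0, mul_zero, sub_zero] at h1
    exact (mul_eq_zero.1 h1).resolve_right (h.transverse x hx)

/-- Every germ of a field annihilating `z_0, …, z_{k-i}` extends to a characteristic field of the
`i`-th derived distribution. -/
theorem exists_characteristicFields (h : IsAdaptedChart S U N z g Z) {i p : ℕ}
    (hip : i + p + 1 = k) {Y : (Fin (k + 1) → ℝ) → (Fin (k + 1) → ℝ)}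
    (hYs : ∀ y ∈ N, ContDiffAt ℝ ∞ Y y)
    (hY : ∀ y ∈ N, ∀ m ≤ p + 1, fderiv ℝ (z m) y (Y y) = 0) (hx : x ∈ N) :
    ∃ c ∈ (S.G U i).characteristicFields U, c =ᶠ[𝓝 x] Y := by
  have hG : ∀ y ∈ N, S.G U i y = contactDistribution z p y := fun y hy => by
    rw [h.G_eq (by omega) hy, show k - 1 - i = p by omega]
  obtain ⟨b, hb, hb1, hb0⟩ := exists_smooth_cutoff (h.isOpen_N.mem_nhds hx)
  set c : (Fin (k + 1) → ℝ) → (Fin (k + 1) → ℝ) := fun y => b y • Y y with hcdef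
  have hcs : ContDiff ℝ ∞ c := contDiff_cutoff_smul hb hb0 hYs
  have hcz : ∀ y ∈ N, ∀ m ≤ p + 1, fderiv ℝ (z m) y (c y) = 0 := fun y hy m hm => by
    simp only [hcdef, map_smul, hY y hy m hm, smul_zero]
  have hcp : ∀ y ∈ N, c y ∈ contactDistribution z p y := fun y hy m _ h2 => by
    rw [contactForm_apply, hcz y hy m (by omega), hcz y hy 0 (by omega), mul_zero, sub_zero]
  have hc0 : ∀ y ∉ N, c =ᶠ[𝓝 y] fun _ => 0 := fun y hy => by
    filter_upwards [hb0 y hy] with w hw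
    simp only [hcdef, hw, zero_smul]
  refine ⟨c, ⟨⟨hcs.contDiffOn, fun y _ => ?_⟩, fun V hV y hyU => ?_⟩, ?_⟩
  · by_cases hy : y ∈ N
    · rw [hG y hy]; exact hcp y hy
    · rw [(hc0 y hy).self_of_nhds]; exact Submodule.zero_mem _
  · by_cases hy : y ∈ N
    · rw [hG y hy]
      intro m h1 h2
      rw [contactForm_lieBracket_of_eventually_eq_zero m (fun m => h.smooth_z m y hy)
        hcs.contDiffAt (contDiffAt_of_mem_sections h.isOpen_U hV hyU),
        hcz y hy _ (by omega), hcz y hy _ (by omega), zero_mul, mul_zero, sub_zero]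
      · filter_upwards [h.eventually_mem hy] with w hw
        exact hcp w hw m h1 h2
      · filter_upwards [h.eventually_mem hy] with w hw
        have := hV.2 w (h.subset_U hw)
        rw [hG w hw] at this
        exact this m h1 h2
    · rw [(hc0 y hy).lieBracket_vectorField_eq (EventuallyEq.refl _ V)]
      have : VectorField.lieBracket ℝ (0 : (Fin (k + 1) → ℝ) → (Fin (k + 1) → ℝ)) V y = 0 := by
        rw [VectorField.lieBracket_zero_left]; rfl
      exact (congrArg (· ∈ S.G U i y) this).mpr (Submodule.zero_mem _)
  · filter_upwards [hb1] with y hy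
    simp only [hcdef, hy, one_smul]

/-- The field with constant components in an adapted chart that takes the value `w` at `x`. -/
theorem exists_constantField (h : IsAdaptedChart S U N z g Z) (hx : x ∈ N)
    (w : Fin (k + 1) → ℝ) : ∃ Y : (Fin (k + 1) → ℝ) → (Fin (k + 1) → ℝ),
      (∀ y ∈ N, ContDiffAt ℝ ∞ Y y) ∧ Y x = w ∧
      ∀ y ∈ N, ∀ m ≤ k, fderiv ℝ (z m) y (Y y) = fderiv ℝ (z m) x w := by
  have hd : ∀ y ∈ N, ∀ m ≤ k, fderiv ℝ (z m) y
      (∑ l ∈ Finset.range (k + 1), fderiv ℝ (z l) x w • Z l y) = fderiv ℝ (z m) x w := by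
    intro y hy m hm
    rw [map_sum, Finset.sum_eq_single m]
    · rw [map_smul, h.dual y hy m hm m hm, if_pos rfl, smul_eq_mul, mul_one]
    · intro l hl hlm
      rw [map_smul, h.dual y hy m hm l (by simpa [Nat.lt_succ_iff] using hl), if_neg hlm.symm,
        smul_zero]
    · intro hm'
      exact absurd (Finset.mem_range.2 (Nat.lt_succ_iff.2 hm)) hm'
  refine ⟨fun y => ∑ l ∈ Finset.range (k + 1), fderiv ℝ (z l) x w • Z l y, fun y hy => ?_, ?_, hd⟩
  · exact ContDiffAt.sum fun l _ => (h.smooth_Z l y hy).const_smul (fderiv ℝ (z l) x w)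
  · refine sub_eq_zero.1 (h.inj x hx _ fun m hm => ?_)
    rw [map_sub, hd x hx m hm, sub_self]

/-- The compatibility of `f` with the characteristic distributions says, in an adapted chart, that
the component `(dz_m - z_{m+1} dz_0)(f)` depends only on `z_0, …, z_{m+1}`. -/
theorem contactForm_lieBracket_drift (h : IsAdaptedChart S U N z g Z) {p m : ℕ} (hmp : m ≤ p)
    {c : (Fin (k + 1) → ℝ) → (Fin (k + 1) → ℝ)} (hcs : ContDiffAt ℝ ∞ c x)
    (hc : ∀ᶠ y in 𝓝 x, ∀ l ≤ p + 1, fderiv ℝ (z l) y (c y) = 0) (hx : x ∈ N) :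
    contactForm z m x (VectorField.lieBracket ℝ S.f c x) =
      -fderiv ℝ (fun y => contactForm z m y (S.f y)) x (c x) := by
  have hf : ContDiffAt ℝ ∞ S.f x :=
    S.smooth_f.contDiffAt (S.isOpen_X.mem_nhds (h.subset_X (h.subset_U hx)))
  have h1 : (fun y => contactForm z m y (c y)) =ᶠ[𝓝 x] fun _ => 0 := by
    filter_upwards [hc] with y hy
    rw [contactForm_apply, hy m (by omega), hy 0 (by omega), mul_zero, sub_zero]
  rw [contactForm_lieBracket m (fun m => h.smooth_z m x hx) hf hcs, h1.fderiv_eq,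
    hc.self_of_nhds 0 (by omega), hc.self_of_nhds (m + 1) (by omega)]
  simp

end IsAdaptedChart

end Adapted

/-! ### Coordinates given by a local diffeomorphism -/

section Chart

open TangentDistribution

variable {k : ℕ}

section Coordinates

variable {φ : OpenPartialHomeomorph (Fin (k + 1) → ℝ) (Fin (k + 1) → ℝ)}
  {z : ℕ → (Fin (k + 1) → ℝ) → ℝ} {x : Fin (k + 1) → ℝ}

/-- The `l`-th coordinate field of a chart. -/
noncomputable def coordinateField (φ : OpenPartialHomeomorph (Fin (k + 1) → ℝ) (Fin (k + 1) → ℝ))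
    (l : ℕ) : (Fin (k + 1) → ℝ) → (Fin (k + 1) → ℝ) := fun x =>
  fderiv ℝ φ.symm (φ x) fun i => if (i : ℕ) = l then 1 else 0

theorem contDiffAt_chart (hφ : ContDiffOn ℝ ∞ φ φ.source) (hx : x ∈ φ.source) :
    ContDiffAt ℝ ∞ φ x := hφ.contDiffAt (φ.open_source.mem_nhds hx)

theorem contDiffAt_chart_symm (hφ' : ContDiffOn ℝ ∞ φ.symm φ.target) (hx : x ∈ φ.source) :
    ContDiffAt ℝ ∞ φ.symm (φ x) := hφ'.contDiffAt (φ.open_target.mem_nhds (φ.map_source hx))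

theorem contDiffAt_coordinateField (hφ : ContDiffOn ℝ ∞ φ φ.source)
    (hφ' : ContDiffOn ℝ ∞ φ.symm φ.target) (l : ℕ) (hx : x ∈ φ.source) :
    ContDiffAt ℝ ∞ (coordinateField φ l) x :=
  (((contDiffAt_chart_symm hφ' hx).fderiv_right (m := ∞) (by simp)).comp x
    (contDiffAt_chart hφ hx)).clm_apply contDiffAt_const

theorem fderiv_chart_symm_apply (hφ : ContDiffOn ℝ ∞ φ φ.source)
    (hφ' : ContDiffOn ℝ ∞ φ.symm φ.target) (hx : x ∈ φ.source) (v : Fin (k + 1) → ℝ) :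
    fderiv ℝ φ.symm (φ x) (fderiv ℝ φ x v) = v := by
  have h1 := HasFDerivAt.comp x
    ((contDiffAt_chart_symm hφ' hx).differentiableAt (by simp)).hasFDerivAt
    ((contDiffAt_chart hφ hx).differentiableAt (by simp)).hasFDerivAt
  have h2 : HasFDerivAt (φ.symm ∘ φ) (ContinuousLinearMap.id ℝ _) x := by
    refine (hasFDerivAt_id x).congr_of_eventuallyEq ?_
    filter_upwards [φ.open_source.eventually_mem hx] with y hy
    exact φ.left_inv hy
  exact congrArg (fun A : (Fin (k + 1) → ℝ) →L[ℝ] (Fin (k + 1) → ℝ) => A v) (h1.unique h2)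

theorem fderiv_chart_apply_symm (hφ : ContDiffOn ℝ ∞ φ φ.source)
    (hφ' : ContDiffOn ℝ ∞ φ.symm φ.target) (hx : x ∈ φ.source) (v : Fin (k + 1) → ℝ) :
    fderiv ℝ φ x (fderiv ℝ φ.symm (φ x) v) = v := by
  have h0 : ContDiffAt ℝ ∞ φ (φ.symm (φ x)) := by
    rw [φ.left_inv hx]; exact contDiffAt_chart hφ hx
  have h1 := HasFDerivAt.comp (φ x) (h0.differentiableAt (by simp)).hasFDerivAt
    ((contDiffAt_chart_symm hφ' hx).differentiableAt (by simp)).hasFDerivAt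
  have h2 : HasFDerivAt (φ ∘ φ.symm) (ContinuousLinearMap.id ℝ _) (φ x) := by
    refine (hasFDerivAt_id (φ x)).congr_of_eventuallyEq ?_
    filter_upwards [φ.open_target.eventually_mem (φ.map_source hx)] with y hy
    exact φ.right_inv hy
  have h3 := congrArg (fun A : (Fin (k + 1) → ℝ) →L[ℝ] (Fin (k + 1) → ℝ) => A v) (h1.unique h2)
  rw [φ.left_inv hx] at h3
  exact h3

theorem fderiv_coordinate (hφ : ContDiffOn ℝ ∞ φ φ.source)
    (hz : ∀ m (hm : m < k + 1), ∀ y ∈ φ.source, z m y = φ y ⟨m, hm⟩) (hx : x ∈ φ.source)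
    {m : ℕ} (hm : m < k + 1) (v : Fin (k + 1) → ℝ) :
    fderiv ℝ (z m) x v = fderiv ℝ φ x v ⟨m, hm⟩ := by
  have h1 := hasFDerivAt_pi'.1
    ((contDiffAt_chart hφ hx).differentiableAt (by simp)).hasFDerivAt ⟨m, hm⟩
  have h2 : z m =ᶠ[𝓝 x] fun y => φ y ⟨m, hm⟩ := by
    filter_upwards [φ.open_source.eventually_mem hx] with y hy
    exact hz m hm y hy
  rw [h2.fderiv_eq, h1.fderiv]
  rfl

theorem fderiv_coordinate_coordinateField (hφ : ContDiffOn ℝ ∞ φ φ.source)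
    (hφ' : ContDiffOn ℝ ∞ φ.symm φ.target)
    (hz : ∀ m (hm : m < k + 1), ∀ y ∈ φ.source, z m y = φ y ⟨m, hm⟩) (hx : x ∈ φ.source)
    {m : ℕ} (hm : m ≤ k) (l : ℕ) :
    fderiv ℝ (z m) x (coordinateField φ l x) = if m = l then 1 else 0 := by
  rw [fderiv_coordinate hφ hz hx (Nat.lt_succ_of_le hm), coordinateField,
    fderiv_chart_apply_symm hφ hφ' hx]

theorem eq_zero_of_fderiv_coordinate (hφ : ContDiffOn ℝ ∞ φ φ.source)
    (hφ' : ContDiffOn ℝ ∞ φ.symm φ.target)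
    (hz : ∀ m (hm : m < k + 1), ∀ y ∈ φ.source, z m y = φ y ⟨m, hm⟩) (hx : x ∈ φ.source)
    (v : Fin (k + 1) → ℝ) (hv : ∀ m ≤ k, fderiv ℝ (z m) x v = 0) : v = 0 := by
  rw [← fderiv_chart_symm_apply hφ hφ' hx v]
  have : fderiv ℝ φ x v = 0 := by
    ext i
    rw [← fderiv_coordinate hφ hz hx i.2]
    exact hv i (Nat.lt_succ_iff.1 i.2)
  rw [this, map_zero]

end Coordinates

theorem finrank_ker_add {n r : ℕ} (L : (Fin n → ℝ) →ₗ[ℝ] (Fin r → ℝ)) (e : Fin r → (Fin n → ℝ))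
    (he : ∀ j, L (e j) = Pi.single j 1) : Module.finrank ℝ (LinearMap.ker L) + r = n := by
  have h1 : Function.Surjective L := by
    intro c
    refine ⟨∑ j, c j • e j, ?_⟩
    rw [map_sum]
    simp only [map_smul, he]
    ext l
    simp [Finset.sum_apply, Pi.single_apply]
  have h2 := L.finrank_range_add_finrank_ker
  rw [LinearMap.range_eq_top.2 h1, finrank_top, Module.finrank_fin_fun, Module.finrank_fin_fun] at h2
  omega

namespace IsAdaptedChart

variable {S : ControlAffineSystem (k + 1)} {U N : Set (Fin (k + 1) → ℝ)}
  {z : ℕ → (Fin (k + 1) → ℝ) → ℝ} {g : (Fin (k + 1) → ℝ) → (Fin (k + 1) → ℝ)}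
  {Z : ℕ → (Fin (k + 1) → ℝ) → (Fin (k + 1) → ℝ)} {x : Fin (k + 1) → ℝ}

theorem finrank_contactDistribution_two (h : IsAdaptedChart S U N z g Z) (hk : 3 ≤ k)
    (hx : x ∈ N) : Module.finrank ℝ (contactDistribution z 2 x) + 2 = k + 1 := by
  let L : (Fin (k + 1) → ℝ) →ₗ[ℝ] (Fin 2 → ℝ) :=
    LinearMap.pi fun j => (contactForm z (j + 1) x : (Fin (k + 1) → ℝ) →ₗ[ℝ] ℝ)
  have hL : contactDistribution z 2 x = LinearMap.ker L := by
    ext v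
    rw [mem_contactDistribution, LinearMap.mem_ker]
    refine ⟨fun hv => funext fun j => hv (j + 1) (by omega) (by omega), fun hv m h1 h2 => ?_⟩
    have := congrFun hv ⟨m - 1, by omega⟩
    simp only [L, LinearMap.pi_apply, Nat.sub_add_cancel h1] at this
    exact this
  rw [hL]
  refine finrank_ker_add L (fun j => Z (j + 1) x) fun j => ?_
  ext m
  change contactForm z (m + 1) x (Z (j + 1) x) = _
  rw [contactForm_apply, h.dual x hx _ (by omega) _ (by omega),
    h.dual x hx 0 (by omega) _ (by omega), if_neg (show ¬(0 = (j : ℕ) + 1) by omega), mul_zero,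
    sub_zero, Pi.single_apply]
  simp [Fin.ext_iff]

/-- The distribution `𝒞^{k-2}` is the annihilator of `dz_0, dz_1, dz_2`, hence of corank three. -/
theorem finrank_C_add_three (h : IsAdaptedChart S U U z g Z) (hk : 3 ≤ k) (hx : x ∈ U) :
    (∀ v, v ∈ S.C U (k - 2) x ↔ ∀ m ≤ 2, fderiv ℝ (z m) x v = 0) ∧
      Module.finrank ℝ (S.C U (k - 2) x) + 3 = k + 1 := by
  have hC : ∀ v, v ∈ S.C U (k - 2) x ↔ ∀ m ≤ 2, fderiv ℝ (z m) x v = 0 := by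
    intro v
    refine ⟨fun hv m hm => ?_, fun hv => ?_⟩
    · have : S.C U (k - 2) x ≤ LinearMap.ker (fderiv ℝ (z m) x : (Fin (k + 1) → ℝ) →ₗ[ℝ] ℝ) := by
        refine Submodule.span_le.2 ?_
        rintro _ ⟨c, hc, rfl⟩
        exact h.fderiv_characteristicFields (p := 1) (by omega) le_rfl (by omega) hc hx hm
      exact this hv
    · obtain ⟨Y, hYs, hYx, hY⟩ := h.exists_constantField hx v
      obtain ⟨c, hc, hcY⟩ := h.exists_characteristicFields (i := k - 2) (p := 1) (by omega) hYs
        (fun y hy m hm => by rw [hY y hy m (by omega), hv m hm]) hx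
      exact Submodule.subset_span ⟨c, hc, by rw [hcY.self_of_nhds, hYx]⟩
  refine ⟨hC, ?_⟩
  let L : (Fin (k + 1) → ℝ) →ₗ[ℝ] (Fin 3 → ℝ) :=
    LinearMap.pi fun j => (fderiv ℝ (z j) x : (Fin (k + 1) → ℝ) →ₗ[ℝ] ℝ)
  have hL : S.C U (k - 2) x = LinearMap.ker L := by
    ext v
    rw [hC, LinearMap.mem_ker]
    exact ⟨fun hv => funext fun j => hv j (by omega),
      fun hv m hm => congrFun hv ⟨m, by omega⟩⟩
  rw [hL]
  refine finrank_ker_add L (fun j => Z j x) fun j => ?_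
  ext m
  change fderiv ℝ (z m) x (Z j x) = _
  rw [h.dual x hx _ (by omega) _ (by omega), Pi.single_apply]
  simp [Fin.ext_iff]

end IsAdaptedChart

/-- An invertible feedback does not change the span of the control fields. -/
theorem span_range_feedback {n : ℕ} (g : Fin 2 → (Fin n → ℝ)) (β : Fin 2 → Fin 2 → ℝ)
    (hβ : IsUnit (Matrix.of β).det) :
    Submodule.span ℝ (range fun j => ∑ i, β i j • g i) = Submodule.span ℝ (range g) := by
  refine le_antisymm (Submodule.span_le.2 ?_) (Submodule.span_le.2 ?_)
  · rintro _ ⟨j, rfl⟩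
    exact Submodule.sum_mem _ fun i _ => Submodule.smul_mem _ _ (Submodule.subset_span ⟨i, rfl⟩)
  · rintro _ ⟨i, rfl⟩
    have h1 : g i = ∑ j, (Matrix.of β)⁻¹ j i • ∑ l, β l j • g l := by
      have h2 := Matrix.mul_nonsing_inv (Matrix.of β) hβ
      simp only [Finset.smul_sum, smul_smul]
      rw [Finset.sum_comm]
      have h3 : ∀ l, ∑ j, ((Matrix.of β)⁻¹ j i * β l j) • g l =
          (if l = i then (1 : ℝ) else 0) • g l := by
        intro l
        rw [← Finset.sum_smul]
        congr 1
        have h4 := congrFun (congrFun h2 l) i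
        rw [Matrix.mul_apply, Matrix.one_apply] at h4
        rw [← h4]
        exact Finset.sum_congr rfl fun j _ => by rw [Matrix.of_apply, mul_comm]
      simp [h3]
    rw [SetLike.mem_coe, h1]
    exact Submodule.sum_mem _ fun j _ => Submodule.smul_mem _ _ (Submodule.subset_span ⟨j, rfl⟩)

/-! ### The triangular form satisfies the conditions -/

/-- The functions `z_0, …, z_k` that bring the system into triangular form are an adapted chart, from
which the ranks of `𝒢^{k-3}` and `𝒞^{k-2}` can be read off. -/
theorem conditions_of_staticFeedbackEquivalent (hk : 3 ≤ k) (S T : ControlAffineSystem (k + 1))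
    (x₀ z₀ : Fin (k + 1) → ℝ) (hT : IsTriangularChainedForm T)
    (hST : StaticFeedbackEquivalent S x₀ T z₀) :
    ∃ U : Set (Fin (k + 1) → ℝ), IsOpen U ∧ x₀ ∈ U ∧ U ⊆ S.X ∧
        S.Ch1 U ∧ S.Ch2 U ∧ S.Ch3 U x₀ ∧ S.Comp U := by
  obtain ⟨φ, α, β, hx₀, -, hS, hTX, hφ, hφ', -, hβ, hfb⟩ := hST
  obtain ⟨h, -, hTf⟩ := hT
  set U := φ.source with hU
  let z : ℕ → (Fin (k + 1) → ℝ) → ℝ := fun m x => if hm : m < k + 1 then φ x ⟨m, hm⟩ else 0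
  have hz : ∀ m (hm : m < k + 1), ∀ y ∈ φ.source, z m y = φ y ⟨m, hm⟩ := fun m hm y _ => dif_pos hm
  let g : (Fin (k + 1) → ℝ) → (Fin (k + 1) → ℝ) := fun x => ∑ i, β x i 0 • S.g i x
  have hd : ∀ x ∈ U, ∀ m (hm : m < k + 1), ∀ v,
      fderiv ℝ (z m) x v = fderiv ℝ φ x v ⟨m, hm⟩ := fun x hx m hm v =>
    fderiv_coordinate hφ hz hx hm v
  have hTz := fun x (hx : x ∈ U) => hTf (φ x) (hTX (φ.map_source hx))
  -- the derivatives of the coordinates along the transformed control fields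
  have hg0 : ∀ x ∈ U, ∀ j, fderiv ℝ (z 0) x (∑ i, β x i j • S.g i x) =
      if j = 0 then 1 else 0 := by
    intro x hx j
    rw [hd x hx 0 (by omega), (hfb x hx).2.2 j]
    fin_cases j
    · exact (hTz x hx).1.2.1
    · exact (hTz x hx).1.2.2
  have hgm : ∀ x ∈ U, ∀ j, ∀ m, 1 ≤ m → m < k → fderiv ℝ (z m) x (∑ i, β x i j • S.g i x) =
      if j = 0 then z (m + 1) x else 0 := by
    intro x hx j m h1 h2
    rw [hd x hx m (by omega), (hfb x hx).2.2 j]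
    fin_cases j
    · rw [hz (m + 1) (by omega) x hx]
      exact ((hTz x hx).2.1 m h1 h2).2.1
    · exact ((hTz x hx).2.1 m h1 h2).2.2
  have hgk : ∀ x ∈ U, ∀ j, fderiv ℝ (z k) x (∑ i, β x i j • S.g i x) =
      if j = 0 then 0 else 1 := by
    intro x hx j
    rw [hd x hx k (by omega), (hfb x hx).2.2 j]
    fin_cases j
    · exact (hTz x hx).2.2.2.1
    · exact (hTz x hx).2.2.2.2
  have hinj := fun x (hx : x ∈ U) => eq_zero_of_fderiv_coordinate hφ hφ' hz hx
  have hspan := fun x (hx : x ∈ U) =>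
    span_range_feedback (fun i => S.g i x) (β x) (hfb x hx).1
  have hchart : IsAdaptedChart S U U z g (coordinateField φ) :=
    { isOpen_U := φ.open_source
      subset_X := hS
      isOpen_N := φ.open_source
      subset_U := subset_rfl
      smooth_z := by
        intro m x hx
        by_cases hm : m < k + 1
        · have : z m = fun y => φ y ⟨m, hm⟩ := funext fun y => dif_pos hm
          rw [this]
          exact contDiffAt_pi.1 (contDiffAt_chart hφ hx) _
        · have : z m = fun y => 0 := funext fun y => dif_neg hm
          rw [this]
          exact contDiffAt_const
      smooth_g := by
        intro x hx
        have hβx : ContDiffAt ℝ ∞ β x := hβ.contDiffAt (φ.open_source.mem_nhds hx)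
        exact ContDiffAt.sum fun i _ => (contDiffAt_pi.1 (contDiffAt_pi.1 hβx i) 0).smul
          ((S.smooth_g i).contDiffAt (S.isOpen_X.mem_nhds (hS hx)))
      smooth_Z := fun l x hx => contDiffAt_coordinateField hφ hφ' l hx
      dual := fun x hx m hm l _ => fderiv_coordinate_coordinateField hφ hφ' hz hx hm l
      inj := hinj
      control_eq := by
        intro x hx
        rw [ControlAffineSystem.controlDistribution, ← hspan x hx]
        refine le_antisymm (Submodule.span_le.2 ?_) fun v hv => ?_
        · rintro _ ⟨j, rfl⟩ m h1 h2
          rw [contactForm_apply, hgm x hx j m h1 (by omega), hg0 x hx j]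
          split_ifs <;> ring
        · have h1 : v = fderiv ℝ (z 0) x v • (∑ i, β x i 0 • S.g i x) +
              fderiv ℝ (z k) x v • (∑ i, β x i 1 • S.g i x) := by
            refine sub_eq_zero.1 (hinj x hx _ fun m hm => ?_)
            rw [map_sub, map_add, map_smul, map_smul, smul_eq_mul, smul_eq_mul]
            rcases Nat.eq_zero_or_pos m with rfl | hm0
            · rw [hg0 x hx, hg0 x hx]; simp
            rcases Nat.lt_or_ge m k with hmk | hmk
            · rw [hgm x hx _ m hm0 hmk, hgm x hx _ m hm0 hmk,
                fderiv_eq_mul_of_mem_contactDistribution hv hm0 (by omega)]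
              simp [mul_comm]
            · obtain rfl : m = k := by omega
              rw [hgk x hx, hgk x hx]; simp
          rw [h1]
          exact Submodule.add_mem _ (Submodule.smul_mem _ _ (Submodule.subset_span ⟨0, rfl⟩))
            (Submodule.smul_mem _ _ (Submodule.subset_span ⟨1, rfl⟩))
      g_mem := by
        intro x hx
        rw [ControlAffineSystem.controlDistribution, ← hspan x hx]
        exact Submodule.subset_span ⟨0, rfl⟩
      transverse := by
        intro x hx
        rw [hg0 x hx 0]
        simp }
  refine ⟨U, φ.open_source, hx₀, hS, fun x hx => ?_, fun x hx => ?_, fun hle => ?_, ?_⟩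
  · rw [hchart.G_eq le_rfl hx, Nat.sub_self]
    exact eq_top_iff.2 fun v _ m h1 h2 => absurd h1 (by omega)
  · obtain ⟨hC, hCr⟩ := hchart.finrank_C_add_three hk hx
    have h2 := hchart.finrank_contactDistribution_two hk hx
    rw [hchart.G_eq (by omega) hx, show k - 1 - (k - 3) = 2 by omega]
    refine ⟨by omega, fun v hv m h1 h2 => ?_, by omega⟩
    rw [contactForm_apply, (hC v).1 hv m h2, (hC v).1 hv 0 (by omega), mul_zero, sub_zero]
  · have h1 := hle (hchart.g_mem x₀ hx₀)
    exact hchart.transverse x₀ hx₀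
      (((hchart.finrank_C_add_three hk hx₀).1 _).1 h1 0 (by omega))
  · intro i hi1 hi2 c hc x hx
    obtain ⟨p, hp⟩ : ∃ p, i + p + 1 = k := ⟨k - 1 - i, by omega⟩
    rw [hchart.G_eq (by omega) hx, show k - 1 - i = p by omega]
    intro m h1 h2
    have hcz : ∀ y ∈ U, ∀ l ≤ p + 1, fderiv ℝ (z l) y (c y) = 0 := fun y hy l hl =>
      hchart.fderiv_characteristicFields hi1 (by omega) hp hc hy hl
    rw [hchart.contactForm_lieBracket_drift h2
      (contDiffAt_of_mem_sections φ.open_source hc.1 hx)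
      ((φ.open_source.eventually_mem hx).mono hcz) hx, neg_eq_zero]
    -- `F` depends only on `z_0, …, z_{m+1}`, which are constant along the line through `φ x`
    -- in the direction of `c x`.
    set F : (Fin (k + 1) → ℝ) → ℝ := fun y => contactForm z m y (S.f y) with hF
    have hFh : ∀ y ∈ U, F y = h m fun l => φ y (Fin.castLE (by omega) l) := by
      intro y hy
      have h3 := (hTz y hy).2.1 m h1 (by omega)
      have h4 := (hfb y hy).2.1
      have h5 : ∑ i, α y i • S.g i y ∈ contactDistribution z (k - 1) y := by
        rw [← hchart.control_eq y hy]
        exact Submodule.sum_mem _ fun i _ => Submodule.smul_mem _ _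
          (Submodule.subset_span ⟨i, rfl⟩)
      have h6 : F y = contactForm z m y (S.f y + ∑ i, α y i • S.g i y) := by
        rw [map_add, h5 m h1 (by omega), add_zero]
      rw [h6, contactForm_apply, hd y hy m (by omega), hd y hy 0 (by omega), h4, h3.1]
      have h7 := (hTz y hy).1.1
      rw [show (⟨0, by omega⟩ : Fin (k + 1)) = 0 from rfl, h7, mul_zero, sub_zero]
    set w := fderiv ℝ φ x (c x) with hw
    have hw0 : ∀ (l : Fin (k + 1)), (l : ℕ) ≤ m + 1 → w l = 0 := fun l hl => by
      rw [hw, ← hd x hx l l.2]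
      exact hcz x hx l (by omega)
    have hFs : DifferentiableAt ℝ F x :=
      (contDiffAt_contactForm_apply (fun m => hchart.smooth_z m x hx)
        (S.smooth_f.contDiffAt (S.isOpen_X.mem_nhds (hS hx)))).differentiableAt (by simp)
    have h3 : HasDerivAt (fun t : ℝ => φ x + t • w) w 0 := by
      simpa using ((hasDerivAt_id (0 : ℝ)).smul_const w).const_add (φ x)
    have h4 : HasDerivAt (fun t : ℝ => φ.symm (φ x + t • w)) (c x) 0 := by
      have h5 : HasFDerivAt φ.symm (fderiv ℝ φ.symm (φ x)) (φ x + (0 : ℝ) • w) := by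
        rw [zero_smul, add_zero]
        exact ((contDiffAt_chart_symm hφ' hx).differentiableAt (by simp)).hasFDerivAt
      have h6 := h5.comp_hasDerivAt (0 : ℝ) h3
      rwa [hw, fderiv_chart_symm_apply hφ hφ' hx] at h6
    have h5 : HasDerivAt (fun t : ℝ => F (φ.symm (φ x + t • w))) (fderiv ℝ F x (c x)) 0 := by
      refine HasFDerivAt.comp_hasDerivAt (l := F) (0 : ℝ) ?_ h4
      rw [zero_smul, add_zero, φ.left_inv hx]
      exact hFs.hasFDerivAt
    have h6 : (fun t : ℝ => F (φ.symm (φ x + t • w))) =ᶠ[𝓝 0] fun _ => F x := by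
      have h7 : ∀ᶠ t : ℝ in 𝓝 0, φ x + t • w ∈ φ.target :=
        h3.continuousAt.eventually_mem (by
          rw [zero_smul, add_zero]
          exact φ.open_target.mem_nhds (φ.map_source hx))
      filter_upwards [h7] with t ht
      rw [hFh _ (φ.map_target ht), hFh x hx, φ.right_inv ht]
      congr 1
      funext l
      rw [Pi.add_apply, Pi.smul_apply, hw0 _ (by simp; omega), smul_zero, add_zero]
    exact h5.unique ((hasDerivAt_const (0 : ℝ) (F x)).congr_of_eventuallyEq h6)

end Chart

/-! ### From two functions to a full chart -/

section Sequence

open TangentDistribution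

variable {k : ℕ}

/-- Every vector of a derived distribution is the value of one of its smooth sections. -/
theorem exists_section_through (S : ControlAffineSystem (k + 1)) {U : Set (Fin (k + 1) → ℝ)}
    (hU : IsOpen U) (hUX : U ⊆ S.X) (i : ℕ) {x v : Fin (k + 1) → ℝ} (hv : v ∈ S.G U i x) :
    ∃ V ∈ (S.G U i).sections U, V x = v := by
  have hadd : ∀ {D : TangentDistribution (k + 1)} {V W}, V ∈ D.sections U → W ∈ D.sections U →
      (fun y => V y + W y) ∈ D.sections U := fun hV hW =>
    ⟨hV.1.add hW.1, fun y hy => Submodule.add_mem _ (hV.2 y hy) (hW.2 y hy)⟩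
  have hsmul : ∀ {D : TangentDistribution (k + 1)} {V} (c : ℝ), V ∈ D.sections U →
      (fun y => c • V y) ∈ D.sections U := fun c hV =>
    ⟨hV.1.const_smul c, fun y hy => Submodule.smul_mem _ c (hV.2 y hy)⟩
  have hzero : ∀ {D : TangentDistribution (k + 1)}, (fun _ => 0) ∈ D.sections U :=
    ⟨contDiffOn_const, fun y _ => Submodule.zero_mem _⟩
  induction i generalizing v with
  | zero =>
    refine Submodule.span_induction ?_ ?_ ?_ ?_ hv
    · rintro _ ⟨j, rfl⟩
      exact ⟨S.g j, ⟨(S.smooth_g j).mono hUX, fun y _ => Submodule.subset_span ⟨j, rfl⟩⟩, rfl⟩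
    · exact ⟨_, hzero, rfl⟩
    · rintro _ _ _ _ ⟨V, hV, rfl⟩ ⟨W, hW, rfl⟩
      exact ⟨_, hadd hV hW, rfl⟩
    · rintro c _ _ ⟨V, hV, rfl⟩
      exact ⟨_, hsmul c hV, rfl⟩
  | succ i ih =>
    obtain ⟨v₁, hv₁, v₂, hv₂, rfl⟩ := Submodule.mem_sup.1 hv
    obtain ⟨V₁, hV₁, rfl⟩ := ih hv₁
    have h1 : V₁ ∈ (S.G U (i + 1)).sections U :=
      ⟨hV₁.1, fun y hy => derivedFlag_le_succ i (hV₁.2 y hy)⟩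
    suffices h2 : ∃ V ∈ (S.G U (i + 1)).sections U, V x = v₂ by
      obtain ⟨V₂, hV₂, rfl⟩ := h2
      exact ⟨_, hadd h1 hV₂, rfl⟩
    refine Submodule.span_induction ?_ ?_ ?_ ?_ hv₂
    · rintro _ ⟨V, hV, W, hW, rfl⟩
      refine ⟨VectorField.lieBracket ℝ V W, ⟨fun y hy => ?_, fun y _ => ?_⟩, rfl⟩
      · exact ((contDiffAt_of_mem_sections hU hV hy).lieBracket_vectorField
          (contDiffAt_of_mem_sections hU hW hy) (by simp)).contDiffWithinAt
      · exact lieBracket_mem_derived (D := S.G U i) hV hW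
    · exact ⟨_, hzero, rfl⟩
    · rintro _ _ _ _ ⟨V, hV, rfl⟩ ⟨W, hW, rfl⟩
      exact ⟨_, hadd hV hW, rfl⟩
    · rintro c _ _ ⟨V, hV, rfl⟩
      exact ⟨_, hsmul c hV, rfl⟩

/-- A sequence of functions `z_0, z_1, …` generated by `z_{m+1} = g(z_m) / g(z_0)` for a control
field `g = g_a` transverse to `dz_0`, and such that `dz_1 - z_2 dz_0` is a nonzero form
annihilating `𝒢^{k-2}`. -/
structure IsContactSequence (S : ControlAffineSystem (k + 1)) (U N : Set (Fin (k + 1) → ℝ))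
    (x₀ : Fin (k + 1) → ℝ) (a : Fin 2) (z : ℕ → (Fin (k + 1) → ℝ) → ℝ) : Prop where
  isOpen_U : IsOpen U
  subset_X : U ⊆ S.X
  isOpen_N : IsOpen N
  subset_U : N ⊆ U
  mem_N : x₀ ∈ N
  smooth_z : ∀ m, ∀ x ∈ N, ContDiffAt ℝ ∞ (z m) x
  transverse : ∀ x ∈ N, fderiv ℝ (z 0) x (S.g a x) ≠ 0
  control_eq_zero : ∀ m, 1 ≤ m → ∀ x ∈ N, contactForm z m x (S.g a x) = 0
  G_le : ∀ x ∈ N, S.G U (k - 2) x ≤ contactDistribution z 1 x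
  ne_zero : ∃ v, contactForm z 1 x₀ v ≠ 0

namespace IsContactSequence

variable {S : ControlAffineSystem (k + 1)} {U N : Set (Fin (k + 1) → ℝ)}
  {x₀ : Fin (k + 1) → ℝ} {a : Fin 2} {z : ℕ → (Fin (k + 1) → ℝ) → ℝ} {x : Fin (k + 1) → ℝ}

theorem fderiv_control (h : IsContactSequence S U N x₀ a z) {m : ℕ} (hm : 1 ≤ m) (hx : x ∈ N) :
    fderiv ℝ (z m) x (S.g a x) = z (m + 1) x * fderiv ℝ (z 0) x (S.g a x) :=
  sub_eq_zero.1 (h.control_eq_zero m hm x hx)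

theorem g_mem_sections (h : IsContactSequence S U N x₀ a z) (b : Fin 2) (i : ℕ) :
    S.g b ∈ (S.G U i).sections U :=
  ⟨(S.smooth_g b).mono h.subset_X, fun _ _ =>
    derivedFlag_mono (D := S.controlDistribution) (Nat.zero_le i)
      (Submodule.subset_span ⟨b, rfl⟩)⟩

/-- Descending induction: if `dz_p - z_{p+1} dz_0` annihilates `𝒢^{i+1}`, then, bracketing with `g`,
`dz_{p+1} - z_{p+2} dz_0` annihilates `𝒢^i`. -/
theorem G_le_contactDistribution (h : IsContactSequence S U N x₀ a z) {i p : ℕ}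
    (hip : i + p + 1 = k) (hp : 1 ≤ p) : ∀ x ∈ N, S.G U i x ≤ contactDistribution z p x := by
  induction p, hp using Nat.le_induction generalizing i with
  | base => rw [show i = k - 2 by omega]; exact h.G_le
  | succ p hp ih =>
    have ih' := ih (i := i + 1) (by omega)
    intro x hx v hv m h1 h2
    rcases Nat.lt_or_ge m (p + 1) with hm | hm
    · exact ih' x hx (derivedFlag_le_succ i hv) m h1 (by omega)
    obtain rfl : m = p + 1 := by omega
    obtain ⟨V, hV, rfl⟩ := exists_section_through S h.isOpen_U h.subset_X i hv
    have h3 := ih' x hx (lieBracket_mem_derived (D := S.G U i) (h.g_mem_sections a i) hV) p hp le_rfl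
    rw [contactForm_lieBracket_of_eventually_eq_zero p (fun m => h.smooth_z m x hx)
      (contDiffAt_of_mem_sections h.isOpen_U (h.g_mem_sections a i) (h.subset_U hx))
      (contDiffAt_of_mem_sections h.isOpen_U hV (h.subset_U hx)),
      h.fderiv_control (by omega) hx] at h3
    · have h4 : -fderiv ℝ (z 0) x (S.g a x) * contactForm z (p + 1) x (V x) = 0 := by
        rw [contactForm_apply]
        linear_combination h3
      exact (mul_eq_zero.1 h4).resolve_left (neg_ne_zero.2 (h.transverse x hx))
    · filter_upwards [h.isOpen_N.eventually_mem hx] with y hy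
      exact h.control_eq_zero p hp y hy
    · filter_upwards [h.isOpen_N.eventually_mem hx] with y hy
      exact ih' y hy (derivedFlag_le_succ i (hV.2 y (h.subset_U hy))) p hp le_rfl

/-- If `dz_p - z_{p+1} dz_0` annihilated `𝒢^{k-p}` at `x₀`, then so would all the forms with smaller
index, down to `dz_1 - z_2 dz_0`, which would annihilate `𝒢^{k-1}`, the whole tangent space. -/
theorem exists_contactForm_ne_zero (h : IsContactSequence S U N x₀ a z)
    (hCh1 : S.G U (k - 1) x₀ = ⊤) {p i : ℕ} (hp : 1 ≤ p) (hip : i + p = k) :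
    ∃ v ∈ S.G U i x₀, contactForm z p x₀ v ≠ 0 := by
  by_contra! hcon
  obtain ⟨v, hv⟩ := h.ne_zero
  suffices H : ∀ v ∈ S.G U (k - 1) x₀, contactForm z 1 x₀ v = 0 from
    hv (H v (hCh1 ▸ Submodule.mem_top))
  clear hv v
  induction p, hp using Nat.le_induction generalizing i with
  | base => rwa [show k - 1 = i by omega]
  | succ p hp ih =>
    refine ih (i := i + 1) (by omega) fun v hv => ?_
    have hx := h.mem_N
    have hle := h.G_le_contactDistribution (i := i) (p := p) (by omega) hp
    have hmem := derived_le (D := S.G U i)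
      (P := LinearMap.ker (contactForm z p x₀ : (Fin (k + 1) → ℝ) →ₗ[ℝ] ℝ))
      (fun w hw => hle x₀ hx hw p hp le_rfl) (fun V hV W hW => ?_) hv
    · exact hmem
    have key : ∀ Y ∈ (S.G U i).sections U, ∀ᶠ y in 𝓝 x₀, contactForm z p y (Y y) = 0 := by
      intro Y hY
      filter_upwards [h.isOpen_N.eventually_mem hx] with y hy
      exact hle y hy (hY.2 y (h.subset_U hy)) p hp le_rfl
    have hV0 := hcon _ (hV.2 x₀ (h.subset_U hx))
    have hW0 := hcon _ (hW.2 x₀ (h.subset_U hx))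
    rw [contactForm_apply] at hV0 hW0
    rw [LinearMap.mem_ker, ContinuousLinearMap.coe_coe,
      contactForm_lieBracket_of_eventually_eq_zero p (fun m => h.smooth_z m x₀ hx)
      (contDiffAt_of_mem_sections h.isOpen_U hV (h.subset_U hx))
      (contDiffAt_of_mem_sections h.isOpen_U hW (h.subset_U hx)) (key V hV) (key W hW)]
    linear_combination fderiv ℝ (z 0) x₀ (W x₀) * hV0 - fderiv ℝ (z 0) x₀ (V x₀) * hW0

/-- The map with components `z_0, …, z_k` has invertible differential at `x₀`. -/
theorem surjective_fderiv (h : IsContactSequence S U N x₀ a z)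
    (hCh1 : S.G U (k - 1) x₀ = ⊤) :
    Function.Surjective (LinearMap.pi fun m : Fin (k + 1) =>
      (fderiv ℝ (z m) x₀ : (Fin (k + 1) → ℝ) →ₗ[ℝ] ℝ)) := by
  set L := LinearMap.pi fun m : Fin (k + 1) =>
      (fderiv ℝ (z m) x₀ : (Fin (k + 1) → ℝ) →ₗ[ℝ] ℝ) with hL
  rw [← LinearMap.range_eq_top]
  by_contra hne
  obtain ⟨c, hc0, hc⟩ := Submodule.exists_le_ker_of_lt_top _ (lt_top_iff_ne_top.2 hne)
  have hsum : ∀ v, ∑ m : Fin (k + 1), fderiv ℝ (z m) x₀ v * c (Pi.single m 1) = 0 := by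
    intro v
    have h1 : c (L v) = 0 := hc (LinearMap.mem_range_self L v)
    have h2 : L v = ∑ m : Fin (k + 1), L v m • Pi.single m (1 : ℝ) := by
      ext l
      simp [Finset.sum_apply, Pi.single_apply]
    rw [h2, map_sum] at h1
    simpa [hL] using h1
  -- The vectors `w_p ∈ 𝒢^{k-p}` with `dz_m(w_p) = 0` for `m < p` and `dz_p(w_p) ≠ 0`.
  have hw : ∀ p ≤ k, ∃ w, fderiv ℝ (z p) x₀ w ≠ 0 ∧ ∀ m < p, fderiv ℝ (z m) x₀ w = 0 := by
    intro p hpk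
    rcases Nat.eq_zero_or_pos p with rfl | hp
    · exact ⟨_, h.transverse x₀ h.mem_N, fun m hm => absurd hm (by omega)⟩
    obtain ⟨v, hv, hvp⟩ := h.exists_contactForm_ne_zero hCh1 (i := k - p) hp (by omega)
    have ht := h.transverse x₀ h.mem_N
    set r := fderiv ℝ (z 0) x₀ v / fderiv ℝ (z 0) x₀ (S.g a x₀) with hr
    have h0 : fderiv ℝ (z 0) x₀ (v - r • S.g a x₀) = 0 := by
      rw [map_sub, map_smul, smul_eq_mul, hr, div_mul_cancel₀ _ ht, sub_self]
    have hm : ∀ m, 1 ≤ m → fderiv ℝ (z m) x₀ (v - r • S.g a x₀) = contactForm z m x₀ v := by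
      intro m hm
      have h1 : contactForm z m x₀ (v - r • S.g a x₀) = contactForm z m x₀ v := by
        rw [map_sub, map_smul, h.control_eq_zero m hm x₀ h.mem_N, smul_zero, sub_zero]
      rw [← h1, contactForm_apply, h0, mul_zero, sub_zero]
    refine ⟨v - r • S.g a x₀, by rwa [hm p hp], fun m hmp => ?_⟩
    rcases Nat.eq_zero_or_pos m with rfl | hm0
    · exact h0
    · rw [hm m hm0]
      exact h.G_le_contactDistribution (i := k - p) (p := p - 1) (by omega) (by omega) x₀ h.mem_N
        hv m hm0 (by omega)
  have hcz : ∀ p : Fin (k + 1), c (Pi.single p 1) = 0 := by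
    intro p
    induction p using WellFoundedGT.induction with
    | ind p ih =>
      obtain ⟨w, hwp, hwm⟩ := hw p (Nat.lt_succ_iff.1 p.2)
      have h1 := hsum w
      rw [Finset.sum_eq_single p] at h1
      · exact (mul_eq_zero.1 h1).resolve_left hwp
      · intro q _ hqp
        rcases lt_or_gt_of_ne hqp with hq | hq
        · rw [hwm q hq, zero_mul]
        · rw [ih q hq, mul_zero]
      · exact fun hp => absurd (Finset.mem_univ p) hp
  exact hc0 (LinearMap.pi_ext fun i r => by
    rw [← mul_one r, ← smul_eq_mul, Pi.single_smul, map_smul, hcz, smul_zero, LinearMap.zero_apply])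

/-- The determinant of the matrix of derivatives of `z_0` and `z_k` along the control fields. -/
noncomputable def controlDet (S : ControlAffineSystem (k + 1)) (z : ℕ → (Fin (k + 1) → ℝ) → ℝ)
    (x : Fin (k + 1) → ℝ) : ℝ :=
  fderiv ℝ (z 0) x (S.g 0 x) * fderiv ℝ (z k) x (S.g 1 x) -
    fderiv ℝ (z 0) x (S.g 1 x) * fderiv ℝ (z k) x (S.g 0 x)

theorem controlDet_ne_zero (h : IsContactSequence S U N x₀ a z) (hk : 1 ≤ k)
    (hCh1 : S.G U (k - 1) x₀ = ⊤) : controlDet S z x₀ ≠ 0 := by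
  intro h0
  obtain ⟨v, hv, hvk⟩ := h.exists_contactForm_ne_zero hCh1 (i := 0) hk (by omega)
  have ht := h.transverse x₀ h.mem_N
  have hgk := h.fderiv_control hk h.mem_N
  refine hvk (Submodule.span_induction (p := fun v _ => contactForm z k x₀ v = 0) ?_ (map_zero _)
    (fun v w _ _ hv hw => by rw [map_add, hv, hw, add_zero])
    (fun c v _ hv => by rw [map_smul, hv, smul_zero]) hv)
  rintro _ ⟨b, rfl⟩
  have h1 : fderiv ℝ (z 0) x₀ (S.g a x₀) * contactForm z k x₀ (S.g b x₀) = 0 := by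
    rw [controlDet] at h0
    rw [contactForm_apply]
    fin_cases a <;> fin_cases b <;> simp only [Fin.zero_eta, Fin.mk_one] at hgk ⊢
    · linear_combination fderiv ℝ (z 0) x₀ (S.g 0 x₀) * hgk
    · linear_combination h0 + fderiv ℝ (z 0) x₀ (S.g 1 x₀) * hgk
    · linear_combination -h0 + fderiv ℝ (z 0) x₀ (S.g 0 x₀) * hgk
    · linear_combination fderiv ℝ (z 0) x₀ (S.g 1 x₀) * hgk
  exact (mul_eq_zero.1 h1).resolve_left ht

theorem contDiffAt_fderiv_g (h : IsContactSequence S U N x₀ a z) (m : ℕ) (b : Fin 2)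
    (hx : x ∈ N) : ContDiffAt ℝ ∞ (fun y => fderiv ℝ (z m) y (S.g b y)) x :=
  (h.smooth_z m x hx).fderiv_apply_smooth
    ((S.smooth_g b).contDiffAt (S.isOpen_X.mem_nhds (h.subset_X (h.subset_U hx))))

theorem contDiffAt_controlDet (h : IsContactSequence S U N x₀ a z) (hx : x ∈ N) :
    ContDiffAt ℝ ∞ (controlDet S z) x :=
  ((h.contDiffAt_fderiv_g 0 0 hx).mul (h.contDiffAt_fderiv_g k 1 hx)).sub
    ((h.contDiffAt_fderiv_g 0 1 hx).mul (h.contDiffAt_fderiv_g k 0 hx))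

/-- The feedback matrix normalizing the derivatives of `z_0` and `z_k` along the control fields. -/
noncomputable def controlMatrix (S : ControlAffineSystem (k + 1))
    (z : ℕ → (Fin (k + 1) → ℝ) → ℝ) (x : Fin (k + 1) → ℝ) : Fin 2 → Fin 2 → ℝ :=
  ![![fderiv ℝ (z k) x (S.g 1 x) / controlDet S z x,
      -fderiv ℝ (z 0) x (S.g 1 x) / controlDet S z x],
    ![-fderiv ℝ (z k) x (S.g 0 x) / controlDet S z x,
      fderiv ℝ (z 0) x (S.g 0 x) / controlDet S z x]]

theorem contDiffAt_controlMatrix (h : IsContactSequence S U N x₀ a z) (hx : x ∈ N)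
    (hD : controlDet S z x ≠ 0) : ContDiffAt ℝ ∞ (controlMatrix S z) x := by
  have hd := h.contDiffAt_controlDet hx
  refine contDiffAt_pi.2 fun i => contDiffAt_pi.2 fun j => ?_
  fin_cases i <;> fin_cases j
  · exact (h.contDiffAt_fderiv_g k 1 hx).div hd hD
  · exact (h.contDiffAt_fderiv_g 0 1 hx).neg.div hd hD
  · exact (h.contDiffAt_fderiv_g k 0 hx).neg.div hd hD
  · exact (h.contDiffAt_fderiv_g 0 0 hx).div hd hD

theorem isUnit_det_controlMatrix (hD : controlDet S z x ≠ 0) :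
    IsUnit (Matrix.of (controlMatrix S z x)).det := by
  rw [Matrix.det_fin_two, isUnit_iff_ne_zero]
  simp only [controlMatrix, Matrix.of_apply, Matrix.cons_val_zero, Matrix.cons_val_one]
  have : fderiv ℝ (z k) x (S.g 1 x) / controlDet S z x * (fderiv ℝ (z 0) x (S.g 0 x) /
      controlDet S z x) - -fderiv ℝ (z 0) x (S.g 1 x) / controlDet S z x *
      (-fderiv ℝ (z k) x (S.g 0 x) / controlDet S z x) = (controlDet S z x)⁻¹ := by
    field_simp
    rw [controlDet]
    ring
  rw [this]
  exact inv_ne_zero hD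

theorem fderiv_zero_controlMatrix (hD : controlDet S z x ≠ 0) (j : Fin 2) :
    fderiv ℝ (z 0) x (∑ i, controlMatrix S z x i j • S.g i x) = if j = 0 then 1 else 0 := by
  rw [Fin.sum_univ_two, map_add, map_smul, map_smul, smul_eq_mul, smul_eq_mul]
  fin_cases j <;>
    simp only [controlMatrix, Matrix.cons_val_zero, Matrix.cons_val_one, Fin.zero_eta, Fin.mk_one,
      Fin.isValue, if_true, one_ne_zero, if_false]
  · field_simp
    rw [controlDet]
    ring
  · ring

theorem fderiv_last_controlMatrix (hD : controlDet S z x ≠ 0) (j : Fin 2) :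
    fderiv ℝ (z k) x (∑ i, controlMatrix S z x i j • S.g i x) = if j = 0 then 0 else 1 := by
  rw [Fin.sum_univ_two, map_add, map_smul, map_smul, smul_eq_mul, smul_eq_mul]
  fin_cases j <;>
    simp only [controlMatrix, Matrix.cons_val_zero, Matrix.cons_val_one, Fin.zero_eta, Fin.mk_one,
      Fin.isValue, if_true, one_ne_zero, if_false]
  · ring
  · field_simp
    rw [controlDet]
    ring

/-- A local chart with coordinates `z_0, …, z_k` around `x₀` whose image is a ball. -/
theorem exists_chart (h : IsContactSequence S U N x₀ a z) (hk : 1 ≤ k)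
    (hCh1 : S.G U (k - 1) x₀ = ⊤) :
    ∃ (φ : OpenPartialHomeomorph (Fin (k + 1) → ℝ) (Fin (k + 1) → ℝ)) (r : ℝ),
      x₀ ∈ φ.source ∧ φ.source ⊆ N ∧ φ.target = Metric.ball (φ x₀) r ∧
      ContDiffOn ℝ ∞ φ φ.source ∧ ContDiffOn ℝ ∞ φ.symm φ.target ∧
      (∀ m (hm : m < k + 1), ∀ y ∈ φ.source, z m y = φ y ⟨m, hm⟩) ∧
      ∀ y ∈ φ.source, controlDet S z y ≠ 0 := by
  let F : (Fin (k + 1) → ℝ) → (Fin (k + 1) → ℝ) := fun y m => z m y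
  have hFs : ∀ y ∈ N, ContDiffAt ℝ ∞ F y := fun y hy => contDiffAt_pi.2 fun m => h.smooth_z m y hy
  have hF' := ((hFs x₀ h.mem_N).differentiableAt (by simp)).hasFDerivAt
  have hsurj : Function.Surjective (fderiv ℝ F x₀ : (Fin (k + 1) → ℝ) →ₗ[ℝ] (Fin (k + 1) → ℝ)) := by
    convert h.surjective_fderiv hCh1 using 1
    ext1 v
    ext m
    exact congrArg (fun A : (Fin (k + 1) → ℝ) →L[ℝ] ℝ => A v) ((hasFDerivAt_pi'.1 hF' m).fderiv.symm)
  let A := (LinearEquiv.ofBijective (fderiv ℝ F x₀ : (Fin (k + 1) → ℝ) →ₗ[ℝ] (Fin (k + 1) → ℝ))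
    ⟨LinearMap.injective_iff_surjective.2 hsurj, hsurj⟩).toContinuousLinearEquiv
  have hA : HasFDerivAt F (A : (Fin (k + 1) → ℝ) →L[ℝ] (Fin (k + 1) → ℝ)) x₀ := by
    refine hF'.congr_fderiv ?_
    ext1 v
    rfl
  obtain ⟨e₀, he₀, he₀F, he₀s, he₀s'⟩ := exists_openPartialHomeomorph_contDiffOn_symm
    ((h.isOpen_N.eventually_mem h.mem_N).mono hFs) hA
  have hgood : ∀ᶠ y in 𝓝 x₀, y ∈ N ∧ controlDet S z y ≠ 0 :=
    (h.isOpen_N.eventually_mem h.mem_N).and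
      ((h.contDiffAt_controlDet h.mem_N).continuousAt.eventually_ne (h.controlDet_ne_zero hk hCh1))
  obtain ⟨s, hs, hso, hx₀s⟩ := eventually_nhds_iff.1 hgood
  let e := e₀.restrOpen s hso
  have hx₀e : x₀ ∈ e.source := ⟨he₀, hx₀s⟩
  obtain ⟨r, hr, hball⟩ := Metric.isOpen_iff.1 e.open_target _ (e.map_source hx₀e)
  let φ := (e.symm.restrOpen (Metric.ball (e x₀) r) Metric.isOpen_ball).symm
  have hφF : (φ : (Fin (k + 1) → ℝ) → (Fin (k + 1) → ℝ)) = F := he₀F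
  have hφt : φ.target = Metric.ball (φ x₀) r := inter_eq_right.2 hball
  have hx₀φ : x₀ ∈ φ.source := by
    have h1 : φ x₀ ∈ φ.target := by rw [hφt]; exact Metric.mem_ball_self hr
    have h2 := φ.map_target h1
    have h3 : φ.symm (φ x₀) = x₀ := e.left_inv hx₀e
    rwa [h3] at h2
  have hφe : ∀ y ∈ φ.source, y ∈ e.source := by
    intro y hy
    have h1 : φ y ∈ e.target := (φ.map_source hy).1
    have h2 : e.symm (φ y) = y := φ.left_inv hy
    exact h2 ▸ e.map_target h1
  refine ⟨φ, r, hx₀φ, fun y hy => (hs y (hφe y hy).2).1, hφt, fun y hy => ?_, fun y hy => ?_,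
    fun m hm y hy => by rw [hφF], fun y hy => (hs y (hφe y hy).2).2⟩
  · rw [hφF]
    exact (he₀s y (hφe y hy).1).contDiffWithinAt
  · exact (he₀s' y hy.1.1).contDiffWithinAt

/-- The functions `z_0, …, z_k` form an adapted chart. -/
theorem isAdaptedChart (h : IsContactSequence S U N x₀ a z) (hk : 2 ≤ k)
    {φ : OpenPartialHomeomorph (Fin (k + 1) → ℝ) (Fin (k + 1) → ℝ)}
    (hφN : φ.source ⊆ N) (hφ : ContDiffOn ℝ ∞ φ φ.source)
    (hφ' : ContDiffOn ℝ ∞ φ.symm φ.target)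
    (hz : ∀ m (hm : m < k + 1), ∀ y ∈ φ.source, z m y = φ y ⟨m, hm⟩)
    (hD : ∀ y ∈ φ.source, controlDet S z y ≠ 0) :
    IsAdaptedChart S U φ.source z (S.g a) (coordinateField φ) where
  isOpen_U := h.isOpen_U
  subset_X := h.subset_X
  isOpen_N := φ.open_source
  subset_U := hφN.trans h.subset_U
  smooth_z m x hx := h.smooth_z m x (hφN hx)
  smooth_g x hx := (S.smooth_g a).contDiffAt
    (S.isOpen_X.mem_nhds (h.subset_X (h.subset_U (hφN hx))))
  smooth_Z l x hx := contDiffAt_coordinateField hφ hφ' l hx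
  dual x hx m hm l _ := fderiv_coordinate_coordinateField hφ hφ' hz hx hm l
  inj x hx := eq_zero_of_fderiv_coordinate hφ hφ' hz hx
  g_mem x _ := Submodule.subset_span ⟨a, rfl⟩
  transverse x hx := h.transverse x (hφN hx)
  control_eq x hx := by
    have hle : S.controlDistribution x ≤ contactDistribution z (k - 1) x :=
      h.G_le_contactDistribution (i := 0) (p := k - 1) (by omega) (by omega) x (hφN hx)
    refine le_antisymm hle fun v hv => ?_
    set γ : Fin 2 → (Fin (k + 1) → ℝ) := fun j => ∑ i, controlMatrix S z x i j • S.g i x with hγ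
    have hγmem : ∀ j, γ j ∈ S.controlDistribution x := fun j =>
      Submodule.sum_mem _ fun i _ => Submodule.smul_mem _ _ (Submodule.subset_span ⟨i, rfl⟩)
    have hγ0 : ∀ j, fderiv ℝ (z 0) x (γ j) = if j = 0 then 1 else 0 :=
      fderiv_zero_controlMatrix (hD x hx)
    have hγk : ∀ j, fderiv ℝ (z k) x (γ j) = if j = 0 then 0 else 1 :=
      fderiv_last_controlMatrix (hD x hx)
    have h1 : v = fderiv ℝ (z 0) x v • γ 0 + fderiv ℝ (z k) x v • γ 1 := by
      refine sub_eq_zero.1 (eq_zero_of_fderiv_coordinate hφ hφ' hz hx _ fun m hm => ?_)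
      rcases Nat.eq_zero_or_pos m with rfl | hm0
      · simp [hγ0]
      rcases Nat.lt_or_ge m k with hmk | hmk
      · have h2 := fderiv_eq_mul_of_mem_contactDistribution (Submodule.sub_mem _ hv (hle
          (Submodule.add_mem _ (Submodule.smul_mem _ (fderiv ℝ (z 0) x v) (hγmem 0))
            (Submodule.smul_mem _ (fderiv ℝ (z k) x v) (hγmem 1))))) hm0 (by omega)
        rw [h2]
        simp [hγ0]
      · obtain rfl : m = k := by omega
        simp [hγk]
    rw [h1]
    exact Submodule.add_mem _ (Submodule.smul_mem _ _ (hγmem 0)) (Submodule.smul_mem _ _ (hγmem 1))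

/-- In an adapted chart, `(dz_m - z_{m+1} dz_0)(f)` has vanishing derivative in the directions that
annihilate `z_0, …, z_{m+1}`. -/
theorem _root_.IsAdaptedChart.fderiv_contactForm_drift {g : (Fin (k + 1) → ℝ) → (Fin (k + 1) → ℝ)}
    {Z : ℕ → (Fin (k + 1) → ℝ) → (Fin (k + 1) → ℝ)} (h : IsAdaptedChart S U N z g Z)
    (hComp : S.Comp U) {m : ℕ} (h1 : 1 ≤ m) (hmk : m < k) (hx : x ∈ N) {w : Fin (k + 1) → ℝ}
    (hw : ∀ l ≤ m + 1, fderiv ℝ (z l) x w = 0) :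
    fderiv ℝ (fun y => contactForm z m y (S.f y)) x w = 0 := by
  obtain ⟨Y, hYs, hYx, hY⟩ := h.exists_constantField hx w
  rcases Nat.lt_or_ge (m + 1) k with hm | hm
  · have hYz : ∀ y ∈ N, ∀ l ≤ m + 1, fderiv ℝ (z l) y (Y y) = 0 := fun y hy l hl => by
      rw [hY y hy l (by omega), hw l hl]
    obtain ⟨c, hc, hcY⟩ := h.exists_characteristicFields (i := k - 1 - m) (p := m) (by omega)
      hYs hYz hx
    have h2 := hComp (k - 1 - m) (by omega) (by omega) c hc x (h.subset_U hx)
    rw [h.G_eq (by omega) hx, show k - 1 - (k - 1 - m) = m by omega] at h2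
    have h3 := h2 m h1 le_rfl
    rw [h.contactForm_lieBracket_drift le_rfl
      (contDiffAt_of_mem_sections h.isOpen_U hc.1 (h.subset_U hx)) ?_ hx, neg_eq_zero,
      hcY.self_of_nhds, hYx] at h3
    · exact h3
    · filter_upwards [hcY, h.eventually_mem hx] with y hy hyN
      rw [hy]
      exact hYz y hyN
  · have hw0 : w = 0 := h.inj x hx w fun l hl => hw l (by omega)
    rw [hw0, map_zero]

/-- In the chart `z_0, …, z_k`, and with the derivatives of `z_0` and `z_k` along trajectories as new
controls, the system is in triangular form. By (Comp) the partial derivatives of the `m`-th drift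
component with respect to `z_{m+2}, …, z_k` vanish; as the image of the chart is a ball, this makes
it a function of `z_0, …, z_{m+1}`. -/
theorem exists_triangularChainedForm (h : IsContactSequence S U N x₀ a z) (hk : 2 ≤ k)
    (hCh1 : S.G U (k - 1) x₀ = ⊤) (hComp : S.Comp U) :
    ∃ (T : ControlAffineSystem (k + 1)) (z₀ : Fin (k + 1) → ℝ),
        IsTriangularChainedForm T ∧ StaticFeedbackEquivalent S x₀ T z₀ := by
  obtain ⟨φ, r, hx₀, hφN, hφt, hφ, hφ', hz, hD⟩ := h.exists_chart (by omega) hCh1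
  have hchart := h.isAdaptedChart hk hφN hφ hφ' hz hD
  set p₀ := φ x₀ with hp₀
  -- The drift of the transformed system.
  let F : ℕ → (Fin (k + 1) → ℝ) → ℝ := fun m y => contactForm z m y (S.f y)
  have hSf : ∀ y ∈ φ.source, ContDiffAt ℝ ∞ S.f y := fun y hy =>
    S.smooth_f.contDiffAt (S.isOpen_X.mem_nhds (h.subset_X (h.subset_U (hφN hy))))
  have hF : ∀ m, ∀ y ∈ φ.source, ContDiffAt ℝ ∞ (F m) y := fun m y hy =>
    contDiffAt_contactForm_apply (fun m => h.smooth_z m y (hφN hy)) (hSf y hy)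
  have hFφ : ∀ m, ∀ p ∈ φ.target, ContDiffAt ℝ ∞ (fun q => F m (φ.symm q)) p := fun m p hp =>
    (hF m _ (φ.map_target hp)).comp p (hφ'.contDiffAt (φ.open_target.mem_nhds hp))
  have hconst : ∀ m, 1 ≤ m → m < k → ∀ p ∈ φ.target, ∀ q ∈ φ.target,
      (∀ l : Fin (k + 1), (l : ℕ) ≤ m + 1 → p l = q l) → F m (φ.symm p) = F m (φ.symm q) := by
    intro m h1 hm p hp q hq hpq
    have hline : ∀ t ∈ Icc (0 : ℝ) 1,
        HasDerivWithinAt (fun t : ℝ => F m (φ.symm (p + t • (q - p)))) 0 (Icc 0 1) t := by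
      intro t ht
      have hmem : p + t • (q - p) ∈ φ.target := by
        rw [hφt] at hp hq ⊢
        refine (convex_ball _ r).segment_subset hp hq ?_
        rw [segment_eq_image']
        exact ⟨t, ht, rfl⟩
      set y := φ.symm (p + t • (q - p)) with hy
      have hyS : y ∈ φ.source := φ.map_target hmem
      have hφy : φ y = p + t • (q - p) := φ.right_inv hmem
      have h2 : HasDerivAt (fun t : ℝ => p + t • (q - p)) (q - p) t := by
        simpa using ((hasDerivAt_id t).smul_const (q - p)).const_add p
      have h3 : HasFDerivAt φ.symm (fderiv ℝ φ.symm (φ y)) (p + t • (q - p)) := by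
        rw [← hφy]
        exact ((contDiffAt_chart_symm hφ' hyS).differentiableAt (by simp)).hasFDerivAt
      have h4 := ((hF m y hyS).differentiableAt (by simp)).hasFDerivAt.comp_hasDerivAt t
        (h3.comp_hasDerivAt t h2)
      refine (h4.congr_deriv ?_).hasDerivWithinAt
      refine hchart.fderiv_contactForm_drift hComp h1 hm hyS fun l hl => ?_
      rw [fderiv_coordinate hφ hz hyS (by omega), fderiv_chart_apply_symm hφ hφ' hyS,
        Pi.sub_apply, hpq ⟨l, by omega⟩ hl, sub_self]
    have := (convex_Icc (0 : ℝ) 1).norm_image_sub_le_of_norm_hasDerivWithin_le (C := 0) hline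
      (by simp) (left_mem_Icc.2 zero_le_one) (right_mem_Icc.2 zero_le_one)
    rw [zero_mul, norm_le_zero_iff, sub_eq_zero] at this
    simpa using this.symm
  -- Truncation of the coordinates after `z_{m+1}`: the remaining ones are those of the centre.
  let ext : (m : ℕ) → (Fin (m + 2) → ℝ) → (Fin (k + 1) → ℝ) := fun m c i =>
    if hi : (i : ℕ) < m + 2 then c ⟨i, hi⟩ else p₀ i
  have hext : ∀ m, ContDiff ℝ ∞ (ext m) := by
    intro m
    refine contDiff_pi.2 fun i => ?_
    by_cases hi : (i : ℕ) < m + 2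
    · simp only [ext, hi, dif_pos]
      fun_prop
    · simp only [ext, hi, dif_neg, not_false_iff]
      fun_prop
  have hextball : ∀ m (hm : m < k) (q : Fin (k + 1) → ℝ), q ∈ φ.target →
      ext m (fun l => q (Fin.castLE (by omega) l)) ∈ φ.target := by
    intro m hm q hq
    rw [hφt, Metric.mem_ball] at hq ⊢
    have hr : 0 < r := dist_nonneg.trans_lt hq
    rw [dist_pi_lt_iff hr] at hq ⊢
    intro i
    by_cases hi : (i : ℕ) < m + 2
    · simp only [ext, hi, dif_pos]
      exact hq i
    · simp only [ext, hi, dif_neg, not_false_iff, dist_self]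
      exact hr
  let T : ControlAffineSystem (k + 1) :=
    { X := φ.target
      isOpen_X := φ.open_target
      f := fun q i => if (i : ℕ) = 0 ∨ (i : ℕ) = k then 0 else F i (φ.symm q)
      g := fun j q i => if j = 0 then
          (if (i : ℕ) = 0 then 1 else if hi : (i : ℕ) < k then q ⟨i + 1, by omega⟩ else 0)
        else (if (i : ℕ) = k then 1 else 0)
      smooth_f := by
        intro q hq
        refine (contDiffAt_pi.2 fun i => ?_).contDiffWithinAt
        by_cases hi : (i : ℕ) = 0 ∨ (i : ℕ) = k
        · simp only [hi, if_true]
          exact contDiffAt_const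
        · simp only [hi, if_false]
          exact hFφ i q hq
      smooth_g := by
        intro j
        refine (contDiff_pi.2 fun i => ?_).contDiffOn
        by_cases hj : j = 0
        · simp only [hj, if_true]
          split_ifs <;> fun_prop
        · simp only [hj, if_false]
          exact contDiff_const }
  refine ⟨T, p₀, ⟨fun m c => F m (φ.symm (ext m c)), fun m h1 hm => ?_, fun q hq => ⟨?_, ?_, ?_⟩⟩,
    φ, fun x => -fun i => ∑ j, controlMatrix S z x i j *
      fderiv ℝ (z (if j = 0 then 0 else k)) x (S.f x),
    controlMatrix S z, hx₀, rfl, (hφN.trans h.subset_U).trans h.subset_X, subset_rfl, hφ, hφ',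
    fun x hx => ?_, fun x hx => (h.contDiffAt_controlMatrix (hφN hx) (hD x hx)).contDiffWithinAt,
    fun x hx => ⟨isUnit_det_controlMatrix (hD x hx), ?_, fun j => ?_⟩⟩
  · rintro _ ⟨q, hq, rfl⟩
    exact ((hFφ m _ (hextball m hm q hq)).comp _ (hext m).contDiffAt).contDiffWithinAt
  · simp [T, show (0 : ℕ) ≠ k by omega]
  · intro m h1 hm
    refine ⟨?_, ?_, ?_⟩
    · have h2 : ¬(m = 0 ∨ m = k) := by omega
      simp only [T, h2, if_false]
      refine hconst m h1 hm q hq _ (hextball m hm q hq) fun l hl => ?_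
      simp only [ext, Nat.lt_succ_of_le hl, dif_pos]
      rfl
    · simp [T, hm, show m ≠ 0 by omega]
    · simp [T, hm.ne]
  · simp [T, show k ≠ 0 by omega]
  · have hβ := h.contDiffAt_controlMatrix (hφN hx) (hD x hx)
    refine (contDiffAt_pi.2 fun i => ContDiffAt.sum fun j _ => ?_).neg.contDiffWithinAt
    exact (contDiffAt_pi.1 (contDiffAt_pi.1 hβ i) j).mul
      ((h.smooth_z _ x (hφN hx)).fderiv_apply_smooth (hSf x hx))
  · -- the transformed drift
    set γ : Fin 2 → (Fin (k + 1) → ℝ) := fun j => ∑ i, controlMatrix S z x i j • S.g i x with hγ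
    have hγ0 : ∀ j, fderiv ℝ (z 0) x (γ j) = if j = 0 then 1 else 0 :=
      fderiv_zero_controlMatrix (hD x hx)
    have hγk : ∀ j, fderiv ℝ (z k) x (γ j) = if j = 0 then 0 else 1 :=
      fderiv_last_controlMatrix (hD x hx)
    have hsum : S.f x + ∑ i, (-fun i => ∑ j, controlMatrix S z x i j *
        fderiv ℝ (z (if j = 0 then 0 else k)) x (S.f x)) i • S.g i x =
        S.f x - (fderiv ℝ (z 0) x (S.f x) • γ 0 + fderiv ℝ (z k) x (S.f x) • γ 1) := by
      simp only [hγ, Pi.neg_apply, Fin.sum_univ_two, Fin.isValue, if_true, one_ne_zero, if_false]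
      module
    rw [hsum]
    have hγmem : ∀ j, γ j ∈ contactDistribution z (k - 1) x := fun j => by
      rw [← hchart.control_eq x hx]
      exact Submodule.sum_mem _ fun i _ => Submodule.smul_mem _ _ (Submodule.subset_span ⟨i, rfl⟩)
    ext i
    rw [← fderiv_coordinate hφ hz hx i.2]
    simp only [T]
    rw [φ.left_inv hx]
    split_ifs with hi
    · rcases hi with hi | hi
      · rw [hi, map_sub, map_add, map_smul, map_smul, hγ0, hγ0]
        simp
      · rw [hi, map_sub, map_add, map_smul, map_smul, hγk, hγk]
        simp
    · have hi1 : 1 ≤ (i : ℕ) := by omega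
      have hik : (i : ℕ) ≤ k - 1 := by omega
      rw [map_sub, map_add, map_smul, map_smul,
        fderiv_eq_mul_of_mem_contactDistribution (hγmem 0) hi1 hik,
        fderiv_eq_mul_of_mem_contactDistribution (hγmem 1) hi1 hik, hγ0, hγ0]
      simp only [F, contactForm_apply, smul_eq_mul, Fin.isValue, if_true, one_ne_zero, if_false]
      ring
  · -- the transformed control fields
    have hmem : ∑ i, controlMatrix S z x i j • S.g i x ∈ contactDistribution z (k - 1) x := by
      rw [← hchart.control_eq x hx]
      exact Submodule.sum_mem _ fun i _ => Submodule.smul_mem _ _ (Submodule.subset_span ⟨i, rfl⟩)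
    have h0 := fderiv_zero_controlMatrix (z := z) (hD x hx) j
    have hk' := fderiv_last_controlMatrix (z := z) (hD x hx) j
    ext i
    rw [← fderiv_coordinate hφ hz hx i.2]
    rcases Nat.eq_zero_or_pos (i : ℕ) with hi | hi
    · rw [hi, h0]
      have : (0 : ℕ) ≠ k := by omega
      simp [T, hi, this]
    rcases Nat.lt_or_ge (i : ℕ) k with hik | hik
    · rw [fderiv_eq_mul_of_mem_contactDistribution hmem hi (by omega), h0,
        hz (i + 1) (by omega) x hx]
      by_cases hj : j = 0
      · simp [T, hj, hi.ne', hik]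
      · simp [T, hj, hik.ne]
    · have hik' : (i : ℕ) = k := by omega
      rw [hik', hk']
      by_cases hj : j = 0
      · simp [T, hj, hik', show k ≠ 0 by omega]
      · simp [T, hj, hik']

end IsContactSequence

end Sequence

/-! ### The first two coordinates -/

section FirstCoordinates

open TangentDistribution

variable {k : ℕ}

/-- The sequence `z_0, z_1, g(z_1) / g(z_0), …` generated by two functions and a vector field. -/
noncomputable def contactSequence {n : ℕ} (z₀ z₁ : (Fin n → ℝ) → ℝ)
    (g : (Fin n → ℝ) → (Fin n → ℝ)) : ℕ → (Fin n → ℝ) → ℝ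
  | 0 => z₀
  | 1 => z₁
  | m + 2 => fun x => fderiv ℝ (contactSequence z₀ z₁ g (m + 1)) x (g x) / fderiv ℝ z₀ x (g x)

theorem contDiffAt_contactSequence {n : ℕ} {z₀ z₁ : (Fin n → ℝ) → ℝ}
    {g : (Fin n → ℝ) → (Fin n → ℝ)} {x : Fin n → ℝ} (h₀ : ContDiffAt ℝ ∞ z₀ x)
    (h₁ : ContDiffAt ℝ ∞ z₁ x) (hg : ContDiffAt ℝ ∞ g x) (hne : fderiv ℝ z₀ x (g x) ≠ 0) (m : ℕ) :
    ContDiffAt ℝ ∞ (contactSequence z₀ z₁ g m) x := by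
  induction m using Nat.strong_induction_on with
  | _ m ih =>
    match m with
    | 0 => exact h₀
    | 1 => exact h₁
    | m + 2 =>
      have h2 := (ih (m + 1) (by omega)).fderiv_apply_smooth hg
      exact h2.fun_div (h₀.fderiv_apply_smooth hg) hne

theorem contactForm_contactSequence {n : ℕ} {z₀ z₁ : (Fin n → ℝ) → ℝ}
    {g : (Fin n → ℝ) → (Fin n → ℝ)} {x : Fin n → ℝ} (hne : fderiv ℝ z₀ x (g x) ≠ 0) {m : ℕ}
    (hm : 1 ≤ m) : contactForm (contactSequence z₀ z₁ g) m x (g x) = 0 := by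
  obtain ⟨m, rfl⟩ : ∃ l, m = l + 1 := ⟨m - 1, by omega⟩
  rw [contactForm_apply, contactSequence, contactSequence, div_mul_cancel₀ _ hne, sub_self]

/-- Characteristic fields are closed under the Lie bracket, by the Jacobi identity. -/
theorem lieBracket_mem_characteristicFields {n : ℕ} {D : TangentDistribution n}
    {U : Set (Fin n → ℝ)} (hU : IsOpen U) {c c' : (Fin n → ℝ) → (Fin n → ℝ)}
    (hc : c ∈ D.characteristicFields U) (hc' : c' ∈ D.characteristicFields U) :
    VectorField.lieBracket ℝ c c' ∈ D.characteristicFields U := by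
  have hbr : ∀ {d V : (Fin n → ℝ) → (Fin n → ℝ)}, d ∈ D.characteristicFields U →
      V ∈ D.sections U → VectorField.lieBracket ℝ d V ∈ D.sections U := fun hd hV =>
    ⟨fun x hx => ((contDiffAt_of_mem_sections hU hd.1 hx).lieBracket_vectorField
      (contDiffAt_of_mem_sections hU hV hx) (by simp)).contDiffWithinAt, hd.2 _ hV⟩
  refine ⟨hbr hc hc'.1, fun V hV x hx => ?_⟩
  have h1 := VectorField.leibniz_identity_lieBracket (n := ∞)
    (by rw [minSmoothness_of_isRCLikeNormedField]; exact WithTop.coe_le_coe.2 le_top)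
    (contDiffAt_of_mem_sections hU hc.1 hx) (contDiffAt_of_mem_sections hU hc'.1 hx)
    (contDiffAt_of_mem_sections hU hV hx)
  rw [← sub_eq_iff_eq_add] at h1
  rw [← h1]
  exact Submodule.sub_mem _ (hc.2 _ (hbr hc' hV) x hx) (hc'.2 _ (hbr hc hV) x hx)

/-- If a distribution spanned by its sections is the whole tangent space at a point, then it is so
nearby, and so is its characteristic distribution. -/
theorem characteristic_eq_top {n : ℕ} {D : TangentDistribution n} {U : Set (Fin n → ℝ)}
    (hU : IsOpen U) {x : Fin n → ℝ} (hx : x ∈ U)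
    (hD : ∀ v ∈ D x, ∃ V ∈ D.sections U, V x = v) (htop : D x = ⊤) :
    D.characteristic U x = ⊤ := by
  have hV : ∀ j : Fin n, ∃ V ∈ D.sections U, V x = Pi.single j 1 := fun j =>
    hD _ (htop ▸ Submodule.mem_top)
  choose V hVs hVx using hV
  have hnear : ∀ᶠ y in 𝓝 x, y ∈ U ∧ D y = ⊤ := by
    have h1 : LinearIndependent ℝ fun j => V j x := by
      have h2 : (fun j => V j x) = Pi.basisFun ℝ (Fin n) := funext fun j => by
        rw [hVx, Pi.basisFun_apply]
      rw [h2]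
      exact (Pi.basisFun ℝ (Fin n)).linearIndependent
    have h3 : ContinuousAt (fun y j => V j y) x := continuousAt_pi.2 fun j =>
      (contDiffAt_of_mem_sections hU (hVs j) hx).continuousAt
    filter_upwards [h3.eventually h1.eventually, hU.eventually_mem hx] with y hy hyU
    refine ⟨hyU, eq_top_iff.2 ?_⟩
    rw [← hy.span_eq_top_of_card_eq_finrank' (by simp)]
    refine Submodule.span_le.2 ?_
    rintro _ ⟨j, rfl⟩
    exact (hVs j).2 y hyU
  obtain ⟨b, hb, hb1, hb0⟩ := exists_smooth_cutoff hnear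
  refine eq_top_iff.2 fun v _ => Submodule.subset_span ⟨fun y => b y • v,
    ⟨⟨(hb.smul contDiff_const).contDiffOn, fun y hy => ?_⟩, fun W hW y hy => ?_⟩, ?_⟩
  · by_cases hyN : y ∈ {y | y ∈ U ∧ D y = ⊤}
    · rw [hyN.2]; exact Submodule.mem_top
    · simp only [(hb0 y hyN).self_of_nhds, zero_smul]
      exact Submodule.zero_mem _
  · by_cases hyN : y ∈ {y | y ∈ U ∧ D y = ⊤}
    · rw [hyN.2]; exact Submodule.mem_top
    · have h1 : (fun y => b y • v) =ᶠ[𝓝 y] 0 := by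
        filter_upwards [hb0 y hyN] with w hw
        simp only [hw, zero_smul, Pi.zero_apply]
      rw [h1.lieBracket_vectorField_eq (EventuallyEq.refl _ W), VectorField.lieBracket_zero_left]
      exact Submodule.zero_mem _
  · simp only [hb1.self_of_nhds, one_smul]

/-- A frame `c_1, …, c_r` of the characteristic distribution `𝒞^{k-2}` near `x₀`, together with a
control field `g_a` transverse to it. -/
structure IsCharacteristicFrame (S : ControlAffineSystem (k + 1)) (U : Set (Fin (k + 1) → ℝ))
    (x₀ : Fin (k + 1) → ℝ) (a : Fin 2) {r : ℕ}
    (c : Fin r → (Fin (k + 1) → ℝ) → (Fin (k + 1) → ℝ)) : Prop where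
  isOpen_U : IsOpen U
  subset_X : U ⊆ S.X
  mem_U : x₀ ∈ U
  card : r + 2 = k
  mem_characteristic : ∀ i, c i ∈ (S.G U (k - 2)).characteristicFields U
  linearIndependent : LinearIndependent ℝ fun i => c i x₀
  span_eq : ∀ᶠ x in 𝓝 x₀, S.C U (k - 2) x = Submodule.span ℝ (range fun i => c i x)
  notMem : S.g a x₀ ∉ Submodule.span ℝ (range fun i => c i x₀)
  ne_top : ∀ x ∈ U, S.G U (k - 2) x ≠ ⊤

/-- The rank conditions give the frame. If `𝒢^{k-2}` were the whole tangent space at a point, so would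
be `𝒞^{k-2}`, whose rank is `k - 2`. -/
theorem exists_isCharacteristicFrame (hk : 3 ≤ k) {S : ControlAffineSystem (k + 1)}
    {U : Set (Fin (k + 1) → ℝ)} {x₀ : Fin (k + 1) → ℝ} (hU : IsOpen U) (hUX : U ⊆ S.X)
    (hx₀ : x₀ ∈ U) (hCh2 : S.Ch2 U) (hCh3 : S.Ch3 U x₀) :
    ∃ (a : Fin 2) (r : ℕ) (c : Fin r → (Fin (k + 1) → ℝ) → (Fin (k + 1) → ℝ)),
      IsCharacteristicFrame S U x₀ a c := by
  have hrank : ∀ x ∈ U, Module.finrank ℝ (S.C U (k - 2) x) + 2 = k := by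
    intro x hx
    obtain ⟨h1, -, h3⟩ := hCh2 x hx
    omega
  obtain ⟨a, ha⟩ : ∃ a, S.g a x₀ ∉ S.C U (k - 2) x₀ := by
    by_contra! hcon
    refine hCh3 (Submodule.span_le.2 ?_)
    rintro _ ⟨a, rfl⟩
    exact hcon a
  obtain ⟨f, hf, hfspan, hfind⟩ := Submodule.exists_fun_fin_finrank_span_eq ℝ
    {w | ∃ c ∈ (S.G U (k - 2)).characteristicFields U, w = c x₀}
  choose c hc hcf using hf
  have hfc : f = fun i => c i x₀ := funext hcf
  rw [hfc] at hfspan hfind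
  have hcard : Module.finrank ℝ (Submodule.span ℝ
      {w | ∃ c ∈ (S.G U (k - 2)).characteristicFields U, w = c x₀}) + 2 = k := hrank x₀ hx₀
  refine ⟨a, _, c, hU, hUX, hx₀, hcard, hc, hfind, ?_, ?_,
    fun x hx htop => ?_⟩
  · have h1 : ContinuousAt (fun y i => c i y) x₀ := continuousAt_pi.2 fun i =>
      (contDiffAt_of_mem_sections hU (hc i).1 hx₀).continuousAt
    filter_upwards [h1.eventually hfind.eventually, hU.eventually_mem hx₀] with x h2 hx
    refine (Submodule.eq_of_le_of_finrank_eq (Submodule.span_le.2 ?_) ?_).symm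
    · rintro _ ⟨i, rfl⟩
      exact Submodule.subset_span ⟨c i, hc i, rfl⟩
    · have h3 := finrank_span_eq_card h2
      rw [Fintype.card_fin] at h3
      have h4 := hrank x hx
      omega
  · rw [hfspan]
    exact ha
  · have h1 : S.C U (k - 2) x = ⊤ := characteristic_eq_top hU hx
      (fun v hv => exists_section_through S hU hUX (k - 2) hv) htop
    have h2 := hrank x hx
    rw [h1, finrank_top, Module.finrank_fin_fun] at h2
    omega

/-- If `A B = C D` near a common zero of the four functions, the same relation holds between their
derivatives in any direction. -/
theorem fderiv_mul_fderiv_eq {E : Type*} [NormedAddCommGroup E] [NormedSpace ℝ E]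
    {A B C D : E → ℝ} {x : E} (hA : DifferentiableAt ℝ A x) (hB : DifferentiableAt ℝ B x)
    (hC : DifferentiableAt ℝ C x) (hD : DifferentiableAt ℝ D x) (hA0 : A x = 0) (hB0 : B x = 0)
    (hC0 : C x = 0) (hD0 : D x = 0) (h : ∀ᶠ y in 𝓝 x, A y * B y = C y * D y) (v : E) :
    fderiv ℝ A x v * fderiv ℝ B x v = fderiv ℝ C x v * fderiv ℝ D x v := by
  have hline : ∀ {F : E → ℝ}, DifferentiableAt ℝ F x → F x = 0 →
      Tendsto (fun t : ℝ => t⁻¹ * F (x + t • v)) (𝓝[≠] 0) (𝓝 (fderiv ℝ F x v)) := by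
    intro F hF hF0
    have h1 := (hF.hasFDerivAt.hasLineDerivAt v).tendsto_slope_zero
    simpa [hF0] using h1
  have h1 := (hline hA hA0).mul (hline hB hB0)
  have h2 := (hline hC hC0).mul (hline hD hD0)
  refine tendsto_nhds_unique (h1.congr' ?_) h2
  have h3 : Tendsto (fun t : ℝ => x + t • v) (𝓝[≠] 0) (𝓝 x) := by
    have : Continuous (fun t : ℝ => x + t • v) := by fun_prop
    simpa using (this.tendsto 0).mono_left nhdsWithin_le_nhds
  filter_upwards [h3.eventually h] with t ht
  linear_combination t⁻¹ * t⁻¹ * ht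

theorem finrank_add_le_of_surjective {n r : ℕ} (A : (Fin n → ℝ) →ₗ[ℝ] (Fin r → ℝ))
    {D K : Submodule ℝ (Fin n → ℝ)} (hKD : K ≤ D) (hK : ∀ v ∈ K, A v = 0)
    (hs : ∀ y, ∃ v ∈ D, A v = y) : Module.finrank ℝ K + r ≤ Module.finrank ℝ D := by
  have h1 := (A.domRestrict D).finrank_range_add_finrank_ker
  have h2 : LinearMap.range (A.domRestrict D) = ⊤ := LinearMap.range_eq_top.2 fun y => by
    obtain ⟨v, hv, hvy⟩ := hs y
    exact ⟨⟨v, hv⟩, hvy⟩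
  rw [h2, finrank_top, Module.finrank_fin_fun] at h1
  have h3 : Module.finrank ℝ K ≤ Module.finrank ℝ (LinearMap.ker (A.domRestrict D)) := by
    refine LinearMap.finrank_le_finrank_of_injective
      (f := (Submodule.inclusion hKD).codRestrict (LinearMap.ker (A.domRestrict D))
        fun v => hK v v.2) fun v w hvw => ?_
    exact Submodule.inclusion_injective hKD (congrArg Subtype.val hvw)
  omega

theorem finrank_sup_span_singleton_le {E : Type*} [AddCommGroup E] [Module ℝ E]
    [FiniteDimensional ℝ E] (P : Submodule ℝ E) (v : E) :
    Module.finrank ℝ ↥(P ⊔ Submodule.span ℝ {v}) ≤ Module.finrank ℝ P + 1 :=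
  (Submodule.finrank_add_le_finrank_add_finrank _ _).trans
    (Nat.add_le_add_left (by simpa using finrank_span_le_card (R := ℝ) ({v} : Set E)) _)

namespace IsCharacteristicFrame

variable {S : ControlAffineSystem (k + 1)} {U : Set (Fin (k + 1) → ℝ)} {x₀ : Fin (k + 1) → ℝ}
  {a : Fin 2} {r : ℕ} {c : Fin r → (Fin (k + 1) → ℝ) → (Fin (k + 1) → ℝ)}

theorem contDiffAt (h : IsCharacteristicFrame S U x₀ a c) (i : Fin r) :
    ∀ᶠ x in 𝓝 x₀, ContDiffAt ℝ ∞ (c i) x := by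
  filter_upwards [h.isOpen_U.eventually_mem h.mem_U] with x hx
  exact contDiffAt_of_mem_sections h.isOpen_U (h.mem_characteristic i).1 hx

theorem g_mem_sections (h : IsCharacteristicFrame S U x₀ a c) :
    S.g a ∈ (S.G U (k - 2)).sections U :=
  ⟨(S.smooth_g a).mono h.subset_X, fun _ _ =>
    derivedFlag_mono (D := S.controlDistribution) (Nat.zero_le _)
      (Submodule.subset_span ⟨a, rfl⟩)⟩

theorem involutive (h : IsCharacteristicFrame S U x₀ a c) (i j : Fin r) :
    ∀ᶠ x in 𝓝 x₀, VectorField.lieBracket ℝ (c i) (c j) x ∈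
      Submodule.span ℝ (range fun l => c l x) := by
  filter_upwards [h.span_eq] with x hx
  rw [← hx]
  exact Submodule.subset_span ⟨_, lieBracket_mem_characteristicFields h.isOpen_U
    (h.mem_characteristic i) (h.mem_characteristic j), rfl⟩

/-- A first integral of the characteristic distribution with a prescribed differential. -/
theorem exists_firstIntegral (h : IsCharacteristicFrame S U x₀ a c)
    (ξ : (Fin (k + 1) → ℝ) →ₗ[ℝ] ℝ) (hξ : ∀ i, ξ (c i x₀) = 0) :
    ∃ z : (Fin (k + 1) → ℝ) → ℝ, (∀ᶠ x in 𝓝 x₀, ContDiffAt ℝ ∞ z x) ∧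
      (∀ v, fderiv ℝ z x₀ v = ξ v) ∧ ∀ i, ∀ᶠ x in 𝓝 x₀, fderiv ℝ z x (c i x) = 0 := by
  obtain ⟨z, hz, hz', hzc⟩ := exists_firstIntegral_of_involutive c h.contDiffAt h.involutive
    h.linearIndependent (LinearMap.toContinuousLinearMap ξ) hξ
  exact ⟨z, hz, fun v => by rw [hz']; rfl, hzc⟩

theorem linearIndependent_eventually (h : IsCharacteristicFrame S U x₀ a c) :
    ∀ᶠ x in 𝓝 x₀, LinearIndependent ℝ fun i => c i x := by
  have h1 : ContinuousAt (fun y i => c i y) x₀ := continuousAt_pi.2 fun i =>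
    (h.contDiffAt i).self_of_nhds.continuousAt
  exact h1.eventually h.linearIndependent.eventually

theorem finrank_span (h : IsCharacteristicFrame S U x₀ a c) :
    ∀ᶠ x in 𝓝 x₀, Module.finrank ℝ (Submodule.span ℝ (range fun i => c i x)) = r := by
  filter_upwards [h.linearIndependent_eventually] with x hx
  rw [finrank_span_eq_card hx, Fintype.card_fin]

theorem finrank_G_le (h : IsCharacteristicFrame S U x₀ a c) {x : Fin (k + 1) → ℝ} (hx : x ∈ U) :
    Module.finrank ℝ (S.G U (k - 2) x) ≤ k := by
  have := Submodule.finrank_lt (h.ne_top x hx)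
  rw [Module.finrank_fin_fun] at this
  omega

theorem g_transverse (h : IsCharacteristicFrame S U x₀ a c) {z₀ : (Fin (k + 1) → ℝ) → ℝ}
    (hz₀ : ∀ᶠ x in 𝓝 x₀, ContDiffAt ℝ ∞ z₀ x) (hg : fderiv ℝ z₀ x₀ (S.g a x₀) ≠ 0) :
    ∀ᶠ x in 𝓝 x₀, fderiv ℝ z₀ x (S.g a x) ≠ 0 :=
  (hz₀.self_of_nhds.fderiv_apply_smooth (contDiffAt_of_mem_sections h.isOpen_U
    h.g_mem_sections h.mem_U)).continuousAt.eventually_ne hg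

/-- The values of `dw_1 - u_1 dz_0` and `dw_2 - u_2 dz_0` on fields of `𝒢^{k-2}` are proportional,
since this distribution contains `𝒞^{k-2}` and `g` and has rank at most `k`. -/
theorem contactForm_parallel (h : IsCharacteristicFrame S U x₀ a c)
    {z₀ w₁ w₂ : (Fin (k + 1) → ℝ) → ℝ} (hz₀ : ∀ᶠ x in 𝓝 x₀, ContDiffAt ℝ ∞ z₀ x)
    (hg : fderiv ℝ z₀ x₀ (S.g a x₀) ≠ 0)
    (hz₀c : ∀ i, ∀ᶠ x in 𝓝 x₀, fderiv ℝ z₀ x (c i x) = 0)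
    (hw₁c : ∀ i, ∀ᶠ x in 𝓝 x₀, fderiv ℝ w₁ x (c i x) = 0)
    (hw₂c : ∀ i, ∀ᶠ x in 𝓝 x₀, fderiv ℝ w₂ x (c i x) = 0) :
    ∀ᶠ x in 𝓝 x₀, ∀ v ∈ S.G U (k - 2) x, ∀ w ∈ S.G U (k - 2) x,
      contactForm (contactSequence z₀ w₁ (S.g a)) 1 x v *
        contactForm (contactSequence z₀ w₂ (S.g a)) 1 x w =
      contactForm (contactSequence z₀ w₂ (S.g a)) 1 x v *
        contactForm (contactSequence z₀ w₁ (S.g a)) 1 x w := by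
  filter_upwards [h.g_transverse hz₀ hg, eventually_all.2 hz₀c, eventually_all.2 hw₁c,
    eventually_all.2 hw₂c, h.finrank_span, h.isOpen_U.eventually_mem h.mem_U] with
    x hgx h0 h1 h2 hr hx v hv w hw
  set τ₁ := contactForm (contactSequence z₀ w₁ (S.g a)) 1 x with hτ₁
  set τ₂ := contactForm (contactSequence z₀ w₂ (S.g a)) 1 x with hτ₂
  have hg1 : τ₁ (S.g a x) = 0 := contactForm_contactSequence hgx le_rfl
  have hg2 : τ₂ (S.g a x) = 0 := contactForm_contactSequence hgx le_rfl
  have hc1 : ∀ i, τ₁ (c i x) = 0 := fun i => by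
    have h3 : τ₁ (c i x) = fderiv ℝ w₁ x (c i x) - _ * fderiv ℝ z₀ x (c i x) := rfl
    rw [h3, h0, h1, mul_zero, sub_zero]
  have hc2 : ∀ i, τ₂ (c i x) = 0 := fun i => by
    have h3 : τ₂ (c i x) = fderiv ℝ w₂ x (c i x) - _ * fderiv ℝ z₀ x (c i x) := rfl
    rw [h3, h0, h2, mul_zero, sub_zero]
  by_contra hne
  have hdet : τ₁ v * τ₂ w - τ₂ v * τ₁ w ≠ 0 := sub_ne_zero.2 hne
  let A : (Fin (k + 1) → ℝ) →ₗ[ℝ] (Fin 3 → ℝ) := LinearMap.pi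
    ![(τ₁ : (Fin (k + 1) → ℝ) →ₗ[ℝ] ℝ), (τ₂ : (Fin (k + 1) → ℝ) →ₗ[ℝ] ℝ),
      (fderiv ℝ z₀ x : (Fin (k + 1) → ℝ) →ₗ[ℝ] ℝ)]
  have hA : ∀ u, A u = ![τ₁ u, τ₂ u, fderiv ℝ z₀ x u] := fun u => by
    ext i
    fin_cases i <;> rfl
  have hle := finrank_add_le_of_surjective A (D := S.G U (k - 2) x)
    (K := Submodule.span ℝ (range fun i => c i x)) ?_ ?_ ?_
  · have := h.finrank_G_le hx
    have := h.card
    omega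
  · refine Submodule.span_le.2 ?_
    rintro _ ⟨i, rfl⟩
    exact (h.mem_characteristic i).1.2 x hx
  · intro u hu
    refine LinearMap.mem_ker.1 ((Submodule.span_le (p := LinearMap.ker A)).2 ?_ hu)
    rintro _ ⟨i, rfl⟩
    rw [SetLike.mem_coe, LinearMap.mem_ker, hA, hc1, hc2, h0]
    ext i
    fin_cases i <;> rfl
  · intro y
    set d := τ₁ v * τ₂ w - τ₂ v * τ₁ w with hd
    set α := (y 0 * τ₂ w - y 1 * τ₁ w) / d with hα
    set β := (y 1 * τ₁ v - y 0 * τ₂ v) / d with hβ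
    refine ⟨α • v + β • w + ((y 2 - α * fderiv ℝ z₀ x v - β * fderiv ℝ z₀ x w) /
      fderiv ℝ z₀ x (S.g a x)) • S.g a x, ?_, ?_⟩
    · exact Submodule.add_mem _ (Submodule.add_mem _ (Submodule.smul_mem _ _ hv)
        (Submodule.smul_mem _ _ hw)) (Submodule.smul_mem _ _ (h.g_mem_sections.2 x hx))
    · rw [hA]
      simp only [map_add, map_smul, smul_eq_mul, hg1, hg2, mul_zero, add_zero]
      rw [div_mul_cancel₀ _ hgx]
      ext i
      fin_cases i
      · change α * τ₁ v + β * τ₁ w = y 0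
        rw [hα, hβ]
        field_simp
        rw [hd]
        ring
      · change α * τ₂ v + β * τ₂ w = y 1
        rw [hα, hβ]
        field_simp
        rw [hd]
        ring
      · change α * fderiv ℝ z₀ x v + β * fderiv ℝ z₀ x w + _ = y 2
        ring

theorem contactForm_frame (i : Fin r) {z₀ w : (Fin (k + 1) → ℝ) → ℝ} {x : Fin (k + 1) → ℝ}
    (hz₀c : fderiv ℝ z₀ x (c i x) = 0) (hwc : fderiv ℝ w x (c i x) = 0)
    (g : (Fin (k + 1) → ℝ) → (Fin (k + 1) → ℝ)) :
    contactForm (contactSequence z₀ w g) 1 x (c i x) = 0 := by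
  have h3 : contactForm (contactSequence z₀ w g) 1 x (c i x) =
    fderiv ℝ w x (c i x) - _ * fderiv ℝ z₀ x (c i x) := rfl
  rw [h3, hz₀c, hwc, mul_zero, sub_zero]

/-- On the span of the frame and of `g`, a form that annihilates the frame is a multiple of
`dz_0`. -/
theorem apply_mul_eq_of_mem {l₀ l : (Fin (k + 1) → ℝ) →L[ℝ] ℝ}
    (h₀ : ∀ i, l₀ (c i x₀) = 0) (hl : ∀ i, l (c i x₀) = 0) {v : Fin (k + 1) → ℝ}
    (hv : v ∈ Submodule.span ℝ (range fun i => c i x₀) ⊔ Submodule.span ℝ {S.g a x₀}) :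
    l v * l₀ (S.g a x₀) = l₀ v * l (S.g a x₀) := by
  have hle : Submodule.span ℝ (range fun i => c i x₀) ⊔ Submodule.span ℝ {S.g a x₀} ≤
      LinearMap.ker ((l₀ (S.g a x₀) • l - l (S.g a x₀) • l₀ :
        (Fin (k + 1) → ℝ) →L[ℝ] ℝ) : (Fin (k + 1) → ℝ) →ₗ[ℝ] ℝ) := by
    refine sup_le (Submodule.span_le.2 ?_) (Submodule.span_le.2 ?_)
    · rintro _ ⟨i, rfl⟩
      simp [h₀, hl]
    · rintro _ rfl
      simp [mul_comm]
  have h1 := hle hv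
  simp only [LinearMap.mem_ker, ContinuousLinearMap.coe_coe, sub_apply, smul_apply, smul_eq_mul] at h1
  linarith

/-- If `𝒢^{k-2}` reduces at `x₀` to the span of `𝒞^{k-2}` and `g`, the form
`dw - (g(w) / g(z_0)) dz_0` takes on brackets of its sections values determined by the derivatives
in the direction `g` of its values on sections. -/
theorem contactForm_lieBracket_mul (h : IsCharacteristicFrame S U x₀ a c)
    (hD : S.G U (k - 2) x₀ ≤
      Submodule.span ℝ (range fun i => c i x₀) ⊔ Submodule.span ℝ {S.g a x₀})
    {z₀ w : (Fin (k + 1) → ℝ) → ℝ} (hz₀ : ∀ᶠ x in 𝓝 x₀, ContDiffAt ℝ ∞ z₀ x)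
    (hw : ∀ᶠ x in 𝓝 x₀, ContDiffAt ℝ ∞ w x) (hg : fderiv ℝ z₀ x₀ (S.g a x₀) ≠ 0)
    (hz₀c : ∀ i, ∀ᶠ x in 𝓝 x₀, fderiv ℝ z₀ x (c i x) = 0)
    (hwc : ∀ i, ∀ᶠ x in 𝓝 x₀, fderiv ℝ w x (c i x) = 0)
    {V W : (Fin (k + 1) → ℝ) → (Fin (k + 1) → ℝ)} (hV : V ∈ (S.G U (k - 2)).sections U)
    (hW : W ∈ (S.G U (k - 2)).sections U) :
    contactForm (contactSequence z₀ w (S.g a)) 1 x₀ (VectorField.lieBracket ℝ V W x₀) *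
        fderiv ℝ z₀ x₀ (S.g a x₀) =
      fderiv ℝ z₀ x₀ (V x₀) * fderiv ℝ
          (fun y => contactForm (contactSequence z₀ w (S.g a)) 1 y (W y)) x₀ (S.g a x₀) -
        fderiv ℝ z₀ x₀ (W x₀) * fderiv ℝ
          (fun y => contactForm (contactSequence z₀ w (S.g a)) 1 y (V y)) x₀ (S.g a x₀) := by
  set z := contactSequence z₀ w (S.g a) with hzdef
  have hsm : ∀ {Y}, Y ∈ (S.G U (k - 2)).sections U → ContDiffAt ℝ ∞ Y x₀ := fun hY =>
    contDiffAt_of_mem_sections h.isOpen_U hY h.mem_U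
  have hz : ∀ m, ContDiffAt ℝ ∞ (z m) x₀ := fun m =>
    contDiffAt_contactSequence hz₀.self_of_nhds hw.self_of_nhds (hsm h.g_mem_sections) hg m
  have hτc : ∀ i, ∀ᶠ y in 𝓝 x₀, contactForm z 1 y (c i y) = 0 := fun i => by
    filter_upwards [hz₀c i, hwc i] with y h1 h2
    exact contactForm_frame i h1 h2 _
  have hτg : ∀ᶠ y in 𝓝 x₀, contactForm z 1 y (S.g a y) = 0 := by
    filter_upwards [h.g_transverse hz₀ hg] with y hy
    exact contactForm_contactSequence hy le_rfl
  have hc0 : ∀ i, fderiv ℝ (z 0) x₀ (c i x₀) = 0 := fun i => (hz₀c i).self_of_nhds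
  have hτD : ∀ v ∈ S.G U (k - 2) x₀, contactForm z 1 x₀ v = 0 := by
    intro v hv
    have h1 := apply_mul_eq_of_mem (l₀ := fderiv ℝ z₀ x₀) (l := contactForm z 1 x₀) hc0
      (fun i => (hτc i).self_of_nhds) (hD hv)
    rw [hτg.self_of_nhds, mul_zero] at h1
    exact (mul_eq_zero.1 h1).resolve_right hg
  -- brackets with characteristic fields stay in the distribution, hence in the kernel of the form
  have hu : ∀ i, fderiv ℝ (z 2) x₀ (c i x₀) = 0 := by
    intro i
    have h1 := hτD _ ((h.mem_characteristic i).2 _ h.g_mem_sections x₀ h.mem_U)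
    rw [contactForm_lieBracket_of_eventually_eq_zero 1 hz (hsm (h.mem_characteristic i).1)
      (hsm h.g_mem_sections) (hτc i) hτg, hc0, mul_zero, sub_zero] at h1
    exact (mul_eq_zero.1 h1).resolve_right hg
  have hp : ∀ {Y}, Y ∈ (S.G U (k - 2)).sections U → ∀ i,
      fderiv ℝ (fun y => contactForm z 1 y (Y y)) x₀ (c i x₀) = 0 := by
    intro Y hY i
    have h1 := hτD _ ((h.mem_characteristic i).2 _ hY x₀ h.mem_U)
    have h2 : (fun y => contactForm z 1 y (c i y)) =ᶠ[𝓝 x₀] fun _ => 0 := hτc i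
    rw [contactForm_lieBracket 1 hz (hsm (h.mem_characteristic i).1) (hsm hY), h2.fderiv_eq,
      hc0, hu] at h1
    simpa using h1
  have hVD := hD (hV.2 x₀ h.mem_U)
  have hWD := hD (hW.2 x₀ h.mem_U)
  have e1 := apply_mul_eq_of_mem (l₀ := fderiv ℝ (z 0) x₀) hc0 (hp hW) hVD
  have e2 := apply_mul_eq_of_mem (l₀ := fderiv ℝ (z 0) x₀) hc0 (hp hV) hWD
  have e3 := apply_mul_eq_of_mem (l₀ := fderiv ℝ (z 0) x₀) hc0 hu hVD
  have e4 := apply_mul_eq_of_mem (l₀ := fderiv ℝ (z 0) x₀) hc0 hu hWD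
  rw [contactForm_lieBracket 1 hz (hsm hV) (hsm hW)]
  change _ * fderiv ℝ (z 0) x₀ (S.g a x₀) = fderiv ℝ (z 0) x₀ (V x₀) * _ -
    fderiv ℝ (z 0) x₀ (W x₀) * _
  linear_combination e1 - e2 + fderiv ℝ (z 0) x₀ (W x₀) * e3 - fderiv ℝ (z 0) x₀ (V x₀) * e4

theorem exists_lieBracket_notMem (h : IsCharacteristicFrame S U x₀ a c)
    (hCh1 : S.G U (k - 1) x₀ = ⊤) {P : Submodule ℝ (Fin (k + 1) → ℝ)}
    (hP : S.G U (k - 2) x₀ ≤ P) (hr : Module.finrank ℝ P ≤ k) :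
    ∃ V ∈ (S.G U (k - 2)).sections U, ∃ W ∈ (S.G U (k - 2)).sections U,
      VectorField.lieBracket ℝ V W x₀ ∉ P := by
  by_contra! hcon
  have h1 : (S.G U (k - 2)).derived U x₀ ≤ P := derived_le hP hcon
  have h2 : S.G U (k - 1) = (S.G U (k - 2)).derived U := by
    have := h.card
    rw [show k - 1 = k - 2 + 1 by omega]
    rfl
  rw [← h2, hCh1, top_le_iff] at h1
  rw [h1, finrank_top, Module.finrank_fin_fun] at hr
  omega

/-- A first integral of the characteristic distribution whose differential does not vanish on the
control field. -/
theorem exists_transverse_firstIntegral (h : IsCharacteristicFrame S U x₀ a c) :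
    ∃ z₀ : (Fin (k + 1) → ℝ) → ℝ, (∀ᶠ x in 𝓝 x₀, ContDiffAt ℝ ∞ z₀ x) ∧
      fderiv ℝ z₀ x₀ (S.g a x₀) ≠ 0 ∧ ∀ i, ∀ᶠ x in 𝓝 x₀, fderiv ℝ z₀ x (c i x) = 0 := by
  obtain ⟨ξ, hξg, hξ⟩ := Submodule.exists_le_ker_of_notMem h.notMem
  obtain ⟨z₀, hz₀, hd, hz₀c⟩ := h.exists_firstIntegral ξ fun i =>
    hξ (Submodule.subset_span ⟨i, rfl⟩)
  exact ⟨z₀, hz₀, by rwa [hd], hz₀c⟩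

/-- The distribution `𝒢^{k-2}` is at `x₀` strictly larger than the span of `𝒞^{k-2}` and `g`.
Otherwise two independent forms `dw_i - u_i dz_0` would annihilate it at `x₀`; since their values on
sections are proportional near `x₀`, so are their values on brackets of sections at `x₀`, and these
brackets could not fill up the tangent space. -/
theorem exists_section_notMem (h : IsCharacteristicFrame S U x₀ a c)
    (hCh1 : S.G U (k - 1) x₀ = ⊤) :
    ∃ V ∈ (S.G U (k - 2)).sections U,
      V x₀ ∉ Submodule.span ℝ (range fun i => c i x₀) ⊔ Submodule.span ℝ {S.g a x₀} := by
  by_contra! hcon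
  set Q := Submodule.span ℝ (range fun i => c i x₀) ⊔ Submodule.span ℝ {S.g a x₀} with hQ
  have hD : S.G U (k - 2) x₀ ≤ Q := fun v hv => by
    obtain ⟨V, hV, rfl⟩ := exists_section_through S h.isOpen_U h.subset_X (k - 2) hv
    exact hcon V hV
  have hcQ : ∀ i, c i x₀ ∈ Q := fun i =>
    (le_sup_left : _ ≤ Q) (Submodule.subset_span ⟨i, rfl⟩)
  have hgQ : S.g a x₀ ∈ Q := (le_sup_right : _ ≤ Q) (Submodule.subset_span rfl)
  have hQr : Module.finrank ℝ Q ≤ r + 1 := by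
    have := h.finrank_span.self_of_nhds
    have := finrank_sup_span_singleton_le (Submodule.span ℝ (range fun i => c i x₀)) (S.g a x₀)
    rw [← hQ] at this
    omega
  have hrk := h.card
  obtain ⟨V, hV, W, hW, hb⟩ := h.exists_lieBracket_notMem hCh1 hD (by omega)
  set b := VectorField.lieBracket ℝ V W x₀
  obtain ⟨V', hV', W', hW', hb'⟩ := h.exists_lieBracket_notMem hCh1
    (P := Q ⊔ Submodule.span ℝ {b}) (hD.trans le_sup_left) (by
      have := finrank_sup_span_singleton_le Q b
      omega)
  set b' := VectorField.lieBracket ℝ V' W' x₀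
  obtain ⟨ξ₁, hξ₁, hξ₁Q⟩ := Submodule.exists_le_ker_of_notMem hb'
  obtain ⟨ξ₂, hξ₂, hξ₂Q⟩ := Submodule.exists_le_ker_of_notMem hb
  have hξ₁b : ξ₁ b = 0 := hξ₁Q ((le_sup_right : _ ≤ Q ⊔ _) (Submodule.subset_span rfl))
  replace hξ₁Q : ∀ v ∈ Q, ξ₁ v = 0 := fun v hv => hξ₁Q ((le_sup_left : Q ≤ _) hv)
  replace hξ₂Q : ∀ v ∈ Q, ξ₂ v = 0 := fun v hv => hξ₂Q hv
  obtain ⟨z₀, hz₀, hg, hz₀c⟩ := h.exists_transverse_firstIntegral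
  obtain ⟨w₁, hw₁, hd₁, hw₁c⟩ := h.exists_firstIntegral ξ₁ fun i => hξ₁Q _ (hcQ i)
  obtain ⟨w₂, hw₂, hd₂, hw₂c⟩ := h.exists_firstIntegral ξ₂ fun i => hξ₂Q _ (hcQ i)
  have hτ : ∀ {w : (Fin (k + 1) → ℝ) → ℝ} {ξ : (Fin (k + 1) → ℝ) →ₗ[ℝ] ℝ},
      (∀ v, fderiv ℝ w x₀ v = ξ v) → (∀ v ∈ Q, ξ v = 0) → ∀ v,
      contactForm (contactSequence z₀ w (S.g a)) 1 x₀ v = ξ v := by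
    intro w ξ hw hξ v
    have h1 : contactForm (contactSequence z₀ w (S.g a)) 1 x₀ v = fderiv ℝ w x₀ v -
      fderiv ℝ w x₀ (S.g a x₀) / fderiv ℝ z₀ x₀ (S.g a x₀) * fderiv ℝ z₀ x₀ v := rfl
    rw [h1, hw, hw, hξ _ hgQ, zero_div, zero_mul, sub_zero]
  have hτ₁ := hτ hd₁ hξ₁Q
  have hτ₂ := hτ hd₂ hξ₂Q
  have hsm : ∀ {Y}, Y ∈ (S.G U (k - 2)).sections U → ContDiffAt ℝ ∞ Y x₀ := fun hY =>
    contDiffAt_of_mem_sections h.isOpen_U hY h.mem_U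
  have hdiff : ∀ {w : (Fin (k + 1) → ℝ) → ℝ}, (∀ᶠ x in 𝓝 x₀, ContDiffAt ℝ ∞ w x) →
      ∀ {Y}, Y ∈ (S.G U (k - 2)).sections U → DifferentiableAt ℝ
        (fun y => contactForm (contactSequence z₀ w (S.g a)) 1 y (Y y)) x₀ := fun hw _ hY =>
    (contDiffAt_contactForm_apply (fun m => contDiffAt_contactSequence hz₀.self_of_nhds
      hw.self_of_nhds (hsm h.g_mem_sections) hg m) (hsm hY)).differentiableAt (by simp)
  have hpar : ∀ {Y Z}, Y ∈ (S.G U (k - 2)).sections U → Z ∈ (S.G U (k - 2)).sections U →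
      fderiv ℝ (fun y => contactForm (contactSequence z₀ w₁ (S.g a)) 1 y (Y y)) x₀ (S.g a x₀) *
        fderiv ℝ (fun y => contactForm (contactSequence z₀ w₂ (S.g a)) 1 y (Z y)) x₀
          (S.g a x₀) =
      fderiv ℝ (fun y => contactForm (contactSequence z₀ w₂ (S.g a)) 1 y (Y y)) x₀ (S.g a x₀) *
        fderiv ℝ (fun y => contactForm (contactSequence z₀ w₁ (S.g a)) 1 y (Z y)) x₀
          (S.g a x₀) := by
    intro Y Z hY hZ
    refine fderiv_mul_fderiv_eq (hdiff hw₁ hY) (hdiff hw₂ hZ) (hdiff hw₂ hY) (hdiff hw₁ hZ)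
      ?_ ?_ ?_ ?_ ?_ _
    · rw [hτ₁, hξ₁Q _ (hD (hY.2 x₀ h.mem_U))]
    · rw [hτ₂, hξ₂Q _ (hD (hZ.2 x₀ h.mem_U))]
    · rw [hτ₂, hξ₂Q _ (hD (hY.2 x₀ h.mem_U))]
    · rw [hτ₁, hξ₁Q _ (hD (hZ.2 x₀ h.mem_U))]
    · filter_upwards [h.contactForm_parallel hz₀ hg hz₀c hw₁c hw₂c,
        h.isOpen_U.eventually_mem h.mem_U] with y hy hyU
      exact hy _ (hY.2 y hyU) _ (hZ.2 y hyU)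
  have e₁ := h.contactForm_lieBracket_mul hD hz₀ hw₁ hg hz₀c hw₁c hV hW
  have e₂ := h.contactForm_lieBracket_mul hD hz₀ hw₂ hg hz₀c hw₂c hV hW
  have e₁' := h.contactForm_lieBracket_mul hD hz₀ hw₁ hg hz₀c hw₁c hV' hW'
  have e₂' := h.contactForm_lieBracket_mul hD hz₀ hw₂ hg hz₀c hw₂c hV' hW'
  rw [hτ₁] at e₁ e₁'
  rw [hτ₂] at e₂ e₂'
  have p1 := hpar hV hV'
  have p2 := hpar hV hW'
  have p3 := hpar hW hV'
  have p4 := hpar hW hW'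
  have hfin : (ξ₁ b * fderiv ℝ z₀ x₀ (S.g a x₀)) * (ξ₂ b' * fderiv ℝ z₀ x₀ (S.g a x₀)) =
      (ξ₂ b * fderiv ℝ z₀ x₀ (S.g a x₀)) * (ξ₁ b' * fderiv ℝ z₀ x₀ (S.g a x₀)) := by
    rw [e₁, e₂, e₁', e₂']
    linear_combination fderiv ℝ z₀ x₀ (V x₀) * fderiv ℝ z₀ x₀ (V' x₀) * p4 -
      fderiv ℝ z₀ x₀ (V x₀) * fderiv ℝ z₀ x₀ (W' x₀) * p3 -
      fderiv ℝ z₀ x₀ (W x₀) * fderiv ℝ z₀ x₀ (V' x₀) * p2 +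
      fderiv ℝ z₀ x₀ (W x₀) * fderiv ℝ z₀ x₀ (W' x₀) * p1
  rw [hξ₁b, zero_mul, zero_mul] at hfin
  exact mul_ne_zero (mul_ne_zero hξ₂ hg) (mul_ne_zero hξ₁ hg) hfin.symm

/-- The kernel of `dz_0` in `𝒢^{k-2}` has rank at most `k - 1`, so it is spanned by any `r + 1`
independent vectors it contains. -/
theorem mem_span_of_apply_eq_zero (h : IsCharacteristicFrame S U x₀ a c)
    {x : Fin (k + 1) → ℝ} (hx : x ∈ U) {l : (Fin (k + 1) → ℝ) →L[ℝ] ℝ} (hg : l (S.g a x) ≠ 0)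
    {Y : Fin (r + 1) → (Fin (k + 1) → ℝ)} (hY : LinearIndependent ℝ Y)
    (hYD : ∀ i, Y i ∈ S.G U (k - 2) x) (hYl : ∀ i, l (Y i) = 0) {v : Fin (k + 1) → ℝ}
    (hv : v ∈ S.G U (k - 2) x) (hvl : l v = 0) : v ∈ Submodule.span ℝ (range Y) := by
  by_contra hcon
  have h1 : LinearIndependent ℝ (Fin.cons v Y : Fin (r + 2) → (Fin (k + 1) → ℝ)) :=
    linearIndependent_finCons.2 ⟨hY, hcon⟩
  have h2 : LinearIndependent ℝ
      (Fin.cons (S.g a x) (Fin.cons v Y) : Fin (r + 3) → (Fin (k + 1) → ℝ)) := by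
    refine linearIndependent_finCons.2 ⟨h1, fun hmem => hg ?_⟩
    refine LinearMap.mem_ker.1
      ((Submodule.span_le (p := LinearMap.ker (l : (Fin (k + 1) → ℝ) →ₗ[ℝ] ℝ))).2 ?_ hmem)
    rintro _ ⟨i, rfl⟩
    refine Fin.cases ?_ (fun i => ?_) i
    · exact hvl
    · exact hYl i
  have h3 := finrank_span_eq_card h2
  have h4 : Submodule.span ℝ (range (Fin.cons (S.g a x) (Fin.cons v Y) :
      Fin (r + 3) → (Fin (k + 1) → ℝ))) ≤ S.G U (k - 2) x := by
    refine Submodule.span_le.2 ?_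
    rintro _ ⟨i, rfl⟩
    refine Fin.cases ?_ (fun i => Fin.cases ?_ (fun i => ?_) i) i
    · exact h.g_mem_sections.2 x hx
    · exact hv
    · exact hYD i
  have h5 := Submodule.finrank_mono h4
  have h6 := h.finrank_G_le hx
  have h7 := h.card
  rw [h3, Fintype.card_fin] at h5
  omega

/-- The functions `z_0` and `z_1`: the first is a first integral of `𝒞^{k-2}` transverse to `g`,
the second a first integral of the rank `k - 1` distribution `𝒢^{k-2} ∩ ker dz_0`. -/
theorem exists_isContactSequence (h : IsCharacteristicFrame S U x₀ a c)
    (hCh1 : S.G U (k - 1) x₀ = ⊤) :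
    ∃ (N : Set (Fin (k + 1) → ℝ)) (z : ℕ → (Fin (k + 1) → ℝ) → ℝ),
      IsContactSequence S U N x₀ a z := by
  obtain ⟨z₀, hz₀, hg, hz₀c⟩ := h.exists_transverse_firstIntegral
  obtain ⟨V, hV, hVQ⟩ := h.exists_section_notMem hCh1
  have hsm : ∀ {Y}, Y ∈ (S.G U (k - 2)).sections U → ∀ x ∈ U, ContDiffAt ℝ ∞ Y x :=
    fun hY x hx => contDiffAt_of_mem_sections h.isOpen_U hY hx
  -- the projection of `V` to `ker dz_0` along `g` completes the characteristic frame
  set X : (Fin (k + 1) → ℝ) → (Fin (k + 1) → ℝ) := fun y =>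
    V y - (fderiv ℝ z₀ y (V y) / fderiv ℝ z₀ y (S.g a y)) • S.g a y with hX
  let Y : Fin (r + 1) → (Fin (k + 1) → ℝ) → (Fin (k + 1) → ℝ) := Fin.cons X c
  have hUe := h.isOpen_U.eventually_mem h.mem_U
  have hY : ∀ᶠ x in 𝓝 x₀, ∀ i, ContDiffAt ℝ ∞ (Y i) x ∧ Y i x ∈ S.G U (k - 2) x ∧
      fderiv ℝ z₀ x (Y i x) = 0 := by
    filter_upwards [hUe, hz₀, h.g_transverse hz₀ hg, eventually_all.2 hz₀c] with x hx hz hgx hc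
    refine Fin.cases ⟨?_, ?_, ?_⟩ fun i => ⟨?_, ?_, ?_⟩
    · have h1 := (hz.fderiv_apply_smooth (hsm hV x hx)).fun_div
        (hz.fderiv_apply_smooth (hsm h.g_mem_sections x hx)) hgx
      exact (hsm hV x hx).sub (h1.smul (hsm h.g_mem_sections x hx))
    · exact Submodule.sub_mem _ (hV.2 x hx)
        (Submodule.smul_mem _ _ (h.g_mem_sections.2 x hx))
    · change fderiv ℝ z₀ x (X x) = 0
      rw [hX, map_sub, map_smul, smul_eq_mul, div_mul_cancel₀ _ hgx, sub_self]
    · exact hsm (h.mem_characteristic i).1 x hx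
    · exact (h.mem_characteristic i).1.2 x hx
    · exact hc i
  have hind : LinearIndependent ℝ fun i => Y i x₀ := by
    have h1 : (fun i => Y i x₀) = Fin.cons (X x₀) fun i => c i x₀ :=
      funext (Fin.cases rfl fun i => rfl)
    rw [h1]
    refine linearIndependent_finCons.2 ⟨h.linearIndependent, fun hmem => hVQ ?_⟩
    have h2 : V x₀ = X x₀ +
        (fderiv ℝ z₀ x₀ (V x₀) / fderiv ℝ z₀ x₀ (S.g a x₀)) • S.g a x₀ :=
      (sub_add_cancel _ _).symm
    rw [h2]
    exact Submodule.add_mem_sup hmem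
      (Submodule.smul_mem _ _ (Submodule.mem_span_singleton_self _))
  have hinde : ∀ᶠ x in 𝓝 x₀, LinearIndependent ℝ fun i => Y i x := by
    have h1 : ContinuousAt (fun y i => Y i y) x₀ := continuousAt_pi.2 fun i =>
      (hY.self_of_nhds i).1.continuousAt
    exact h1.eventually hind.eventually
  have hspan : ∀ᶠ x in 𝓝 x₀, ∀ v ∈ S.G U (k - 2) x, fderiv ℝ z₀ x v = 0 →
      v ∈ Submodule.span ℝ (range fun i => Y i x) := by
    filter_upwards [hUe, h.g_transverse hz₀ hg, hY, hinde] with x hx hgx hYx hix v hv hv0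
    exact h.mem_span_of_apply_eq_zero hx hgx hix (fun i => (hYx i).2.1) (fun i => (hYx i).2.2)
      hv hv0
  have hinv : ∀ i j, ∀ᶠ x in 𝓝 x₀,
      VectorField.lieBracket ℝ (Y i) (Y j) x ∈ Submodule.span ℝ (range fun l => Y l x) := by
    intro i j
    filter_upwards [hUe, hz₀, hspan, hY.eventually_nhds] with x hx hz hsp hYx
    refine hsp _ ?_ ?_
    · have hchar : ∀ (i : Fin r) j,
          VectorField.lieBracket ℝ (c i) (Y j) x ∈ S.G U (k - 2) x := fun i j =>
        lieBracket_mem_of_mem_characteristicFields (h.mem_characteristic i) hx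
          (hYx.mono fun y hy => ⟨(hy j).1, (hy j).2.1⟩)
      refine Fin.cases (Fin.cases ?_ (fun j => ?_) j) (fun i => hchar i j) i
      · rw [VectorField.lieBracket_self]
        exact Submodule.zero_mem _
      · rw [VectorField.lieBracket_swap]
        exact Submodule.neg_mem _ (hchar j 0)
    · have h1 : ∀ i, (fun y => fderiv ℝ z₀ y (Y i y)) =ᶠ[𝓝 x] fun _ => 0 := fun i =>
        hYx.mono fun y hy => (hy i).2.2
      rw [fderiv_lieBracket_apply hz (hYx.self_of_nhds i).1 (hYx.self_of_nhds j).1,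
        (h1 i).fderiv_eq, (h1 j).fderiv_eq]
      simp
  obtain ⟨ξ, hξ0, hξ⟩ := Submodule.exists_le_ker_of_lt_top _
    (lt_top_iff_ne_top.2 (h.ne_top x₀ h.mem_U))
  obtain ⟨z₁, hz₁, hd₁, hz₁Y⟩ := exists_firstIntegral_of_involutive Y
    (fun i => hY.mono fun x hx => (hx i).1) hinv hind (LinearMap.toContinuousLinearMap ξ)
    fun i => hξ (hY.self_of_nhds i).2.1
  have hGle : ∀ᶠ x in 𝓝 x₀, S.G U (k - 2) x ≤
      contactDistribution (contactSequence z₀ z₁ (S.g a)) 1 x := by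
    filter_upwards [hUe, h.g_transverse hz₀ hg, hspan, eventually_all.2 hz₁Y] with
      x hx hgx hsp hz₁x v hv m hm1 hm2
    obtain rfl : m = 1 := by omega
    set v' := v - (fderiv ℝ z₀ x v / fderiv ℝ z₀ x (S.g a x)) • S.g a x with hv'
    have h1 : fderiv ℝ z₀ x v' = 0 := by
      rw [hv', map_sub, map_smul, smul_eq_mul, div_mul_cancel₀ _ hgx, sub_self]
    have h2 : v' ∈ Submodule.span ℝ (range fun i => Y i x) := hsp v'
      (Submodule.sub_mem _ hv (Submodule.smul_mem _ _ (h.g_mem_sections.2 x hx))) h1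
    have h3 : fderiv ℝ z₁ x v' = 0 := by
      refine LinearMap.mem_ker.1 ((Submodule.span_le
        (p := LinearMap.ker (fderiv ℝ z₁ x : (Fin (k + 1) → ℝ) →ₗ[ℝ] ℝ))).2 ?_ h2)
      rintro _ ⟨i, rfl⟩
      exact hz₁x i
    have h4 : contactForm (contactSequence z₀ z₁ (S.g a)) 1 x v' =
      fderiv ℝ z₁ x v' - _ * fderiv ℝ z₀ x v' := rfl
    rw [h1, h3, mul_zero, sub_zero, hv', map_sub, map_smul,
      contactForm_contactSequence hgx le_rfl, smul_zero, sub_zero] at h4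
    exact h4
  obtain ⟨N, hN, hNo, hxN⟩ := eventually_nhds_iff.1
    (hUe.and (hz₀.and (hz₁.and ((h.g_transverse hz₀ hg).and hGle))))
  refine ⟨N, contactSequence z₀ z₁ (S.g a), h.isOpen_U, h.subset_X, hNo,
    fun x hx => (hN x hx).1, hxN, fun m x hx => ?_, fun x hx => (hN x hx).2.2.2.1,
    fun m hm x hx => contactForm_contactSequence (hN x hx).2.2.2.1 hm,
    fun x hx => (hN x hx).2.2.2.2, ?_⟩
  · obtain ⟨hxU, h1, h2, h3, -⟩ := hN x hx
    exact contDiffAt_contactSequence h1 h2 (hsm h.g_mem_sections x hxU) h3 m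
  · by_contra! hcon
    refine hξ0 (LinearMap.ext fun v => ?_)
    have h1 : contactForm (contactSequence z₀ z₁ (S.g a)) 1 x₀ v = fderiv ℝ z₁ x₀ v -
      fderiv ℝ z₁ x₀ (S.g a x₀) / fderiv ℝ z₀ x₀ (S.g a x₀) * fderiv ℝ z₀ x₀ v := rfl
    have h2 : ∀ v, fderiv ℝ z₁ x₀ v = ξ v := fun v => by rw [hd₁]; rfl
    have h3 : ξ (S.g a x₀) = 0 := hξ (h.g_mem_sections.2 x₀ h.mem_U)
    rw [hcon v, h2, h2, h3, zero_div, zero_mul, sub_zero] at h1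
    exact h1.symm

end IsCharacteristicFrame

end FirstCoordinates

theorem mainTheorem1 (k : ℕ) (hk : 3 ≤ k) (S : ControlAffineSystem (k + 1))
    (x₀ : Fin (k + 1) → ℝ) (hx₀ : x₀ ∈ S.X) :
    (∃ (T : ControlAffineSystem (k + 1)) (z₀ : Fin (k + 1) → ℝ),
        IsTriangularChainedForm T ∧ StaticFeedbackEquivalent S x₀ T z₀) ↔
      ∃ U : Set (Fin (k + 1) → ℝ), IsOpen U ∧ x₀ ∈ U ∧ U ⊆ S.X ∧
        S.Ch1 U ∧ S.Ch2 U ∧ S.Ch3 U x₀ ∧ S.Comp U := by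
  constructor
  · rintro ⟨T, z₀, hT, hST⟩
    exact conditions_of_staticFeedbackEquivalent hk S T x₀ z₀ hT hST
  · rintro ⟨U, hU, hxU, hUX, hCh1, hCh2, hCh3, hComp⟩
    obtain ⟨a, r, c, hc⟩ := exists_isCharacteristicFrame hk hU hUX hxU hCh2 hCh3
    obtain ⟨N, z, hz⟩ := hc.exists_isContactSequence (hCh1 x₀ hxU)
    exact hz.exists_triangularChainedForm (by omega) (hCh1 x₀ hxU) hComp
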